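/- Let $\mathcal H$ be a finite-dimensional or separable infinite-dimensional complex Hilbert space. A state is a positive trace-class operator on $\mathcal H$ with unit trace, and $\|A\|_1=\mathrm{Tr}|A|$ is the trace norm. An ensemble $\{p_i,\rho_i\}$ is a finite or countable collection of states $\rho_i$ with a probability distribution $\{p_i\}$. Its Holevo quantity is $\chi(\{p_i,\rho_i\})=\sum_i p_iH(\rho_i\|\bar\rho)\in[0,+\infty]$, where $\bar\rho=\sum_ip_i\rho_i$ and $H(\cdot\|\cdot)$ is the quantum relative entropy. Write $\eta(x)=-x\log x$, $h_2(x)=\eta(x)+\eta(1-x)$ and $g(x)=(1+x)\,h_2\!\left(\frac{x}{1+x}\right)$. For nonnegative $x=\{x_i\}\in\ell_1$ and positive trace-class $A$ let $S(\{x_i\})=\sum_i\eta(x_i)-\eta(\sum_ix_i)$ and $H(A)=\mathrm{Tr}\,\eta(A)-\eta(\mathrm{Tr}A)$ be the homogeneous extensions of the Shannon and von Neumann entropies (with values in $[0,+\infty]$). Let $\{p_i,\rho_i\}$ be an ensemble of states on $\mathcal H$ and $\sigma$ any state on $\mathcal H$. Put $$\varepsilon=\tfrac12\sum_ip_i\|\rho_i-\sigma\|_1,\qquad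 t_i=\frac{p_i\|\rho_i-\sigma\|_1}{\sum_jp_j\|\rho_j-\sigma\|_1},\qquad \tau_i^{\pm}=\frac{2[\rho_i-\sigma]_\pm}{\|\rho_i-\sigma\|_1},$$ where $[\cdot]_\pm$ are the positive and negative parts and positions $i$ with $\rho_i=\sigma$ are omitted from $\{t_i,\tau_i^\pm\}$ (if $\varepsilon=0$, then $t_i=0$ for all $i$ and all quantities built from $\{t_i,\tau_i^\pm\}$ are $0$). Write $\chi=\chi(\{p_i,\rho_i\})$ and $\chi^\pm=\chi(\{t_i,\tau_i^\pm\})$. Then the following holds. 1. In $[0,+\infty]$ (with $0\cdot\infty=0$), $\chi+\varepsilon\chi^-\le\varepsilon\chi^++g(\varepsilon)$ and $\varepsilon\chi^+\le\chi+\varepsilon\chi^-+g(\varepsilon)$. In particular, if $\chi^+<\infty$, then $\chi,\chi^-<\infty$ and $$\bigl|\chi-\varepsilon(\chi^+-\chi^-)\bigr|\le g(\varepsilon).\tag{a}$$ 2. One has $\chi\le\varepsilon\chi^++g(\varepsilon)$, and if $\chi^-<\infty$, then $$\chi\le\varepsilon(\chi^+-\chi^-)+g(\varepsilon)\le\varepsilon\chi^++g(\varepsilon).\tag{b}$$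 3. One has $$\chi\le\varepsilon S(\{t_i\})+g(\varepsilon)=S\bigl(\{\tfrac12p_i\|\rho_i-\sigma\|_1\}\bigr)+g(\varepsilon),\tag{c}$$ $$\chi\le\varepsilon H\Bigl(\sum_it_i\tau_i^+\Bigr)+g(\varepsilon)=H\Bigl(\sum_ip_i[\rho_i-\sigma]_+\Bigr)+g(\varepsilon).\tag{d}$$ 4. Let $\dim\mathcal H\ge2$ and fix a finite or countable index set with at least two elements. The upper bounds in (a), (b) (both of them), (c) and (d) are tight, in the sense that the supremum of the ratio of the left-hand side to the upper bound, over all ensembles with this index set and all states $\sigma$ for which the inequality is considered (ratios $0/0$ and $\infty/\infty$ being disregarded), equals $1$. Moreover, for every $\varepsilon\in(0,1]$ there are such an ensemble and a state $\sigma$ with $\varepsilon=\frac12\sum_ip_i\|\rho_i-\sigma\|_1$, with $\chi$, $\chi^+$, $\chi^-$ finite, and with $$\chi-\varepsilon(\chi^+-\chi^-)=h_2(\varepsilon).$$ -/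

import Mathlib

open scoped InnerProductSpace ENNReal

noncomputable section

namespace HolevoBound

variable {ι : Type*} {H : Type*} [NormedAddCommGroup H] [InnerProductSpace ℂ H] [CompleteSpace H]

variable (H) in
/-- The index set of some orthonormal (Hilbert) basis of `H`. -/
def basisSet : Set H := (exists_hilbertBasis ℂ H).choose

variable (H) in
/-- Some orthonormal (Hilbert) basis of `H`. -/
def someBasis : HilbertBasis (basisSet H) ℂ H := (exists_hilbertBasis ℂ H).choose_spec.choose

/-- The trace `∑ i, ⟨i|A|i⟩ ∈ [0, ∞]` of a positive operator (it does not depend on the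
orthonormal basis). -/
def posTrace (A : H →L[ℂ] H) : ℝ≥0∞ :=
  ∑' i, ENNReal.ofReal (⟪someBasis H i, A (someBasis H i)⟫_ℂ).re

/-- The trace `Tr B = Tr B₊ - Tr B₋` of a self-adjoint operator at least one of whose parts
`B₊`, `B₋` has finite trace. -/
def saTrace (B : H →L[ℂ] H) : EReal := (posTrace B⁺ : EReal) - (posTrace B⁻ : EReal)

/-- The trace norm `‖A‖₁ = Tr |A|` of a trace-class operator. -/
def traceNorm (A : H →L[ℂ] H) : ℝ := (posTrace (CFC.abs A)).toReal

variable (H) in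
/-- Quantum states: positive operators of unit trace. -/
structure QState where
  op : H →L[ℂ] H
  nonneg : 0 ≤ op
  trace_eq_one : posTrace op = 1

variable (ι H) in
/-- Discrete ensembles of quantum states, indexed by `ι`. -/
structure Ensemble where
  p : ι → ℝ
  p_nonneg : ∀ i, 0 ≤ p i
  hasSum_p : HasSum p 1
  state : ι → QState H

/-- The orthonormal basis `b` consists of eigenvectors of `A`. -/
def IsEigenbasis {w : Set H} (b : HilbertBasis w ℂ H) (A : H →L[ℂ] H) : Prop :=
  ∀ i, ∃ l : ℝ, A (b i) = l • b i

/-- The eigenvalue of `A` on the eigenvector `v` (a unit vector). -/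
def eigval (A : H →L[ℂ] H) (v : H) : ℝ := (⟪v, A v⟫_ℂ).re

open Classical in
/-- `a log a - a log b + b - a ∈ [0, ∞]` for `a, b ≥ 0`, equal to `∞` if `a > 0 = b`. -/
def klTerm (a b : ℝ) : ℝ≥0∞ :=
  if b = 0 ∧ a ≠ 0 then ⊤
  else ENNReal.ofReal (a * Real.log a - a * Real.log b + b - a)

/-- The quantum relative entropy `H(ρ‖σ) = ∑ᵢ ⟨i| ρ log ρ - ρ log σ + σ - ρ |i⟩` (Lindblad's
form; for states `Tr σ - Tr ρ = 0`, so this is `∑ᵢ ⟨i| ρ log ρ - ρ log σ |i⟩`), where `|i⟩` is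
an orthonormal eigenbasis of `ρ`, and `⟨i| · |i⟩` is evaluated by expanding `|i⟩` over an
orthonormal eigenbasis `|j⟩` of `σ`. All terms of the double sum are nonnegative, and one of them
is `∞` exactly if the support of `ρ` is not contained in that of `σ`. The sum is the same for
all pairs of eigenbases; the infimum only serves to avoid choosing a pair. -/
def relEntropy (ρ σ : H →L[ℂ] H) : ℝ≥0∞ :=
  ⨅ (w : Set H) (v : Set H) (b : HilbertBasis w ℂ H) (c : HilbertBasis v ℂ H)
    (_ : IsEigenbasis b ρ) (_ : IsEigenbasis c σ),
    ∑' i, ∑' j, ENNReal.ofReal (‖⟪b i, c j⟫_ℂ‖ ^ 2) *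
      klTerm (eigval ρ (b i)) (eigval σ (c j))

/-- The Holevo quantity `∑ᵢ pᵢ H(ρᵢ‖ρ̄)`, `ρ̄ = ∑ⱼ pⱼ ρⱼ`. Positions of weight zero do not
contribute. -/
def holevo (p : ι → ℝ) (ρ : ι → H →L[ℂ] H) : ℝ≥0∞ :=
  ∑' i, ENNReal.ofReal (p i) * relEntropy (ρ i) (∑' j, p j • ρ j)

/-- The homogeneous extension `∑ᵢ η(xᵢ) - η(∑ᵢ xᵢ)`, `η(x) = -x log x`, of the Shannon entropy to
the positive cone of `ℓ¹`, with values in `[0, ∞]`. -/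
def shannon (x : ι → ℝ) : EReal :=
  ((∑' i, ENNReal.ofReal (Real.negMulLog (x i)) : ℝ≥0∞) : EReal)
    - ((∑' i, ENNReal.ofReal (-Real.negMulLog (x i)) : ℝ≥0∞) : EReal)
    - ((Real.negMulLog (∑' i, x i) : ℝ) : EReal)

/-- The homogeneous extension `Tr η(A) - η(Tr A)` of the von Neumann entropy to the positive cone
of the trace-class operators, with values in `[0, ∞]`. -/
def vonNeumann (A : H →L[ℂ] H) : EReal :=
  saTrace (cfc Real.negMulLog A) - ((Real.negMulLog (posTrace A).toReal : ℝ) : EReal)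

/-- `g(ε) = (1 + ε) h₂(ε / (1 + ε))`. -/
def gFun (ε : ℝ) : ℝ := (1 + ε) * Real.binEntropy (ε / (1 + ε))

namespace Ensemble

/-- The Holevo quantity of the ensemble. -/
def chi (E : Ensemble ι H) : ℝ≥0∞ := holevo E.p fun i => (E.state i).op

/-- The difference `ρᵢ - σ`. -/
def diff (E : Ensemble ι H) (σ : QState H) (i : ι) : H →L[ℂ] H := (E.state i).op - σ.op

/-- `ε = ½ ∑ᵢ pᵢ ‖ρᵢ - σ‖₁`. -/
def eps (E : Ensemble ι H) (σ : QState H) : ℝ :=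
  1 / 2 * ∑' i, E.p i * traceNorm (E.diff σ i)

/-- `tᵢ = pᵢ ‖ρᵢ - σ‖₁ / ∑ⱼ pⱼ ‖ρⱼ - σ‖₁`; it vanishes where `ρᵢ = σ`. -/
def t (E : Ensemble ι H) (σ : QState H) (i : ι) : ℝ :=
  E.p i * traceNorm (E.diff σ i) / ∑' j, E.p j * traceNorm (E.diff σ j)

/-- `τᵢ⁺ = 2 [ρᵢ - σ]₊ / ‖ρᵢ - σ‖₁`. -/
def tauPlus (E : Ensemble ι H) (σ : QState H) (i : ι) : H →L[ℂ] H :=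
  (2 / traceNorm (E.diff σ i)) • (E.diff σ i)⁺

/-- `τᵢ⁻ = 2 [ρᵢ - σ]₋ / ‖ρᵢ - σ‖₁`. -/
def tauMinus (E : Ensemble ι H) (σ : QState H) (i : ι) : H →L[ℂ] H :=
  (2 / traceNorm (E.diff σ i)) • (E.diff σ i)⁻

/-- The Holevo quantity of `{tᵢ, τᵢ⁺}`. -/
def chiPlus (E : Ensemble ι H) (σ : QState H) : ℝ≥0∞ := holevo (E.t σ) (E.tauPlus σ)

/-- The Holevo quantity of `{tᵢ, τᵢ⁻}`. -/
def chiMinus (E : Ensemble ι H) (σ : QState H) : ℝ≥0∞ := holevo (E.t σ) (E.tauMinus σ)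

end Ensemble

/-- The function `g` is a tight upper bound for the nonnegative function `f` on the set `S`:
`f ≤ g` on `S` and `sup f / g = 1`. Points with `0 / 0` or `∞ / ∞` do not influence the supremum,
as these quotients are `0` in `EReal`. -/
def IsTightBound {X : Type*} (S : Set X) (f g : X → EReal) : Prop :=
  (∀ x ∈ S, 0 ≤ f x ∧ f x ≤ g x) ∧ (⨆ x ∈ S, f x / g x) = 1

end HolevoBound

end

open HolevoBound

open scoped InnerProductSpace ENNReal

noncomputable section

set_option linter.unusedSectionVars false

namespace HolevoBound

variable {ι : Type*} {H : Type*} [NormedAddCommGroup H] [InnerProductSpace ℂ H] [CompleteSpace H]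

/-! ### Traces of positive operators -/

/-! The Jordan decomposition gives `ρᵢ + [ρᵢ - σ]₋ = σ + [ρᵢ - σ]₊`, so each of these operators `Cᵢ`
is split in two ways, `Cᵢ = Aᵢ + Nᵢ = Bᵢ + Pᵢ`, with `Tr Aᵢ = Tr Bᵢ = 1` and `Tr Nᵢ = Tr Pᵢ`. For
positive trace-class operators, with Lindblad's relative entropy, let `K(A, B) = H(A‖A+B) +
H(B‖A+B)` (`pairEntropy`). If `S`, `T` are the averages of `Aᵢ`, `Nᵢ`, Donald's identity evaluates
the total relative entropy of all `Aᵢ`, `Nᵢ` with respect to `S + T` in two ways: `∑ pᵢ H(Aᵢ‖S) + ∑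
pᵢ H(Nᵢ‖T) + K(S, T) = ∑ pᵢ K(Aᵢ, Nᵢ) + ∑ pᵢ H(Cᵢ‖S+T)` (`sum_relEntropy_add_pairEntropy`). The last
sum is the same for both splittings, so only the gaps `∑ pᵢ K(Aᵢ, Nᵢ) - K(S, T)` have to be
compared, and each lies between `0` and `g(ε)`. The lower bound is joint convexity. For the upper
bound, `K(Aᵢ, Nᵢ) ≤ Tr Cᵢ`, while `K(S, T)` is at least its value on the traces `1`, `ε`, which is
`1 + ε - g(ε)`. Since the Holevo quantity of the constant family `σ` is zero, this is one half of
(a); exchanging the two splittings gives the other half (`sum_relEntropy_le_of_add_eq_add`).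

The required properties of the relative entropy come from one formula. The scalar integrand `a log a
- a log s + s - a` is an integral over `θ` of quadratic-over-linear terms, and the operator version
of each such term is a supremum of functionals linear in `(A, B)`, indexed by finite rank operators
(`varSup`). This yields independence of the eigenbases, joint convexity for countable mixtures, and
approximation by compressions to finite-dimensional subspaces. Donald's identity is proved in finite
dimension by counting entropies and then passes to the limit. Identities are kept free of
subtraction in `[0, ∞]`, and only finite terms are cancelled.

Bounds (c) and (d) follow because a Holevo quantity is at most the Shannon entropy of the weights
and at most the von Neumann entropy of the average. For tightness, two orthogonal pure states with
weights `1 - ε`, `ε`, and `σ` equal to the first, give `χ = h₂(ε)` and `χ⁺ = χ⁻ = 0`; moreover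
`h₂(ε) / g(ε) → 1` as `ε → 0`. -/

lemma re_inner_nonneg {A : H →L[ℂ] H} (hA : 0 ≤ A) (x : H) : 0 ≤ (⟪x, A x⟫_ℂ).re :=
  ((ContinuousLinearMap.nonneg_iff_isPositive A).1 hA).re_inner_nonneg_right x

lemma inner_apply_comm {A : H →L[ℂ] H} (hA : IsSelfAdjoint A) (x y : H) :
    ⟪A x, y⟫_ℂ = ⟪x, A y⟫_ℂ :=
  ContinuousLinearMap.isSelfAdjoint_iff_isSymmetric.1 hA x y

lemma tsum_norm_inner_sq {w : Type*} (b : HilbertBasis w ℂ H) (x : H) :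
    ∑' i, ENNReal.ofReal (‖⟪b i, x⟫_ℂ‖ ^ 2) = ENNReal.ofReal (‖x‖ ^ 2) := by
  have h := b.hasSum_inner_mul_inner x x
  have h2 : HasSum (fun i => ‖⟪b i, x⟫_ℂ‖ ^ 2) (‖x‖ ^ 2) := by
    have h3 := Complex.hasSum_re h
    convert h3 using 1
    · ext i
      rw [← inner_conj_symm x (b i), RCLike.conj_mul]
      norm_cast
    · rw [inner_self_eq_norm_sq_to_K]; norm_cast
  rw [← h2.tsum_eq, ENNReal.ofReal_tsum_of_nonneg (fun _ => by positivity) h2.summable]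

lemma inner_sqrt_apply {A : H →L[ℂ] H} (hA : 0 ≤ A) (x : H) :
    (⟪x, A x⟫_ℂ).re = ‖CFC.sqrt A x‖ ^ 2 := by
  have h1 : A x = CFC.sqrt A (CFC.sqrt A x) := by
    conv_lhs => rw [← CFC.sqrt_mul_sqrt_self A hA]
    rfl
  rw [h1, ← inner_apply_comm (CFC.sqrt_nonneg A).isSelfAdjoint, inner_self_eq_norm_sq_to_K]
  norm_cast

/-- By Parseval both sides are the double sum of `|⟨c j, S (b i)⟩|²`. With `S` the square root of a
positive operator this makes the trace independent of the basis. -/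
lemma tsum_norm_sq_comm {v w : Type*} (b : HilbertBasis v ℂ H) (c : HilbertBasis w ℂ H)
    {S : H →L[ℂ] H} (hS : IsSelfAdjoint S) :
    ∑' i, ENNReal.ofReal (‖S (b i)‖ ^ 2) = ∑' j, ENNReal.ofReal (‖S (c j)‖ ^ 2) := by
  simp_rw [← tsum_norm_inner_sq c (S (b _)), ← tsum_norm_inner_sq b (S (c _))]
  rw [ENNReal.tsum_comm]
  congr! 6 with j i
  rw [← inner_apply_comm hS, ← inner_conj_symm, RCLike.norm_conj]

/-- The trace of a positive operator can be computed in every orthonormal basis. -/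
lemma posTrace_eq {A : H →L[ℂ] H} (hA : 0 ≤ A) {w : Type*} (b : HilbertBasis w ℂ H) :
    posTrace A = ∑' i, ENNReal.ofReal (⟪b i, A (b i)⟫_ℂ).re := by
  unfold posTrace
  simp_rw [inner_sqrt_apply hA]
  exact tsum_norm_sq_comm _ _ (CFC.sqrt_nonneg A).isSelfAdjoint

@[simp] lemma posTrace_zero : posTrace (0 : H →L[ℂ] H) = 0 := by simp [posTrace]

lemma posTrace_add {A B : H →L[ℂ] H} (hA : 0 ≤ A) (hB : 0 ≤ B) :
    posTrace (A + B) = posTrace A + posTrace B := by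
  unfold posTrace
  rw [← ENNReal.tsum_add]
  congr with i
  rw [add_apply, inner_add_right, Complex.add_re,
    ENNReal.ofReal_add (re_inner_nonneg hA _) (re_inner_nonneg hB _)]

lemma posTrace_smul (A : H →L[ℂ] H) {r : ℝ} (hr : 0 ≤ r) :
    posTrace (r • A) = ENNReal.ofReal r * posTrace A := by
  unfold posTrace
  rw [← ENNReal.tsum_mul_left]
  congr with i
  rw [smul_apply, inner_smul_right_eq_smul, Complex.smul_re,
    smul_eq_mul, ENNReal.ofReal_mul hr]

lemma hasSum_re_inner {κ : Type*} {A : κ → H →L[ℂ] H} {S : H →L[ℂ] H} (hS : HasSum A S)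
    (x y : H) : HasSum (fun k => ⟪x, A k y⟫_ℂ) ⟪x, S y⟫_ℂ :=
  ((innerSL ℂ x).comp (ContinuousLinearMap.apply ℂ H y)).hasSum hS

lemma nonneg_of_hasSum {κ : Type*} {A : κ → H →L[ℂ] H} {S : H →L[ℂ] H} (hS : HasSum A S)
    (hA : ∀ k, 0 ≤ A k) : 0 ≤ S :=
  hasSum_mono (f := fun _ => 0) hasSum_zero hS hA

lemma ofReal_re_inner_of_hasSum {κ : Type*} {A : κ → H →L[ℂ] H} {S : H →L[ℂ] H}
    (hS : HasSum A S) (hA : ∀ k, 0 ≤ A k) (x : H) :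
    ENNReal.ofReal (⟪x, S x⟫_ℂ).re = ∑' k, ENNReal.ofReal (⟪x, A k x⟫_ℂ).re := by
  have h := Complex.hasSum_re (hasSum_re_inner hS x x)
  rw [← h.tsum_eq, ENNReal.ofReal_tsum_of_nonneg (fun k => re_inner_nonneg (hA k) x) h.summable]

lemma posTrace_of_hasSum {κ : Type*} {A : κ → H →L[ℂ] H} {S : H →L[ℂ] H}
    (hS : HasSum A S) (hA : ∀ k, 0 ≤ A k) : posTrace S = ∑' k, posTrace (A k) := by
  unfold posTrace
  rw [ENNReal.tsum_comm]
  congr with i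
  exact ofReal_re_inner_of_hasSum hS hA _

/-- Parseval, then Cauchy–Schwarz in each term: the Hilbert–Schmidt norm of the square root
dominates its operator norm. -/
lemma norm_sqrt_apply_sq_le {A : H →L[ℂ] H} (hA : 0 ≤ A) (x : H) :
    ENNReal.ofReal (‖CFC.sqrt A x‖ ^ 2) ≤ posTrace A * ENNReal.ofReal (‖x‖ ^ 2) := by
  rw [← tsum_norm_inner_sq (someBasis H), posTrace, ← ENNReal.tsum_mul_right]
  refine ENNReal.tsum_le_tsum fun i => ?_
  rw [← inner_apply_comm (CFC.sqrt_nonneg A).isSelfAdjoint, inner_sqrt_apply hA,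
    ← ENNReal.ofReal_mul (by positivity), ← mul_pow]
  gcongr
  exact norm_inner_le_norm _ _

/-- Besides forcing positive operators of trace zero to vanish, this turns trace bounds into norm
summability of the averages of an ensemble. -/
lemma norm_le_posTrace {A : H →L[ℂ] H} (hA : 0 ≤ A) :
    ENNReal.ofReal ‖A‖ ≤ posTrace A := by
  by_cases ht : posTrace A = ⊤
  · simp [ht]
  obtain ⟨t, ht'⟩ : ∃ t : NNReal, posTrace A = t := ⟨_, (ENNReal.coe_toNNReal ht).symm⟩
  have h1 : ∀ x, ‖CFC.sqrt A x‖ ^ 2 ≤ t * ‖x‖ ^ 2 := fun x => by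
    have h := norm_sqrt_apply_sq_le hA x
    rw [ht', ← ENNReal.ofReal_coe_nnreal, ← ENNReal.ofReal_mul (by positivity)] at h
    exact (ENNReal.ofReal_le_ofReal_iff (by positivity)).1 h
  have h2 : ‖CFC.sqrt A‖ ≤ Real.sqrt t := by
    refine ContinuousLinearMap.opNorm_le_bound _ (Real.sqrt_nonneg _) fun x => ?_
    have := Real.sqrt_le_sqrt (h1 x)
    rwa [Real.sqrt_sq (norm_nonneg _), Real.sqrt_mul (by positivity),
      Real.sqrt_sq (norm_nonneg _)] at this
  have h3 : ‖A‖ ≤ t := by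
    rw [← CFC.sqrt_mul_sqrt_self A hA]
    calc _ ≤ ‖CFC.sqrt A‖ * ‖CFC.sqrt A‖ := norm_mul_le _ _
      _ ≤ Real.sqrt t * Real.sqrt t := by gcongr
      _ = t := Real.mul_self_sqrt (by positivity)
  rw [ht', ← ENNReal.ofReal_coe_nnreal]
  exact ENNReal.ofReal_le_ofReal h3

lemma eq_zero_of_posTrace_eq_zero {A : H →L[ℂ] H} (hA : 0 ≤ A) (h : posTrace A = 0) : A = 0 := by
  have := norm_le_posTrace hA
  rw [h, nonpos_iff_eq_zero, ENNReal.ofReal_eq_zero] at this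
  exact norm_le_zero_iff.1 this

/-- Positive trace-class operators are compact. -/
lemma isCompactOperator_of_posTrace_ne_top {A : H →L[ℂ] H} (hA : 0 ≤ A)
    (ht : posTrace A ≠ ⊤) : IsCompactOperator A := by
  set S := CFC.sqrt A with hS
  have hSsa : IsSelfAdjoint S := (CFC.sqrt_nonneg A).isSelfAdjoint
  set b := someBasis H
  -- `T F` is `S` followed by the projection onto the span of the `b i` with `i ∈ F`. The squared
  -- norm of `S - T F` is at most a tail of the convergent series for the trace, so `S` is a norm
  -- limit of finite rank operators.
  let T : Finset (basisSet H) → H →L[ℂ] H := fun F =>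
    ∑ i ∈ F, InnerProductSpace.rankOne ℂ (b i) (S (b i))
  have hTc : ∀ F, IsCompactOperator (T F) := fun F => by
    have : ∀ x y : H, IsCompactOperator (InnerProductSpace.rankOne ℂ x y) := fun x y => by
      rw [InnerProductSpace.rankOne_def']
      have h := isCompactOperator_of_locallyCompactSpace_rng
        (ContinuousLinearMap.toSpanSingleton ℂ x)
      exact h.comp_clm (innerSL ℂ y)
    have h2 : T F ∈ compactOperator (RingHom.id ℂ) H H :=
      Submodule.sum_mem _ fun i _ => this _ _
    exact h2
  have hsum : ∑' i, ENNReal.ofReal (‖S (b i)‖ ^ 2) ≠ ⊤ := by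
    rw [posTrace] at ht
    simp_rw [inner_sqrt_apply hA] at ht
    exact ht
  have hbound : ∀ F : Finset (basisSet H), ∀ x : H, ENNReal.ofReal (‖(S - T F) x‖ ^ 2) ≤
      (∑' i : {i // i ∉ F}, ENNReal.ofReal (‖S (b i)‖ ^ 2)) * ENNReal.ofReal (‖x‖ ^ 2) := by
    classical
    intro F x
    rw [← tsum_norm_inner_sq b, ← ENNReal.tsum_mul_right]
    have hz : ∀ i, ⟪b i, (S - T F) x⟫_ℂ = if i ∈ F then 0 else ⟪S (b i), x⟫_ℂ := by
      intro i
      have hon := b.orthonormal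
      rw [sub_apply, inner_sub_right, ← inner_apply_comm hSsa]
      simp only [T, sum_apply, InnerProductSpace.rankOne_apply, inner_sum,
        inner_smul_right, orthonormal_iff_ite.1 hon]
      split_ifs with hi <;> simp [hi]
    rw [← tsum_subtype_eq_of_support_subset (s := {i | i ∉ F})]
    · refine ENNReal.tsum_le_tsum fun i => ?_
      rw [hz, if_neg i.2, ← ENNReal.ofReal_mul (by positivity), ← mul_pow]
      gcongr
      exact norm_inner_le_norm _ _
    · intro i hi
      by_contra hF
      rw [Set.mem_ofPred_eq, not_not] at hF
      exact hi (by simp only [hz, if_pos hF]; simp)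
  have htend : Filter.Tendsto T Filter.atTop (nhds S) := by
    have h0 := ENNReal.tendsto_tsum_compl_atTop_zero hsum
    rw [tendsto_iff_norm_sub_tendsto_zero]
    rw [Metric.tendsto_nhds]
    intro ε hε
    have hε' : (0 : ℝ≥0∞) < ENNReal.ofReal ((ε / 2) ^ 2) := by
      rw [ENNReal.ofReal_pos]; positivity
    filter_upwards [h0.eventually_lt_const hε'] with F hF
    have : ‖S - T F‖ ≤ ε / 2 := by
      refine ContinuousLinearMap.opNorm_le_bound _ (by positivity) fun x => ?_
      have h := (hbound F x).trans (mul_le_mul_left hF.le _)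
      rw [← ENNReal.ofReal_mul (by positivity),
        ENNReal.ofReal_le_ofReal_iff (by positivity), ← mul_pow] at h
      exact (pow_le_pow_iff_left₀ (by positivity) (by positivity) two_ne_zero).1 h
    rw [dist_zero_right, norm_norm, norm_sub_rev]
    linarith
  have hSc : IsCompactOperator S := isCompactOperator_of_tendsto htend (.of_forall hTc)
  have : IsCompactOperator (S * S : H →L[ℂ] H) := hSc.comp_clm S
  rwa [hS, CFC.sqrt_mul_sqrt_self A hA] at this

/-! ### Eigenbases -/

lemma IsEigenbasis.apply_eq {w : Set H} {b : HilbertBasis w ℂ H} {A : H →L[ℂ] H}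
    (hb : IsEigenbasis b A) (i : w) : A (b i) = (eigval A (b i)) • b i := by
  obtain ⟨l, hl⟩ := hb i
  rw [eigval, hl, inner_smul_right_eq_smul, inner_self_eq_norm_sq_to_K, b.orthonormal.1 i]
  simp

lemma eigval_nonneg {A : H →L[ℂ] H} (hA : 0 ≤ A) (v : H) : 0 ≤ eigval A v := re_inner_nonneg hA v

lemma posTrace_eq_tsum_eigval {A : H →L[ℂ] H} (hA : 0 ≤ A) {w : Type*} (b : HilbertBasis w ℂ H) :
    posTrace A = ∑' i, ENNReal.ofReal (eigval A (b i)) := posTrace_eq hA b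

/-- The **spectral theorem** for compact self-adjoint operators, in terms of a Hilbert basis. -/
lemma exists_isEigenbasis {A : H →L[ℂ] H} (hA : IsSelfAdjoint A) (hc : IsCompactOperator A) :
    ∃ (w : Set H) (b : HilbertBasis w ℂ H), IsEigenbasis b A := by
  classical
  have hsym : (A : H →ₗ[ℂ] H).IsSymmetric :=
    ContinuousLinearMap.isSelfAdjoint_iff_isSymmetric.1 hA
  -- All complex `μ` are admitted: where `μ` is not an eigenvalue the space is zero and its basis is
  -- empty.
  let V : ℂ → Submodule ℂ H := fun μ => Module.End.eigenspace (A : Module.End ℂ H) μ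
  have hVc : ∀ μ, CompleteSpace (V μ) := fun μ => by
    have : IsClosed (V μ : Set H) := by
      have : (V μ : Set H) = {x | A x = μ • x} := by
        ext x; exact Module.End.mem_eigenspace_iff
      rw [this]
      exact isClosed_eq A.continuous (continuous_const_smul μ)
    exact this.completeSpace_coe
  choose W B hB using fun μ => exists_hilbertBasis ℂ (V μ)
  let f : (Σ μ, W μ) → H := fun i => (B i.1 i.2 : H)
  have hof : OrthogonalFamily ℂ (fun μ => V μ) fun μ => (V μ).subtypeₗᵢ :=
    hsym.orthogonalFamily_eigenspaces
  have hf : Orthonormal ℂ f := by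
    refine hof.orthonormal_sigma_orthonormal (v_family := fun μ i => B μ i) fun μ => ?_
    exact (B μ).orthonormal
  have hfe : ∀ i, A (f i) = i.1 • f i := fun i =>
    Module.End.mem_eigenspace_iff.1 (B i.1 i.2).2
  -- A vector orthogonal to the bases of all eigenspaces is orthogonal to the eigenspaces
  -- themselves, and for a compact self-adjoint operator these span a dense subspace.
  have hspan : (Submodule.span ℂ (Set.range f))ᗮ = ⊥ := by
    rw [eq_bot_iff, ← ContinuousLinearMap.orthogonalComplement_iSup_eigenspaces_eq_bot hc hsym]
    intro x hx
    rw [Submodule.mem_orthogonal'] at hx ⊢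
    have : (⨆ μ, V μ) ≤ LinearMap.ker (innerSL ℂ x : H →ₗ[ℂ] ℂ) := by
      refine iSup_le fun μ y hy => ?_
      have hs := (B μ).hasSum_repr ⟨y, hy⟩
      have hs2 := ((innerSL ℂ x).comp (V μ).subtypeL).hasSum hs
      have h0 : ∀ i, ((innerSL ℂ x).comp (V μ).subtypeL) ((B μ).repr ⟨y, hy⟩ i • B μ i) = 0 := by
        intro i
        have := hx (f ⟨μ, i⟩) (Submodule.subset_span ⟨_, rfl⟩)
        simp only [map_smul, ContinuousLinearMap.comp_apply, innerSL_apply_apply]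
        simpa [f] using Or.inr this
      have hs3 := hs2.congr_fun fun i => (h0 i).symm
      exact hs3.unique hasSum_zero
    exact fun u hu => this hu
  have hinj : Function.Injective f := hf.linearIndependent.injective
  let e := Equiv.ofInjective f hinj
  have hg : Orthonormal ℂ ((↑) : Set.range f → H) := by
    have := hf.comp e.symm e.symm.injective
    convert this using 1
    ext i
    exact congrArg Subtype.val (e.apply_symm_apply i).symm
  refine ⟨Set.range f, HilbertBasis.mkOfOrthogonalEqBot hg (by rwa [Subtype.range_coe]), ?_⟩
  rintro ⟨_, i, rfl⟩
  rw [HilbertBasis.coe_mkOfOrthogonalEqBot]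
  refine ⟨i.1.re, ?_⟩
  show A (f i) = _
  rw [hfe]
  have hne : f i ≠ 0 := hf.ne_zero i
  have hr : (starRingEnd ℂ) i.1 = i.1 := hsym.conj_eigenvalue_eq_self
    (Module.End.hasEigenvalue_of_hasEigenvector ⟨Module.End.mem_eigenspace_iff.2 (hfe i), hne⟩)
  conv_lhs => rw [← Complex.conj_eq_iff_re.1 hr]
  rfl

lemma exists_isEigenbasis_of_posTrace_ne_top {A : H →L[ℂ] H} (hA : 0 ≤ A)
    (ht : posTrace A ≠ ⊤) : ∃ (w : Set H) (b : HilbertBasis w ℂ H), IsEigenbasis b A :=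
  exists_isEigenbasis hA.isSelfAdjoint (isCompactOperator_of_posTrace_ne_top hA ht)

/-- Distinct basis vectors are at distance `√2`, so the balls of radius `1/2` around them are
disjoint. Countability is what permits exchanging sums over bases with integrals over `θ`. -/
lemma countable_of_hilbertBasis [TopologicalSpace.SeparableSpace H] {w : Type*}
    (b : HilbertBasis w ℂ H) : Countable w := by
  refine Pairwise.countable_of_isOpen_disjoint (s := fun i => Metric.ball (b i) (1 / 2)) ?_
    (fun _ => Metric.isOpen_ball) (fun i => ⟨b i, Metric.mem_ball_self (by norm_num)⟩)
  intro i j hij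
  refine Metric.ball_disjoint_ball ?_
  have h : ‖b i - b j‖ ^ 2 = 2 := by
    rw [@norm_sub_sq ℂ, b.orthonormal.1 i, b.orthonormal.1 j, b.orthonormal.2 hij]
    norm_num
  rw [dist_eq_norm]
  nlinarith [norm_nonneg (b i - b j)]

/-! ### An integral representation of `klTerm` -/

/-- The integrand of the representation of `klTerm` as an integral of `χ²`-divergences. -/
def chiSqTerm (θ a s : ℝ) : ℝ := (a - s) ^ 2 / (θ * a + (1 - θ) * s)

lemma chiSqTerm_nonneg {θ a s : ℝ} (h0 : 0 < θ) (h1 : θ < 1) (ha : 0 ≤ a) (hs : 0 ≤ s) :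
    0 ≤ chiSqTerm θ a s := by
  have : 0 ≤ 1 - θ := by linarith
  unfold chiSqTerm; positivity

lemma measurable_chiSqTerm (a s : ℝ) : Measurable fun θ => chiSqTerm θ a s := by
  unfold chiSqTerm; fun_prop

/-- The integrand equals `a (a - s) / (s + θ (a - s)) - (a - s)`, with antiderivative `a log (s + θ
(a - s)) - (a - s) θ`. For `s = 0 < a` it is `a (1/θ - 1)`, and both sides are infinite. The gain is
that the logarithms are replaced by quadratic-over-linear terms, which have a variational formula.
-/
lemma lintegral_chiSqTerm {a s : ℝ} (ha : 0 ≤ a) (hs : 0 ≤ s) :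
    ∫⁻ θ in Set.Ioo (0 : ℝ) 1, ENNReal.ofReal (1 - θ) * ENNReal.ofReal (chiSqTerm θ a s)
      = klTerm a s := by
  rcases hs.eq_or_lt with rfl | hs
  · rcases ha.eq_or_lt with rfl | ha
    · simp [chiSqTerm, klTerm]
    · rw [klTerm, if_pos ⟨rfl, ha.ne'⟩]
      by_contra hne
      have h1 : ∀ θ ∈ Set.Ioo (0 : ℝ) 1, ENNReal.ofReal (1 - θ) *
          ENNReal.ofReal (chiSqTerm θ a 0) = ENNReal.ofReal (a * (θ⁻¹ - 1)) := by
        intro θ hθ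
        rw [← ENNReal.ofReal_mul (by linarith [hθ.2])]
        congr 1
        have := hθ.1.ne'
        unfold chiSqTerm
        field_simp
        ring
      rw [MeasureTheory.setLIntegral_congr_fun measurableSet_Ioo h1] at hne
      have h2 : MeasureTheory.IntegrableOn (fun θ : ℝ => a * (θ⁻¹ - 1)) (Set.Ioo 0 1) := by
        refine ⟨by fun_prop, ?_⟩
        rw [MeasureTheory.hasFiniteIntegral_iff_ofReal]
        · exact lt_top_iff_ne_top.2 hne
        · filter_upwards [MeasureTheory.ae_restrict_mem measurableSet_Ioo] with θ hθ
          have := (one_lt_inv₀ hθ.1).2 hθ.2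
          exact mul_nonneg ha.le (by linarith)
      have h3 : MeasureTheory.IntegrableOn (fun θ : ℝ => θ⁻¹) (Set.Ioo 0 1) := by
        have h4 : MeasureTheory.IntegrableOn (fun _ : ℝ => (1 : ℝ)) (Set.Ioo 0 1) := by simp
        have := (h2.const_mul a⁻¹).add h4
        refine this.congr (.of_forall fun θ => ?_)
        simp [ha.ne']
      have h4 : IntervalIntegrable (fun θ : ℝ => θ⁻¹) MeasureTheory.volume 0 1 :=
        (intervalIntegrable_iff_integrableOn_Ioo_of_le zero_le_one).2 h3
      rw [intervalIntegrable_inv_iff] at h4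
      simp at h4
  · rw [klTerm, if_neg (fun h => hs.ne' h.1)]
    -- The denominator vanishes on `[0, 1]` only at `θ = 1` with `a = 0`; apart from that case, the
    -- integrand is continuous on the closed interval.
    have hw : ∀ θ ∈ Set.Icc (0 : ℝ) 1, 0 < s + θ * (a - s) ∨ (a = 0 ∧ θ = 1) := by
      intro θ hθ
      by_cases h : θ = 1
      · rcases ha.eq_or_lt with rfl | ha
        · exact Or.inr ⟨rfl, h⟩
        · left; rw [h]; linarith
      · left
        have : θ < 1 := lt_of_le_of_ne hθ.2 h
        nlinarith [mul_nonneg hθ.1 ha, mul_pos (sub_pos.2 this) hs]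
    have h1 : ∀ θ ∈ Set.Ioo (0 : ℝ) 1, ENNReal.ofReal (1 - θ) *
          ENNReal.ofReal (chiSqTerm θ a s)
            = ENNReal.ofReal (a * ((a - s) / (s + θ * (a - s))) - (a - s)) := by
      intro θ hθ
      rw [← ENNReal.ofReal_mul (by linarith [hθ.2])]
      congr 1
      have hpos : s + θ * (a - s) ≠ 0 := by
        rcases hw θ ⟨hθ.1.le, hθ.2.le⟩ with h | h
        · exact h.ne'
        · exact absurd h.2 hθ.2.ne
      unfold chiSqTerm
      rw [show θ * a + (1 - θ) * s = s + θ * (a - s) by ring]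
      field_simp
      ring
    rw [MeasureTheory.setLIntegral_congr_fun measurableSet_Ioo h1]
    rcases ha.eq_or_lt with rfl | ha
    · simp
    have hwp : ∀ θ ∈ Set.Icc (0 : ℝ) 1, 0 < s + θ * (a - s) := fun θ hθ => by
      rcases hw θ hθ with h | h
      · exact h
      · exact absurd h.1 ha.ne'
    have hcont : ContinuousOn (fun θ : ℝ => a * ((a - s) / (s + θ * (a - s))) - (a - s))
        (Set.Icc 0 1) := by
      refine ContinuousOn.sub (ContinuousOn.mul continuousOn_const
        (ContinuousOn.div continuousOn_const (by fun_prop) fun θ hθ => (hwp θ hθ).ne'))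
        continuousOn_const
    have hInt : MeasureTheory.IntegrableOn
        (fun θ : ℝ => a * ((a - s) / (s + θ * (a - s))) - (a - s)) (Set.Icc 0 1) :=
      hcont.integrableOn_Icc
    have hval : ∫ θ in (0 : ℝ)..1, (a * ((a - s) / (s + θ * (a - s))) - (a - s))
        = (a * Real.log (s + 1 * (a - s)) - (a - s) * 1)
          - (a * Real.log (s + 0 * (a - s)) - (a - s) * 0) := by
      refine intervalIntegral.integral_eq_sub_of_hasDerivAt
        (f := fun θ => a * Real.log (s + θ * (a - s)) - (a - s) * θ) (fun θ hθ => ?_) ?_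
      · rw [Set.uIcc_of_le zero_le_one] at hθ
        have h := (((hasDerivAt_id θ).mul_const (a - s)).const_add s).log (hwp θ hθ).ne'
        convert (h.const_mul a).sub ((hasDerivAt_id θ).const_mul (a - s)) using 1
        · rfl
        · simp
      · exact (intervalIntegrable_iff_integrableOn_Icc_of_le zero_le_one).2 hInt
    rw [← MeasureTheory.ofReal_integral_eq_lintegral_ofReal
      (hInt.mono_set Set.Ioo_subset_Icc_self), ← MeasureTheory.integral_Ioc_eq_integral_Ioo,
      ← intervalIntegral.integral_of_le zero_le_one, hval]
    · congr 1
      simp only [one_mul, add_sub_cancel, zero_mul, add_zero, mul_one, mul_zero, sub_zero]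
      ring
    · filter_upwards [MeasureTheory.ae_restrict_mem measurableSet_Ioo] with θ hθ
      have hp := hwp θ ⟨hθ.1.le, hθ.2.le⟩
      show 0 ≤ a * ((a - s) / (s + θ * (a - s))) - (a - s)
      have : a * ((a - s) / (s + θ * (a - s))) - (a - s)
          = (1 - θ) * (a - s) ^ 2 / (s + θ * (a - s)) := by
        rw [eq_div_iff hp.ne', sub_mul, mul_assoc, div_mul_cancel₀ _ hp.ne']
        ring
      rw [this]
      have := hθ.2
      exact div_nonneg (mul_nonneg (by linarith) (sq_nonneg _)) hp.le

/-! ### A variational formula for the relative entropy -/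

/-- The functional `2 Re Tr Y*(A - B) - θ Tr Y*AY - (1 - θ) Tr YBY*` of the finite rank operator
`Y = ∑ₖ |uₖ⟩⟨vₖ|`. -/
def varForm {κ : Type*} [Fintype κ] (θ : ℝ) (u v : κ → H) (A B : H →L[ℂ] H) : ℝ :=
  2 * (∑ k, ⟪u k, (A - B) (v k)⟫_ℂ).re
    - θ * (∑ k, ∑ l, ⟪u k, A (u l)⟫_ℂ * ⟪v l, v k⟫_ℂ).re
    - (1 - θ) * (∑ k, ∑ l, ⟪u k, u l⟫_ℂ * ⟪v l, B (v k)⟫_ℂ).re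

/-- The supremum of `varForm` over all finite rank operators. -/
def varSup (θ : ℝ) (A B : H →L[ℂ] H) : ℝ≥0∞ :=
  ⨆ (n : ℕ) (u : Fin n → H) (v : Fin n → H), ENNReal.ofReal (varForm θ u v A B)

lemma ofReal_varForm_le_varSup {κ : Type*} [Fintype κ] (θ : ℝ) (u v : κ → H) (A B : H →L[ℂ] H) :
    ENNReal.ofReal (varForm θ u v A B) ≤ varSup θ A B := by
  let e := Fintype.equivFin κ
  have : varForm θ u v A B = varForm θ (u ∘ e.symm) (v ∘ e.symm) A B := by
    unfold varForm
    simp only [Function.comp_apply]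
    rw [← e.symm.sum_comp]
    congr 4
    · rw [← e.symm.sum_comp]
      exact Finset.sum_congr rfl fun k _ => by rw [← e.symm.sum_comp]
    · rw [← e.symm.sum_comp]
      exact Finset.sum_congr rfl fun k _ => by rw [← e.symm.sum_comp]
  rw [this]
  exact le_iSup_of_le _ (le_iSup_of_le _ (le_iSup_of_le _ le_rfl))

/-- Completing the square: for `J > 0` the left side is maximal at `y = (x / J) m`. For `J = 0` the
hypothesis removes the linear term as well, and `x ^ 2 / J` reads as `0`. -/
lemma two_mul_re_sub_le {x J : ℝ} (hJ : 0 ≤ J) (hx : J = 0 → x = 0) (y m : ℂ) :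
    2 * (x * (starRingEnd ℂ y * m).re) - J * ‖y‖ ^ 2 ≤ ‖m‖ ^ 2 * (x ^ 2 / J) := by
  rcases hJ.eq_or_lt with h | h
  · rw [← h, hx h.symm]; simp
  · have h1 : (starRingEnd ℂ y * m).re ≤ ‖y‖ * ‖m‖ := by
      refine (Complex.re_le_norm _).trans (by simp)
    have h2 : -(‖y‖ * ‖m‖) ≤ (starRingEnd ℂ y * m).re := by
      have := (Complex.abs_re_le_norm (starRingEnd ℂ y * m))
      rw [norm_mul, RCLike.norm_conj] at this
      exact (abs_le.1 this).1
    have h3 : x * (starRingEnd ℂ y * m).re ≤ |x| * (‖y‖ * ‖m‖) := by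
      rcases abs_cases x with ⟨h, h'⟩ | ⟨h, h'⟩ <;> rw [h] <;> nlinarith
    have h4 : 2 * (|x| * (‖y‖ * ‖m‖)) - J * ‖y‖ ^ 2 ≤ ‖m‖ ^ 2 * (x ^ 2 / J) := by
      rw [← mul_div_assoc, le_div_iff₀ h, ← sq_abs x]
      nlinarith [sq_nonneg (J * ‖y‖ - |x| * ‖m‖)]
    linarith

/-! ### Expansion of the variational functional in eigenbases. -/

section Expansion

variable {w v : Set H} {b : HilbertBasis w ℂ H} {c : HilbertBasis v ℂ H} {A B : H →L[ℂ] H}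

lemma IsEigenbasis.inner_apply (hb : IsEigenbasis b A) (hA : IsSelfAdjoint A) (i : w) (x : H) :
    ⟪b i, A x⟫_ℂ = eigval A (b i) * ⟪b i, x⟫_ℂ := by
  rw [← inner_apply_comm hA, hb.apply_eq, ← Complex.coe_smul, inner_smul_left, Complex.conj_ofReal]

variable {κ : Type*} [Fintype κ]

/-- The matrix element `⟨bᵢ|Y|cⱼ⟩` of `Y = ∑ₖ |xₖ⟩⟨yₖ|`. -/
def matElem (b : HilbertBasis w ℂ H) (c : HilbertBasis v ℂ H) (x y : κ → H) (i : w) (j : v) : ℂ :=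
  ∑ k, ⟪b i, x k⟫_ℂ * ⟪y k, c j⟫_ℂ

lemma conj_matElem (x y : κ → H) (i : w) (j : v) :
    starRingEnd ℂ (matElem b c x y i j) = ∑ k, ⟪x k, b i⟫_ℂ * ⟪c j, y k⟫_ℂ := by
  simp [matElem, map_sum]

lemma hasSum_conj_matElem_mul (x y : κ → H) (i : w) (T : H →L[ℂ] H) :
    HasSum (fun j => ∑ k, ⟪x k, b i⟫_ℂ * (⟪b i, c j⟫_ℂ * ⟪c j, T (y k)⟫_ℂ))
      (∑ k, ⟪x k, b i⟫_ℂ * ⟪b i, T (y k)⟫_ℂ) :=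
  hasSum_sum fun k _ => (c.hasSum_inner_mul_inner (b i) (T (y k))).mul_left _

lemma hasSum_norm_matElem_sq (x y : κ → H) (i : w) (T : H →L[ℂ] H) :
    HasSum (fun j => ∑ k, ∑ l, (⟪x k, b i⟫_ℂ * ⟪b i, x l⟫_ℂ) * (⟪y l, c j⟫_ℂ * ⟪c j, T (y k)⟫_ℂ))
      (∑ k, ∑ l, (⟪x k, b i⟫_ℂ * ⟪b i, x l⟫_ℂ) * ⟪y l, T (y k)⟫_ℂ) :=
  hasSum_sum fun k _ => hasSum_sum fun l _ => (c.hasSum_inner_mul_inner (y l) (T (y k))).mul_left _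

lemma norm_matElem_sq (x y : κ → H) (i : w) (j : v) :
    ((‖matElem b c x y i j‖ ^ 2 : ℝ) : ℂ)
      = ∑ k, ∑ l, (⟪x k, b i⟫_ℂ * ⟪b i, x l⟫_ℂ) * (⟪y l, c j⟫_ℂ * ⟪c j, y k⟫_ℂ) := by
  push_cast
  rw [← Complex.conj_mul', conj_matElem, matElem, Finset.sum_mul_sum]
  refine Finset.sum_congr rfl fun k _ => Finset.sum_congr rfl fun l _ => ?_
  ring

/-- The contribution of a pair of basis vectors to `varForm`. -/
def varTerm (θ : ℝ) (A B : H →L[ℂ] H) (b : HilbertBasis w ℂ H) (c : HilbertBasis v ℂ H)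
    (x y : κ → H) (i : w) (j : v) : ℝ :=
  2 * ((eigval A (b i) - eigval B (c j)) * (starRingEnd ℂ (matElem b c x y i j) * ⟪b i, c j⟫_ℂ).re)
    - (θ * eigval A (b i) + (1 - θ) * eigval B (c j)) * ‖matElem b c x y i j‖ ^ 2

/-- The contribution of a basis vector to `varForm`. -/
def varRow (θ : ℝ) (A B : H →L[ℂ] H) (b : HilbertBasis w ℂ H) (x y : κ → H) (i : w) : ℝ :=
  2 * (∑ k, ⟪x k, b i⟫_ℂ * ⟪b i, (A - B) (y k)⟫_ℂ).re
    - θ * (∑ k, ∑ l, (⟪x k, b i⟫_ℂ * ⟪b i, A (x l)⟫_ℂ) * ⟪y l, y k⟫_ℂ).re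
    - (1 - θ) * (∑ k, ∑ l, (⟪x k, b i⟫_ℂ * ⟪b i, x l⟫_ℂ) * ⟪y l, B (y k)⟫_ℂ).re

/-- Inserting the resolution of the identity given by `c` decouples the functional: each matrix
element of `Y` meets only its own pair of eigenvalues. -/
lemma hasSum_varTerm (hb : IsEigenbasis b A) (hc : IsEigenbasis c B) (hA : IsSelfAdjoint A)
    (hB : IsSelfAdjoint B) (θ : ℝ) (x y : κ → H) (i : w) :
    HasSum (fun j => varTerm θ A B b c x y i j) (varRow θ A B b x y i) := by
  have h1 := (hasSum_conj_matElem_mul (b := b) (c := c) x y i 1).mul_left (eigval A (b i) : ℂ)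
  have h2 := hasSum_conj_matElem_mul (b := b) (c := c) x y i B
  have h3 := (hasSum_norm_matElem_sq (b := b) (c := c) x y i 1).mul_left (eigval A (b i) : ℂ)
  have h4 := hasSum_norm_matElem_sq (b := b) (c := c) x y i B
  have h := ((Complex.hasSum_re (h1.sub h2)).mul_left 2).sub
    (((Complex.hasSum_re h3).mul_left θ).add ((Complex.hasSum_re h4).mul_left (1 - θ)))
  convert h using 1
  · rfl
  · ext j
    simp only [hc.inner_apply hB, one_apply_eq_self]
    have e1 : (eigval A (b i) : ℂ) * ∑ k, ⟪x k, b i⟫_ℂ * (⟪b i, c j⟫_ℂ * ⟪c j, y k⟫_ℂ)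
        - ∑ k, ⟪x k, b i⟫_ℂ * (⟪b i, c j⟫_ℂ * (eigval B (c j) * ⟪c j, y k⟫_ℂ))
        = ((eigval A (b i) - eigval B (c j) : ℝ) : ℂ)
          * (starRingEnd ℂ (matElem b c x y i j) * ⟪b i, c j⟫_ℂ) := by
      rw [conj_matElem, Finset.mul_sum, Finset.sum_mul, Finset.mul_sum, ← Finset.sum_sub_distrib]
      refine Finset.sum_congr rfl fun k _ => ?_
      push_cast; ring
    have e2 : ∑ k, ∑ l, (⟪x k, b i⟫_ℂ * ⟪b i, x l⟫_ℂ)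
          * (⟪y l, c j⟫_ℂ * (eigval B (c j) * ⟪c j, y k⟫_ℂ))
        = (eigval B (c j) : ℂ) * ((‖matElem b c x y i j‖ ^ 2 : ℝ) : ℂ) := by
      rw [norm_matElem_sq, Finset.mul_sum]
      refine Finset.sum_congr rfl fun k _ => ?_
      rw [Finset.mul_sum]
      refine Finset.sum_congr rfl fun l _ => ?_
      ring
    rw [e1, e2, ← norm_matElem_sq, ← Complex.ofReal_mul, ← Complex.ofReal_mul, Complex.ofReal_re,
      Complex.ofReal_re, Complex.re_ofReal_mul, varTerm]
    ring
  · simp only [varRow, one_apply_eq_self]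
    have e1 : ∑ k, ⟪x k, b i⟫_ℂ * ⟪b i, (A - B) (y k)⟫_ℂ
        = (eigval A (b i) : ℂ) * ∑ k, ⟪x k, b i⟫_ℂ * ⟪b i, y k⟫_ℂ
          - ∑ k, ⟪x k, b i⟫_ℂ * ⟪b i, B (y k)⟫_ℂ := by
      rw [Finset.mul_sum, ← Finset.sum_sub_distrib]
      refine Finset.sum_congr rfl fun k _ => ?_
      rw [sub_apply, inner_sub_right, hb.inner_apply hA]
      ring
    have e2 : ∑ k, ∑ l, (⟪x k, b i⟫_ℂ * ⟪b i, A (x l)⟫_ℂ) * ⟪y l, y k⟫_ℂ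
        = (eigval A (b i) : ℂ) * ∑ k, ∑ l, (⟪x k, b i⟫_ℂ * ⟪b i, x l⟫_ℂ) * ⟪y l, y k⟫_ℂ := by
      rw [Finset.mul_sum]
      refine Finset.sum_congr rfl fun k _ => ?_
      rw [Finset.mul_sum]
      refine Finset.sum_congr rfl fun l _ => ?_
      rw [hb.inner_apply hA]
      ring
    rw [e1, e2]
    ring

lemma hasSum_varRow (b : HilbertBasis w ℂ H) (A B : H →L[ℂ] H) (θ : ℝ) (x y : κ → H) :
    HasSum (fun i => varRow θ A B b x y i) (varForm θ x y A B) := by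
  refine HasSum.sub (HasSum.sub ?_ ?_) ?_ <;> refine (Complex.hasSum_re ?_).mul_left _
  · exact hasSum_sum fun k _ => b.hasSum_inner_mul_inner _ _
  · exact hasSum_sum fun k _ => hasSum_sum fun l _ => (b.hasSum_inner_mul_inner _ _).mul_right _
  · exact hasSum_sum fun k _ => hasSum_sum fun l _ => (b.hasSum_inner_mul_inner _ _).mul_right _

/-- Discarding negative terms only increases the sum; it moves estimates into `[0, ∞]`, where no
summability has to be checked. -/
lemma ofReal_le_tsum_of_hasSum {α : Type*} {f : α → ℝ} {s : ℝ} (h : HasSum f s) :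
    ENNReal.ofReal s ≤ ∑' i, ENNReal.ofReal (f i) := by
  by_cases ht : ∑' i, ENNReal.ofReal (f i) = ⊤
  · rw [ht]; exact le_top
  have h1 : Summable fun i => (ENNReal.ofReal (f i)).toReal := ENNReal.summable_toReal ht
  rw [← ENNReal.ofReal_toReal ht, ENNReal.tsum_toReal_eq (fun i => ENNReal.ofReal_ne_top)]
  refine ENNReal.ofReal_le_ofReal (hasSum_le (fun i => ?_) h h1.hasSum)
  exact Real.le_coe_toNNReal (f i)

/-- The matrix elements of `Y` can be optimized separately, each by completing the square. -/
lemma ofReal_varForm_le (hb : IsEigenbasis b A) (hc : IsEigenbasis c B) (hA : 0 ≤ A)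
    (hB : 0 ≤ B) {θ : ℝ} (h0 : 0 < θ) (h1 : θ < 1) (x y : κ → H) :
    ENNReal.ofReal (varForm θ x y A B) ≤ ∑' i, ∑' j, ENNReal.ofReal (‖⟪b i, c j⟫_ℂ‖ ^ 2) *
      ENNReal.ofReal (chiSqTerm θ (eigval A (b i)) (eigval B (c j))) := by
  refine (ofReal_le_tsum_of_hasSum (hasSum_varRow b A B θ x y)).trans
    (ENNReal.tsum_le_tsum fun i => ?_)
  refine (ofReal_le_tsum_of_hasSum (hasSum_varTerm hb hc hA.isSelfAdjoint hB.isSelfAdjoint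
    θ x y i)).trans (ENNReal.tsum_le_tsum fun j => ?_)
  rw [← ENNReal.ofReal_mul (by positivity)]
  have ha := eigval_nonneg hA (b i)
  have hs := eigval_nonneg hB (c j)
  have h1' : 0 < 1 - θ := by linarith
  refine ENNReal.ofReal_le_ofReal (two_mul_re_sub_le (by positivity) (fun h => ?_) _ _)
  have e1 : θ * eigval A (b i) = 0 := by nlinarith [mul_nonneg h0.le ha, mul_nonneg h1'.le hs]
  have e2 : (1 - θ) * eigval B (c j) = 0 := by linarith
  rw [(mul_eq_zero.1 e1).resolve_left h0.ne', (mul_eq_zero.1 e2).resolve_left h1'.ne', sub_zero]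

lemma le_varSup (hb : IsEigenbasis b A) (hc : IsEigenbasis c B) (hA : 0 ≤ A)
    (hB : 0 ≤ B) {θ : ℝ} (h0 : 0 < θ) (h1 : θ < 1) :
    ∑' i, ∑' j, ENNReal.ofReal (‖⟪b i, c j⟫_ℂ‖ ^ 2) *
      ENNReal.ofReal (chiSqTerm θ (eigval A (b i)) (eigval B (c j))) ≤ varSup θ A B := by
  classical
  rw [← ENNReal.tsum_prod (f := fun i j => ENNReal.ofReal (‖⟪b i, c j⟫_ℂ‖ ^ 2) *
      ENNReal.ofReal (chiSqTerm θ (eigval A (b i)) (eigval B (c j)))), ENNReal.tsum_eq_iSup_sum]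
  refine iSup_le fun G => ?_
  let J : w × v → ℝ := fun p => θ * eigval A (b p.1) + (1 - θ) * eigval B (c p.2)
  let X : w × v → ℝ := fun p => eigval A (b p.1) - eigval B (c p.2)
  -- The maximizing matrix elements from the completed square, used on the finite set `G` and
  -- replaced by zero outside, so that `Y` has finite rank.
  let z : w × v → ℂ := fun p => ((X p / J p : ℝ) : ℂ) * ⟪b p.1, c p.2⟫_ℂ
  have key : varForm θ (fun k : G => z k • b k.1.1) (fun k : G => c k.1.2) A B
      = ∑ p ∈ G, ‖⟪b p.1, c p.2⟫_ℂ‖ ^ 2 * chiSqTerm θ (eigval A (b p.1)) (eigval B (c p.2)) := by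
    -- The operators `|b i⟩⟨c j|` are orthonormal in the Hilbert–Schmidt product, which removes all
    -- cross terms from the two quadratic parts.
    have horth : ∀ k l : G, ⟪b k.1.1, b l.1.1⟫_ℂ * ⟪c l.1.2, c k.1.2⟫_ℂ = if k = l then 1 else 0 := by
      intro k l
      rw [orthonormal_iff_ite.1 b.orthonormal, orthonormal_iff_ite.1 c.orthonormal]
      have : k = l ↔ k.1.1 = l.1.1 ∧ l.1.2 = k.1.2 := by
        rw [Subtype.ext_iff, Prod.ext_iff, eq_comm (a := l.1.2)]
      split_ifs <;> simp_all
    have e1 : ∑ k : G, ⟪z k • b k.1.1, (A - B) (c k.1.2)⟫_ℂ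
        = ∑ k : G, ((X k * (X k / J k * ‖⟪b k.1.1, c k.1.2⟫_ℂ‖ ^ 2) : ℝ) : ℂ) := by
      refine Finset.sum_congr rfl fun k _ => ?_
      rw [inner_smul_left, sub_apply, inner_sub_right, hb.inner_apply hA.isSelfAdjoint,
        hc.apply_eq, inner_smul_right_eq_smul, Complex.real_smul]
      simp only [z, X, map_mul, Complex.conj_ofReal]
      push_cast
      rw [← Complex.conj_mul']
      ring
    have e2 : ∑ k : G, ∑ l : G, ⟪z k • b k.1.1, A (z l • b l.1.1)⟫_ℂ * ⟪c l.1.2, c k.1.2⟫_ℂ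
        = ∑ k : G, ((eigval A (b k.1.1) * ‖z k‖ ^ 2 : ℝ) : ℂ) := by
      refine Finset.sum_congr rfl fun k _ => ?_
      have : ∀ l : G, ⟪z k • b k.1.1, A (z l • b l.1.1)⟫_ℂ * ⟪c l.1.2, c k.1.2⟫_ℂ
          = if k = l then ((eigval A (b k.1.1) * ‖z k‖ ^ 2 : ℝ) : ℂ) else 0 := by
        intro l
        rw [map_smul, hb.apply_eq, inner_smul_left, inner_smul_right, inner_smul_right_eq_smul,
          Complex.real_smul]
        have h := horth k l
        by_cases hkl : k = l
        · subst hkl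
          rw [if_pos rfl] at h ⊢
          push_cast
          rw [← Complex.conj_mul']
          linear_combination (starRingEnd ℂ (z k) * z k * eigval A (b k.1.1)) * h
        · rw [if_neg hkl] at h ⊢
          linear_combination (starRingEnd ℂ (z k) * z l * eigval A (b l.1.1)) * h
      simp_rw [this]
      simp
    have e3 : ∑ k : G, ∑ l : G, ⟪z k • b k.1.1, z l • b l.1.1⟫_ℂ * ⟪c l.1.2, B (c k.1.2)⟫_ℂ
        = ∑ k : G, ((eigval B (c k.1.2) * ‖z k‖ ^ 2 : ℝ) : ℂ) := by
      refine Finset.sum_congr rfl fun k _ => ?_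
      have : ∀ l : G, ⟪z k • b k.1.1, z l • b l.1.1⟫_ℂ * ⟪c l.1.2, B (c k.1.2)⟫_ℂ
          = if k = l then ((eigval B (c k.1.2) * ‖z k‖ ^ 2 : ℝ) : ℂ) else 0 := by
        intro l
        rw [hc.apply_eq, inner_smul_left, inner_smul_right, inner_smul_right_eq_smul,
          Complex.real_smul]
        have h := horth k l
        by_cases hkl : k = l
        · subst hkl
          rw [if_pos rfl] at h ⊢
          push_cast
          rw [← Complex.conj_mul']
          linear_combination (starRingEnd ℂ (z k) * z k * eigval B (c k.1.2)) * h
        · rw [if_neg hkl] at h ⊢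
          linear_combination (starRingEnd ℂ (z k) * z l * eigval B (c k.1.2)) * h
      simp_rw [this]
      simp
    rw [varForm, e1, e2, e3, ← Finset.sum_coe_sort G]
    simp only [← Complex.ofReal_sum, Complex.ofReal_re]
    rw [Finset.mul_sum, Finset.mul_sum, Finset.mul_sum, ← Finset.sum_sub_distrib,
      ← Finset.sum_sub_distrib]
    refine Finset.sum_congr rfl fun k _ => ?_
    have hz : ‖z k‖ ^ 2 = (X k / J k) ^ 2 * ‖⟪b k.1.1, c k.1.2⟫_ℂ‖ ^ 2 := by
      simp only [z, norm_mul, Complex.norm_real, mul_pow, Real.norm_eq_abs, sq_abs]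
    have hch : chiSqTerm θ (eigval A (b k.1.1)) (eigval B (c k.1.2)) = X k ^ 2 / J k := rfl
    have hJ : J k = θ * eigval A (b k.1.1) + (1 - θ) * eigval B (c k.1.2) := rfl
    have hX : (X k / J k) ^ 2 * J k = X k ^ 2 / J k := by
      by_cases h : J k = 0
      · simp [h]
      · field_simp
    rw [hz, hch]
    linear_combination (-‖⟪b k.1.1, c k.1.2⟫_ℂ‖ ^ 2) * hX
      + (X k / J k) ^ 2 * ‖⟪b k.1.1, c k.1.2⟫_ℂ‖ ^ 2 * hJ
  calc _ = ENNReal.ofReal (varForm θ (fun k : G => z k • b k.1.1) (fun k : G => c k.1.2) A B) := by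
        rw [key, ENNReal.ofReal_sum_of_nonneg]
        · exact Finset.sum_congr rfl fun p _ => by rw [← ENNReal.ofReal_mul (by positivity)]
        · exact fun p _ => mul_nonneg (by positivity)
            (chiSqTerm_nonneg h0 h1 (eigval_nonneg hA _) (eigval_nonneg hB _))
    _ ≤ _ := ofReal_varForm_le_varSup _ _ _ _ _

lemma varSup_eq_tsum (hb : IsEigenbasis b A) (hc : IsEigenbasis c B) (hA : 0 ≤ A)
    (hB : 0 ≤ B) {θ : ℝ} (h0 : 0 < θ) (h1 : θ < 1) :
    varSup θ A B = ∑' i, ∑' j, ENNReal.ofReal (‖⟪b i, c j⟫_ℂ‖ ^ 2) *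
      ENNReal.ofReal (chiSqTerm θ (eigval A (b i)) (eigval B (c j))) :=
  le_antisymm (iSup_le fun _ => iSup_le fun _ => iSup_le fun _ =>
    ofReal_varForm_le hb hc hA hB h0 h1 _ _) (le_varSup hb hc hA hB h0 h1)

variable [TopologicalSpace.SeparableSpace H]

/-- The right side no longer mentions the eigenbases. This gives their irrelevance and reduces the
relative entropy to the functionals `varForm`. -/
lemma tsum_klTerm_eq_lintegral (hb : IsEigenbasis b A) (hc : IsEigenbasis c B) (hA : 0 ≤ A)
    (hB : 0 ≤ B) :
    ∑' i, ∑' j, ENNReal.ofReal (‖⟪b i, c j⟫_ℂ‖ ^ 2) * klTerm (eigval A (b i)) (eigval B (c j))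
      = ∫⁻ θ in Set.Ioo (0 : ℝ) 1, ENNReal.ofReal (1 - θ) * varSup θ A B := by
  have := countable_of_hilbertBasis b
  have := countable_of_hilbertBasis c
  have hm : ∀ i j, Measurable fun θ : ℝ => ENNReal.ofReal (‖⟪b i, c j⟫_ℂ‖ ^ 2) *
      (ENNReal.ofReal (1 - θ) *
        ENNReal.ofReal (chiSqTerm θ (eigval A (b i)) (eigval B (c j)))) := fun i j => by
    have := measurable_chiSqTerm (eigval A (b i)) (eigval B (c j))
    fun_prop
  have h : ∀ θ ∈ Set.Ioo (0 : ℝ) 1, ENNReal.ofReal (1 - θ) * varSup θ A B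
      = ∑' i, ∑' j, ENNReal.ofReal (‖⟪b i, c j⟫_ℂ‖ ^ 2) * (ENNReal.ofReal (1 - θ) *
        ENNReal.ofReal (chiSqTerm θ (eigval A (b i)) (eigval B (c j)))) := by
    intro θ hθ
    rw [varSup_eq_tsum hb hc hA hB hθ.1 hθ.2]
    simp_rw [← ENNReal.tsum_mul_left]
    exact tsum_congr fun i => tsum_congr fun j => by ring
  rw [MeasureTheory.setLIntegral_congr_fun measurableSet_Ioo h, MeasureTheory.lintegral_tsum
    fun i => (Measurable.tsum fun j => hm i j).aemeasurable]
  congr with i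
  rw [MeasureTheory.lintegral_tsum fun j => (hm i j).aemeasurable]
  congr with j
  rw [MeasureTheory.lintegral_const_mul' _ _ ENNReal.ofReal_ne_top,
    lintegral_chiSqTerm (eigval_nonneg hA _) (eigval_nonneg hB _)]

/-- The relative entropy can be computed in every pair of eigenbases. -/
theorem relEntropy_eq_tsum (hb : IsEigenbasis b A) (hc : IsEigenbasis c B) (hA : 0 ≤ A)
    (hB : 0 ≤ B) : relEntropy A B = ∑' i, ∑' j, ENNReal.ofReal (‖⟪b i, c j⟫_ℂ‖ ^ 2) *
      klTerm (eigval A (b i)) (eigval B (c j)) := by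
  refine le_antisymm (iInf_le_of_le w <| iInf_le_of_le v <| iInf_le_of_le b <| iInf_le_of_le c <|
    iInf_le_of_le hb <| iInf_le_of_le hc le_rfl) ?_
  refine le_iInf fun w' => le_iInf fun v' => le_iInf fun b' => le_iInf fun c' => le_iInf fun hb' =>
    le_iInf fun hc' => ?_
  rw [tsum_klTerm_eq_lintegral hb hc hA hB, tsum_klTerm_eq_lintegral hb' hc' hA hB]

end Expansion

/-- The relative entropy as an integral of suprema of affine functionals. -/
theorem relEntropy_eq_lintegral [TopologicalSpace.SeparableSpace H] {A B : H →L[ℂ] H}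
    (hA : 0 ≤ A) (hB : 0 ≤ B) (htA : posTrace A ≠ ⊤) (htB : posTrace B ≠ ⊤) :
    relEntropy A B = ∫⁻ θ in Set.Ioo (0 : ℝ) 1, ENNReal.ofReal (1 - θ) * varSup θ A B := by
  obtain ⟨w, b, hb⟩ := exists_isEigenbasis_of_posTrace_ne_top hA htA
  obtain ⟨v, c, hc⟩ := exists_isEigenbasis_of_posTrace_ne_top hB htB
  rw [relEntropy_eq_tsum hb hc hA hB, tsum_klTerm_eq_lintegral hb hc hA hB]

/-! ### Joint convexity, scaling, and special values of the relative entropy -/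

/-- The supremum is over an uncountable family, but of functions continuous in `θ`, so it is lower
semicontinuous. -/
lemma measurable_varSup (A B : H →L[ℂ] H) : Measurable fun θ => varSup θ A B := by
  refine LowerSemicontinuous.measurable ?_
  refine lowerSemicontinuous_iSup fun n => lowerSemicontinuous_iSup fun u =>
    lowerSemicontinuous_iSup fun v => 
      (ENNReal.continuous_ofReal.comp ?_).lowerSemicontinuous
  unfold varForm
  fun_prop

lemma hasSum_varForm {κ' : Type*} [Fintype κ'] {κ : Type*} {A B : κ → H →L[ℂ] H}
    {S T : H →L[ℂ] H} (hS : HasSum A S) (hT : HasSum B T) (θ : ℝ) (u v : κ' → H) :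
    HasSum (fun k => varForm θ u v (A k) (B k)) (varForm θ u v S T) := by
  refine HasSum.sub (HasSum.sub ?_ ?_) ?_ <;> refine (Complex.hasSum_re ?_).mul_left _
  · exact hasSum_sum fun k _ => hasSum_re_inner (hS.sub hT) _ _
  · exact hasSum_sum fun k _ => hasSum_sum fun l _ => (hasSum_re_inner hS _ _).mul_right _
  · exact hasSum_sum fun k _ => hasSum_sum fun l _ => (hasSum_re_inner hT _ _).mul_left _

lemma varForm_smul {κ' : Type*} [Fintype κ'] (r θ : ℝ) (u v : κ' → H) (A B : H →L[ℂ] H) :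
    varForm θ u v (r • A) (r • B) = r * varForm θ u v A B := by
  unfold varForm
  have e1 : ∑ k, ⟪u k, (r • A - r • B) (v k)⟫_ℂ = (r : ℂ) * ∑ k, ⟪u k, (A - B) (v k)⟫_ℂ := by
    rw [← smul_sub, Finset.mul_sum]
    simp_rw [smul_apply, inner_smul_right_eq_smul, Complex.real_smul]
  have e2 : ∑ k, ∑ l, ⟪u k, (r • A) (u l)⟫_ℂ * ⟪v l, v k⟫_ℂ
      = (r : ℂ) * ∑ k, ∑ l, ⟪u k, A (u l)⟫_ℂ * ⟪v l, v k⟫_ℂ := by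
    simp_rw [Finset.mul_sum]
    simp [inner_smul_right_eq_smul, mul_assoc]
  have e3 : ∑ k, ∑ l, ⟪u k, u l⟫_ℂ * ⟪v l, (r • B) (v k)⟫_ℂ
      = (r : ℂ) * ∑ k, ∑ l, ⟪u k, u l⟫_ℂ * ⟪v l, B (v k)⟫_ℂ := by
    simp_rw [Finset.mul_sum]
    simp [inner_smul_right_eq_smul, mul_left_comm]
  rw [e1, e2, e3]
  simp only [Complex.re_ofReal_mul]
  ring

/-- A supremum of continuous linear functionals of the pair is countably sublinear. This is joint
convexity before integration over `θ`. -/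
lemma varSup_hasSum_le {κ : Type*} {A B : κ → H →L[ℂ] H} {q : κ → ℝ} (hq : ∀ k, 0 ≤ q k)
    {S T : H →L[ℂ] H} (hS : HasSum (fun k => q k • A k) S) (hT : HasSum (fun k => q k • B k) T)
    (θ : ℝ) : varSup θ S T ≤ ∑' k, ENNReal.ofReal (q k) * varSup θ (A k) (B k) := by
  refine iSup_le fun n => iSup_le fun u => iSup_le fun v => ?_
  refine (ofReal_le_tsum_of_hasSum (hasSum_varForm hS hT θ u v)).trans
    (ENNReal.tsum_le_tsum fun k => ?_)
  rw [varForm_smul, ENNReal.ofReal_mul (hq k)]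
  gcongr
  exact ofReal_varForm_le_varSup _ _ _ _ _

/-- The overlaps `|⟨b i, c j⟩|²` form a doubly stochastic array, so traces and entropies can be
written as double sums and compared with `relEntropy` term by term. -/
lemma tsum_overlap_right {w v : Type*} (b : HilbertBasis w ℂ H) (c : HilbertBasis v ℂ H) (i : w) :
    ∑' j, ENNReal.ofReal (‖⟪b i, c j⟫_ℂ‖ ^ 2) = 1 := by
  have h := tsum_norm_inner_sq c (b i)
  rw [b.orthonormal.1 i, one_pow, ENNReal.ofReal_one] at h
  rw [← h]
  exact tsum_congr fun j => by rw [← inner_conj_symm, RCLike.norm_conj]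

lemma tsum_overlap_left {w v : Type*} (b : HilbertBasis w ℂ H) (c : HilbertBasis v ℂ H) (j : v) :
    ∑' i, ENNReal.ofReal (‖⟪b i, c j⟫_ℂ‖ ^ 2) = 1 := by
  rw [tsum_norm_inner_sq, c.orthonormal.1 j]; simp

lemma tsum_tsum_overlap_mul_left {w v : Type*} (b : HilbertBasis w ℂ H) (c : HilbertBasis v ℂ H)
    (f : w → ℝ≥0∞) : ∑' i, ∑' j, ENNReal.ofReal (‖⟪b i, c j⟫_ℂ‖ ^ 2) * f i = ∑' i, f i := by
  simp_rw [ENNReal.tsum_mul_right, tsum_overlap_right, one_mul]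

lemma tsum_tsum_overlap_mul_right {w v : Type*} (b : HilbertBasis w ℂ H) (c : HilbertBasis v ℂ H)
    (f : v → ℝ≥0∞) : ∑' i, ∑' j, ENNReal.ofReal (‖⟪b i, c j⟫_ℂ‖ ^ 2) * f j = ∑' j, f j := by
  rw [ENNReal.tsum_comm]
  simp_rw [ENNReal.tsum_mul_right, tsum_overlap_left, one_mul]

lemma klTerm_zero_left (s : ℝ) : klTerm 0 s = ENNReal.ofReal s := by simp [klTerm]

lemma klTerm_nonneg_aux {a s : ℝ} (ha : 0 ≤ a) (hs : 0 < s) :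
    0 ≤ a * Real.log a - a * Real.log s + s - a := by
  rcases ha.eq_or_lt with rfl | ha
  · simpa using hs.le
  have h := Real.log_le_sub_one_of_pos (div_pos hs ha)
  rw [Real.log_div hs.ne' ha.ne'] at h
  have h2 := mul_le_mul_of_nonneg_left h ha.le
  have h3 : a * (s / a - 1) = s - a := by field_simp
  nlinarith

/-- The rule `klTerm a (r s) = klTerm a s - a log r + (r - 1) s`, with terms moved across so that
nothing is subtracted and infinite values are covered. -/
lemma klTerm_mul_right {a s r : ℝ} (ha : 0 ≤ a) (hs : 0 ≤ s) (hr : 0 < r) :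
    klTerm a (r * s) + (ENNReal.ofReal (Real.log r) * ENNReal.ofReal a + ENNReal.ofReal s)
      = klTerm a s + (ENNReal.ofReal (-Real.log r) * ENNReal.ofReal a
        + ENNReal.ofReal r * ENNReal.ofReal s) := by
  rcases hs.eq_or_lt with rfl | hs
  · rcases ha.eq_or_lt with rfl | ha
    · simp [klTerm]
    · have : klTerm a 0 = ⊤ := by rw [klTerm, if_pos ⟨rfl, ha.ne'⟩]
      simp [this]
  · have hrs := mul_pos hr hs
    rw [klTerm, if_neg (fun h => hrs.ne' h.1), klTerm, if_neg (fun h => hs.ne' h.1),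
      Real.log_mul hr.ne' hs.ne']
    have k1 := klTerm_nonneg_aux ha hrs
    have k2 := klTerm_nonneg_aux ha hs
    rw [Real.log_mul hr.ne' hs.ne'] at k1
    rcases le_total 0 (Real.log r) with hl | hl
    · rw [ENNReal.ofReal_of_nonpos (neg_nonpos.2 hl), zero_mul, zero_add,
        ← ENNReal.ofReal_mul hl, ← ENNReal.ofReal_mul hr.le,
        ← ENNReal.ofReal_add (by positivity) hs.le, ← ENNReal.ofReal_add k1 (by positivity),
        ← ENNReal.ofReal_add k2 hrs.le]
      congr 1; ring
    · rw [ENNReal.ofReal_of_nonpos hl, zero_mul, zero_add,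
        ← ENNReal.ofReal_mul (neg_nonneg.2 hl), ← ENNReal.ofReal_mul hr.le,
        ← ENNReal.ofReal_add (mul_nonneg (neg_nonneg.2 hl) ha) hrs.le,
        ← ENNReal.ofReal_add k1 hs.le,
        ← ENNReal.ofReal_add k2 (add_nonneg (mul_nonneg (neg_nonneg.2 hl) ha) hrs.le)]
      congr 1; ring

lemma eigval_smul (r : ℝ) (B : H →L[ℂ] H) (x : H) : eigval (r • B) x = r * eigval B x := by
  simp [eigval, inner_smul_right_eq_smul]

lemma IsEigenbasis.smul {w : Set H} {b : HilbertBasis w ℂ H} {A : H →L[ℂ] H}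
    (hb : IsEigenbasis b A) (r : ℝ) : IsEigenbasis b (r • A) := fun i => by
  obtain ⟨l, hl⟩ := hb i
  exact ⟨r * l, by rw [smul_apply, hl, mul_smul]⟩

section Separable

variable [TopologicalSpace.SeparableSpace H]

/-- **Joint convexity** of the relative entropy, for countable combinations. -/
theorem relEntropy_hasSum_le {κ : Type*} [Countable κ] {A B : κ → H →L[ℂ] H} {q : κ → ℝ}
    (hq : ∀ k, 0 ≤ q k) {S T : H →L[ℂ] H} (hS : HasSum (fun k => q k • A k) S)
    (hT : HasSum (fun k => q k • B k) T) (hA : ∀ k, 0 ≤ A k) (hB : ∀ k, 0 ≤ B k)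
    (htA : ∀ k, posTrace (A k) ≠ ⊤) (htB : ∀ k, posTrace (B k) ≠ ⊤)
    (htS : posTrace S ≠ ⊤) (htT : posTrace T ≠ ⊤) :
    relEntropy S T ≤ ∑' k, ENNReal.ofReal (q k) * relEntropy (A k) (B k) := by
  have hS0 : 0 ≤ S := nonneg_of_hasSum hS fun k => smul_nonneg (hq k) (hA k)
  have hT0 : 0 ≤ T := nonneg_of_hasSum hT fun k => smul_nonneg (hq k) (hB k)
  rw [relEntropy_eq_lintegral hS0 hT0 htS htT]
  simp_rw [fun k => relEntropy_eq_lintegral (hA k) (hB k) (htA k) (htB k),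
    ← MeasureTheory.lintegral_const_mul' _ _ ENNReal.ofReal_ne_top]
  rw [← MeasureTheory.lintegral_tsum]
  · refine MeasureTheory.lintegral_mono fun θ => ?_
    calc _ ≤ ENNReal.ofReal (1 - θ) * ∑' k, ENNReal.ofReal (q k) * varSup θ (A k) (B k) := by
          gcongr
          exact varSup_hasSum_le hq hS hT θ
      _ = _ := by
          rw [← ENNReal.tsum_mul_left]
          exact tsum_congr fun k => by ring
  · intro k
    have := measurable_varSup (A k) (B k)
    fun_prop

lemma relEntropy_self {A : H →L[ℂ] H} (hA : 0 ≤ A) (ht : posTrace A ≠ ⊤) :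
    relEntropy A A = 0 := by
  obtain ⟨w, b, hb⟩ := exists_isEigenbasis_of_posTrace_ne_top hA ht
  rw [relEntropy_eq_tsum hb hb hA hA]
  simp only [ENNReal.tsum_eq_zero]
  intro i j
  by_cases hij : i = j
  · subst hij
    rw [klTerm, if_neg (fun h => h.2 h.1)]
    simp
  · rw [b.orthonormal.2 hij]; simp

lemma relEntropy_smul_le {A B : H →L[ℂ] H} (hA : 0 ≤ A) (hB : 0 ≤ B) (htA : posTrace A ≠ ⊤)
    (htB : posTrace B ≠ ⊤) {r : ℝ} (hr : 0 ≤ r) :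
    relEntropy (r • A) (r • B) ≤ ENNReal.ofReal r * relEntropy A B := by
  have h := relEntropy_hasSum_le (κ := Unit) (A := fun _ => A) (B := fun _ => B) (q := fun _ => r)
    (S := r • A) (T := r • B) (fun _ => hr) (hasSum_unique _) (hasSum_unique _) (fun _ => hA)
    (fun _ => hB) (fun _ => htA) (fun _ => htB)
    (by rw [posTrace_smul _ hr]; exact ENNReal.mul_ne_top ENNReal.ofReal_ne_top htA)
    (by rw [posTrace_smul _ hr]; exact ENNReal.mul_ne_top ENNReal.ofReal_ne_top htB)
  simpa using h

/-- One inequality is joint convexity with a single weight `r`; the other is the same statement for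
`r⁻¹`. -/
lemma relEntropy_smul_smul {A B : H →L[ℂ] H} (hA : 0 ≤ A) (hB : 0 ≤ B) (htA : posTrace A ≠ ⊤)
    (htB : posTrace B ≠ ⊤) {r : ℝ} (hr : 0 ≤ r) :
    relEntropy (r • A) (r • B) = ENNReal.ofReal r * relEntropy A B := by
  refine le_antisymm (relEntropy_smul_le hA hB htA htB hr) ?_
  rcases hr.eq_or_lt with rfl | hr0
  · simp
  have h := relEntropy_smul_le (smul_nonneg hr hA) (smul_nonneg hr hB)
    (by rw [posTrace_smul _ hr]; exact ENNReal.mul_ne_top ENNReal.ofReal_ne_top htA)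
    (by rw [posTrace_smul _ hr]; exact ENNReal.mul_ne_top ENNReal.ofReal_ne_top htB)
    (inv_nonneg.2 hr)
  rw [inv_smul_smul₀ hr0.ne', inv_smul_smul₀ hr0.ne'] at h
  calc _ ≤ ENNReal.ofReal r * (ENNReal.ofReal r⁻¹ * relEntropy (r • A) (r • B)) := by gcongr
    _ = _ := by
      rw [← mul_assoc, ← ENNReal.ofReal_mul hr, mul_inv_cancel₀ hr0.ne', ENNReal.ofReal_one, one_mul]

/-- Every basis is an eigenbasis of `0`, and `klTerm 0 s` is `s`. Traces thus become relative
entropies, and their behaviour under compression needs no separate proof. -/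
lemma relEntropy_zero_left {B : H →L[ℂ] H} (hB : 0 ≤ B) (ht : posTrace B ≠ ⊤) :
    relEntropy 0 B = posTrace B := by
  obtain ⟨v, c, hc⟩ := exists_isEigenbasis_of_posTrace_ne_top hB ht
  have hb : IsEigenbasis c (0 : H →L[ℂ] H) := fun i => ⟨0, by simp⟩
  rw [relEntropy_eq_tsum hb hc le_rfl hB]
  have : ∀ i, eigval (0 : H →L[ℂ] H) (c i) = 0 := fun i => by simp [eigval]
  simp_rw [this, klTerm_zero_left]
  rw [tsum_tsum_overlap_mul_right c c fun j => ENNReal.ofReal (eigval B (c j)),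
    posTrace_eq_tsum_eigval hB c]

/-- The dependence of the relative entropy on the normalization of the second argument. -/
lemma relEntropy_smul_right {A B : H →L[ℂ] H} (hA : 0 ≤ A) (hB : 0 ≤ B) (htA : posTrace A ≠ ⊤)
    (htB : posTrace B ≠ ⊤) {r : ℝ} (hr : 0 < r) :
    relEntropy A (r • B) + (ENNReal.ofReal (Real.log r) * posTrace A + posTrace B)
      = relEntropy A B + (ENNReal.ofReal (-Real.log r) * posTrace A
        + ENNReal.ofReal r * posTrace B) := by
  obtain ⟨w, b, hb⟩ := exists_isEigenbasis_of_posTrace_ne_top hA htA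
  obtain ⟨v, c, hc⟩ := exists_isEigenbasis_of_posTrace_ne_top hB htB
  rw [relEntropy_eq_tsum hb (hc.smul r) hA (smul_nonneg hr.le hB), relEntropy_eq_tsum hb hc hA hB,
    posTrace_eq_tsum_eigval hA b, posTrace_eq_tsum_eigval hB c]
  have hl := tsum_tsum_overlap_mul_left b c fun i => ENNReal.ofReal (eigval A (b i))
  have hr' := tsum_tsum_overlap_mul_right b c fun j => ENNReal.ofReal (eigval B (c j))
  rw [← hl, ← hr']
  simp_rw [← ENNReal.tsum_mul_left, ← ENNReal.tsum_add, eigval_smul]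
  refine tsum_congr fun i => tsum_congr fun j => ?_
  have h := klTerm_mul_right (eigval_nonneg hA (b i)) (eigval_nonneg hB (c j)) hr
  have h2 := congrArg (ENNReal.ofReal (‖⟪b i, c j⟫_ℂ‖ ^ 2) * ·) h
  simp only [mul_add] at h2
  convert h2 using 3 <;> ring

end Separable

/-! ### Compressions to finite-dimensional subspaces -/

/-- The compression of an operator to a subspace. -/
def compress (K : Submodule ℂ H) [CompleteSpace K] (A : H →L[ℂ] H) : K →L[ℂ] K :=
  K.orthogonalProjectionOnto ∘L A ∘L K.subtypeL

section Compress

variable (K : Submodule ℂ H) [CompleteSpace K]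

lemma inner_compress (A : H →L[ℂ] H) (x y : K) : ⟪x, compress K A y⟫_ℂ = ⟪(x : H), A y⟫_ℂ := by
  simp [compress]

lemma compress_nonneg {A : H →L[ℂ] H} (hA : 0 ≤ A) : 0 ≤ compress K A := by
  rw [ContinuousLinearMap.nonneg_iff_isPositive] at hA ⊢
  exact hA.orthogonalProjectionOnto_comp K

lemma compress_smul (r : ℝ) (A : H →L[ℂ] H) : compress K (r • A) = r • compress K A := by
  ext x; simp [compress]

lemma compress_zero : compress K (0 : H →L[ℂ] H) = 0 := by
  ext x; simp [compress]

lemma hasSum_compress {κ : Type*} {A : κ → H →L[ℂ] H} {S : H →L[ℂ] H} (hS : HasSum A S) :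
    HasSum (fun k => compress K (A k)) (compress K S) := by
  have h1 := ((ContinuousLinearMap.compL ℂ K H H).flip K.subtypeL).hasSum hS
  exact (ContinuousLinearMap.compL ℂ K H K K.orthogonalProjectionOnto).hasSum h1

/-- Compressing the operators amounts to restricting the vectors `u`, `v` to the subspace, so
compression restricts the supremum in `varSup`. -/
lemma varForm_compress {κ : Type*} [Fintype κ] (θ : ℝ) (u v : κ → K) (A B : H →L[ℂ] H) :
    varForm θ u v (compress K A) (compress K B)
      = varForm θ (fun k => (u k : H)) (fun k => (v k : H)) A B := by
  unfold varForm
  simp only [sub_apply, inner_sub_right, inner_compress]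
  simp only [Submodule.coe_inner]

lemma varSup_compress_le (θ : ℝ) (A B : H →L[ℂ] H) :
    varSup θ (compress K A) (compress K B) ≤ varSup θ A B :=
  iSup_le fun n => iSup_le fun u => iSup_le fun v => by
    rw [varForm_compress]; exact ofReal_varForm_le_varSup _ _ _ _ _

lemma varSup_compress_mono {K K' : Submodule ℂ H} [CompleteSpace K]
    [CompleteSpace K'] (h : K ≤ K') (θ : ℝ) (A B : H →L[ℂ] H) :
    varSup θ (compress K A) (compress K B) ≤ varSup θ (compress K' A) (compress K' B) :=
  iSup_le fun n => iSup_le fun u => iSup_le fun v => by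
    have h1 := ofReal_varForm_le_varSup θ (fun k => (⟨u k, h (u k).2⟩ : K'))
      (fun k => (⟨v k, h (v k).2⟩ : K')) (compress K' A) (compress K' B)
    rw [varForm_compress] at h1 ⊢
    exact h1

/-- Finitely many vectors from the union lie in a common `K N`; such tuples are dense, and `varForm`
is continuous in the vectors. -/
lemma varSup_eq_iSup_compress {K : ℕ → Submodule ℂ H} [∀ n, CompleteSpace (K n)]
    (hmono : Monotone K) (hd : Dense (⋃ n, (K n : Set H))) (θ : ℝ) (A B : H →L[ℂ] H) :
    varSup θ A B = ⨆ n, varSup θ (compress (K n) A) (compress (K n) B) := by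
  refine le_antisymm (iSup_le fun m => iSup_le fun u => iSup_le fun v => ?_)
    (iSup_le fun n => varSup_compress_le _ _ _ _)
  let D : Set (Fin m → H) := Set.univ.pi fun _ => ⋃ n, (K n : Set H)
  have hD : Dense (D ×ˢ D) := (dense_pi _ fun _ _ => hd).prod (dense_pi _ fun _ _ => hd)
  have hcont : Continuous fun p : (Fin m → H) × (Fin m → H) =>
      ENNReal.ofReal (varForm θ p.1 p.2 A B) := by
    refine ENNReal.continuous_ofReal.comp ?_
    unfold varForm
    fun_prop
  refine hD.induction (P := fun p => ENNReal.ofReal (varForm θ p.1 p.2 A B)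
    ≤ ⨆ n, varSup θ (compress (K n) A) (compress (K n) B)) ?_ ?_ (u, v)
  · rintro ⟨u, v⟩ ⟨hu, hv⟩
    have hu' : ∀ i, ∃ n, u i ∈ K n := fun i => by simpa [D] using hu i (Set.mem_univ i)
    have hv' : ∀ i, ∃ n, v i ∈ K n := fun i => by simpa [D] using hv i (Set.mem_univ i)
    choose nu hnu using hu'
    choose nv hnv using hv'
    let N := Finset.univ.sup nu ⊔ Finset.univ.sup nv
    have h1 : ∀ i, u i ∈ K N := fun i =>
      hmono ((Finset.le_sup (Finset.mem_univ i)).trans le_sup_left) (hnu i)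
    have h2 : ∀ i, v i ∈ K N := fun i =>
      hmono ((Finset.le_sup (Finset.mem_univ i)).trans le_sup_right) (hnv i)
    have h3 := ofReal_varForm_le_varSup θ (fun k => (⟨u k, h1 k⟩ : K N))
      (fun k => (⟨v k, h2 k⟩ : K N)) (compress (K N) A) (compress (K N) B)
    rw [varForm_compress] at h3
    exact le_iSup_of_le N h3
  · exact isClosed_le hcont continuous_const

end Compress

lemma finite_of_hilbertBasis [FiniteDimensional ℂ H] {w : Type*} (b : HilbertBasis w ℂ H) :
    Finite w := b.orthonormal.linearIndependent.finite

lemma posTrace_ne_top_of_finiteDimensional [FiniteDimensional ℂ H] (A : H →L[ℂ] H) :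
    posTrace A ≠ ⊤ := by
  have := finite_of_hilbertBasis (someBasis H)
  have := Fintype.ofFinite (basisSet H)
  rw [posTrace, tsum_fintype]
  exact ENNReal.sum_ne_top.2 fun _ _ => ENNReal.ofReal_ne_top

/-! ### Relative entropy and trace as limits of finite-dimensional compressions. -/

section Limit

variable [TopologicalSpace.SeparableSpace H] {K : ℕ → Submodule ℂ H}
  [∀ n, FiniteDimensional ℂ (K n)]

lemma relEntropy_compress_eq_lintegral (n : ℕ) {A B : H →L[ℂ] H} (hA : 0 ≤ A) (hB : 0 ≤ B) :
    relEntropy (compress (K n) A) (compress (K n) B) = ∫⁻ θ in Set.Ioo (0 : ℝ) 1,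
      ENNReal.ofReal (1 - θ) * varSup θ (compress (K n) A) (compress (K n) B) :=
  relEntropy_eq_lintegral (compress_nonneg _ hA) (compress_nonneg _ hB)
    (posTrace_ne_top_of_finiteDimensional _) (posTrace_ne_top_of_finiteDimensional _)

lemma monotone_relEntropy_compress (hmono : Monotone K) {A B : H →L[ℂ] H} (hA : 0 ≤ A)
    (hB : 0 ≤ B) : Monotone fun n => relEntropy (compress (K n) A) (compress (K n) B) := by
  intro m n hmn
  simp only [relEntropy_compress_eq_lintegral _ hA hB]
  exact MeasureTheory.lintegral_mono fun θ => by gcongr; exact varSup_compress_mono (hmono hmn) _ _ _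

/-- The relative entropy is the limit of the relative entropies of finite-dimensional
compressions. -/
theorem relEntropy_eq_iSup_compress (hmono : Monotone K) (hd : Dense (⋃ n, (K n : Set H)))
    {A B : H →L[ℂ] H} (hA : 0 ≤ A) (hB : 0 ≤ B) (htA : posTrace A ≠ ⊤) (htB : posTrace B ≠ ⊤) :
    relEntropy A B = ⨆ n, relEntropy (compress (K n) A) (compress (K n) B) := by
  simp only [relEntropy_compress_eq_lintegral _ hA hB]
  rw [relEntropy_eq_lintegral hA hB htA htB, ← MeasureTheory.lintegral_iSup]
  · refine MeasureTheory.lintegral_congr fun θ => ?_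
    rw [varSup_eq_iSup_compress hmono hd, ENNReal.mul_iSup]
  · intro n
    have := measurable_varSup (compress (K n) A) (compress (K n) B)
    fun_prop
  · exact fun m n hmn θ => by
      dsimp only
      gcongr
      exact varSup_compress_mono (hmono hmn) _ _ _

lemma monotone_posTrace_compress (hmono : Monotone K) {B : H →L[ℂ] H} (hB : 0 ≤ B) :
    Monotone fun n => posTrace (compress (K n) B) := by
  have h := monotone_relEntropy_compress hmono (A := (0 : H →L[ℂ] H)) le_rfl hB
  simpa only [compress_zero, relEntropy_zero_left (compress_nonneg _ hB)
    (posTrace_ne_top_of_finiteDimensional _)] using h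

lemma posTrace_eq_iSup_compress (hmono : Monotone K) (hd : Dense (⋃ n, (K n : Set H)))
    {B : H →L[ℂ] H} (hB : 0 ≤ B) (ht : posTrace B ≠ ⊤) :
    posTrace B = ⨆ n, posTrace (compress (K n) B) := by
  have h := relEntropy_eq_iSup_compress hmono hd (A := (0 : H →L[ℂ] H)) le_rfl hB (by simp) ht
  simpa only [compress_zero, relEntropy_zero_left (compress_nonneg _ hB)
    (posTrace_ne_top_of_finiteDimensional _), relEntropy_zero_left hB ht] using h

end Limit

variable (H) in
lemma exists_finiteDimensional_exhaustion [TopologicalSpace.SeparableSpace H] :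
    ∃ K : ℕ → Submodule ℂ H, (∀ n, FiniteDimensional ℂ (K n)) ∧ Monotone K ∧
      Dense (⋃ n, (K n : Set H)) := by
  refine ⟨fun n => Submodule.span ℂ (TopologicalSpace.denseSeq H '' Set.Iio n),
    fun n => FiniteDimensional.span_of_finite ℂ ((Set.finite_Iio n).image _),
    fun m n hmn => Submodule.span_mono (Set.image_mono (Set.Iio_subset_Iio hmn)), ?_⟩
  refine (TopologicalSpace.denseRange_denseSeq H).mono ?_
  rintro _ ⟨n, rfl⟩
  exact Set.mem_iUnion.2 ⟨n + 1, Submodule.subset_span ⟨n, by simp, rfl⟩⟩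

/-! ### Donald's identity -/

open Classical in
/-- `-log s` (its positive part) with values in `[0, ∞]`, equal to `∞` at `s = 0`. -/
def negLog (s : ℝ) : ℝ≥0∞ := if s = 0 then ⊤ else ENNReal.ofReal (-Real.log s)

/-- The formula `a log a - a log s + s - a` with each term split into positive and negative parts on
opposite sides; at `s = 0 < a` both sides are infinite. -/
lemma klTerm_add_eq {a s : ℝ} (ha : 0 ≤ a) (hs : 0 ≤ s) :
    klTerm a s + (ENNReal.ofReal a + ENNReal.ofReal a * ENNReal.ofReal (Real.log s)
        + ENNReal.ofReal (Real.negMulLog a))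
      = ENNReal.ofReal (-Real.negMulLog a) + ENNReal.ofReal a * negLog s + ENNReal.ofReal s := by
  rcases hs.eq_or_lt with rfl | hs
  · rcases ha.eq_or_lt with rfl | ha
    · simp [klTerm]
    · have : klTerm a 0 = ⊤ := by rw [klTerm, if_pos ⟨rfl, ha.ne'⟩]
      have h2 : ENNReal.ofReal a * negLog 0 = ⊤ := by
        rw [negLog, if_pos rfl, ENNReal.mul_top]
        simpa using ha
      simp [this, h2]
  · rw [klTerm, if_neg (fun h => hs.ne' h.1), negLog, if_neg hs.ne']
    have k := klTerm_nonneg_aux ha hs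
    have hη : Real.negMulLog a = -(a * Real.log a) := by rw [Real.negMulLog]; ring
    rw [← ENNReal.ofReal_mul ha, ← ENNReal.ofReal_mul ha, hη, neg_neg]
    rcases le_total 0 (Real.log s) with hl | hl <;> rcases le_total 0 (a * Real.log a) with hn | hn
    · rw [ENNReal.ofReal_of_nonpos (p := -(a * Real.log a)) (by linarith),
        ENNReal.ofReal_of_nonpos (p := a * -Real.log s) (by nlinarith), add_zero, add_zero,
        ← ENNReal.ofReal_add ha (by positivity), ← ENNReal.ofReal_add k (by positivity),
        ← ENNReal.ofReal_add hn hs.le]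
      congr 1; ring
    · rw [ENNReal.ofReal_of_nonpos hn,
        ENNReal.ofReal_of_nonpos (p := a * -Real.log s) (by nlinarith), add_zero, zero_add,
        ← ENNReal.ofReal_add ha (by positivity),
        ← ENNReal.ofReal_add (add_nonneg ha (by positivity)) (by linarith),
        ← ENNReal.ofReal_add k (add_nonneg (add_nonneg ha (by positivity)) (by linarith))]
      congr 1; ring
    · have h1 : 0 ≤ a * -Real.log s := by nlinarith
      rw [ENNReal.ofReal_of_nonpos (p := -(a * Real.log a)) (by linarith),
        ENNReal.ofReal_of_nonpos (p := a * Real.log s) (by nlinarith), add_zero, add_zero,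
        ← ENNReal.ofReal_add k ha, ← ENNReal.ofReal_add hn h1,
        ← ENNReal.ofReal_add (add_nonneg hn h1) hs.le]
      congr 1; ring
    · have h1 : 0 ≤ a * -Real.log s := by nlinarith
      rw [ENNReal.ofReal_of_nonpos hn,
        ENNReal.ofReal_of_nonpos (p := a * Real.log s) (by nlinarith), add_zero, zero_add,
        ← ENNReal.ofReal_add ha (by linarith), ← ENNReal.ofReal_add k (by linarith),
        ← ENNReal.ofReal_add h1 hs.le]
      congr 1; ring

/-- The positive part of `Tr A log B`, in an eigenbasis of `B`. -/
def posLogSum {v : Set H} (c : HilbertBasis v ℂ H) (A B : H →L[ℂ] H) : ℝ≥0∞ :=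
  ∑' j, ENNReal.ofReal (eigval A (c j)) * ENNReal.ofReal (Real.log (eigval B (c j)))

/-- The negative part of `Tr A log B`, in an eigenbasis of `B`. -/
def negLogSum {v : Set H} (c : HilbertBasis v ℂ H) (A B : H →L[ℂ] H) : ℝ≥0∞ :=
  ∑' j, ENNReal.ofReal (eigval A (c j)) * negLog (eigval B (c j))

/-- The positive part of `-Tr A log A`, in an eigenbasis of `A`. -/
def posEntropySum {w : Set H} (b : HilbertBasis w ℂ H) (A : H →L[ℂ] H) : ℝ≥0∞ :=
  ∑' i, ENNReal.ofReal (Real.negMulLog (eigval A (b i)))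

/-- The negative part of `-Tr A log A`, in an eigenbasis of `A`. -/
def negEntropySum {w : Set H} (b : HilbertBasis w ℂ H) (A : H →L[ℂ] H) : ℝ≥0∞ :=
  ∑' i, ENNReal.ofReal (-Real.negMulLog (eigval A (b i)))

lemma tsum_overlap_mul_eigval {w : Set H} {b : HilbertBasis w ℂ H} {A : H →L[ℂ] H}
    (hb : IsEigenbasis b A) (hA : 0 ≤ A) (x : H) :
    ∑' i, ENNReal.ofReal (‖⟪b i, x⟫_ℂ‖ ^ 2) * ENNReal.ofReal (eigval A (b i))
      = ENNReal.ofReal (eigval A x) := by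
  have h := Complex.hasSum_re (b.hasSum_inner_mul_inner x (A x))
  have h2 : ∀ i, (⟪x, b i⟫_ℂ * ⟪b i, A x⟫_ℂ).re = ‖⟪b i, x⟫_ℂ‖ ^ 2 * eigval A (b i) := by
    intro i
    rw [hb.inner_apply hA.isSelfAdjoint, mul_left_comm, Complex.re_ofReal_mul,
      ← inner_conj_symm x, Complex.conj_mul', mul_comm]
    norm_cast
  simp_rw [h2] at h
  rw [eigval, ← h.tsum_eq, ENNReal.ofReal_tsum_of_nonneg
    (fun i => mul_nonneg (by positivity) (eigval_nonneg hA _)) h.summable]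
  exact tsum_congr fun i => (ENNReal.ofReal_mul (by positivity)).symm

lemma tsum_tsum_overlap_mul_eigval {w v : Set H} {b : HilbertBasis w ℂ H} {A : H →L[ℂ] H}
    (hb : IsEigenbasis b A) (hA : 0 ≤ A) (c : HilbertBasis v ℂ H) (f : v → ℝ≥0∞) :
    ∑' i, ∑' j, ENNReal.ofReal (‖⟪b i, c j⟫_ℂ‖ ^ 2) * (ENNReal.ofReal (eigval A (b i)) * f j)
      = ∑' j, ENNReal.ofReal (eigval A (c j)) * f j := by
  rw [ENNReal.tsum_comm]
  refine tsum_congr fun j => ?_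
  simp_rw [← mul_assoc]
  rw [ENNReal.tsum_mul_right, tsum_overlap_mul_eigval hb hA]

/-- The subtraction-free form of `H(A‖B) = Tr A log A - Tr A log B + Tr B - Tr A`, valid without any
finiteness assumption. -/
lemma relEntropy_add_eq [TopologicalSpace.SeparableSpace H] {w v : Set H}
    {b : HilbertBasis w ℂ H} {c : HilbertBasis v ℂ H} {A B : H →L[ℂ] H}
    (hb : IsEigenbasis b A) (hc : IsEigenbasis c B) (hA : 0 ≤ A) (hB : 0 ≤ B) :
    relEntropy A B + (posTrace A + posLogSum c A B + posEntropySum b A)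
      = negEntropySum b A + negLogSum c A B + posTrace B := by
  rw [relEntropy_eq_tsum hb hc hA hB, posTrace_eq_tsum_eigval hA b, posTrace_eq_tsum_eigval hB c,
    posEntropySum, negEntropySum, posLogSum, negLogSum,
    ← tsum_tsum_overlap_mul_eigval hb hA c, ← tsum_tsum_overlap_mul_eigval hb hA c,
    ← tsum_tsum_overlap_mul_left b c fun i => ENNReal.ofReal (eigval A (b i)),
    ← tsum_tsum_overlap_mul_left b c fun i => ENNReal.ofReal (Real.negMulLog (eigval A (b i))),
    ← tsum_tsum_overlap_mul_left b c fun i => ENNReal.ofReal (-Real.negMulLog (eigval A (b i))),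
    ← tsum_tsum_overlap_mul_right b c fun j => ENNReal.ofReal (eigval B (c j))]
  simp_rw [← ENNReal.tsum_add]
  refine tsum_congr fun i => tsum_congr fun j => ?_
  simp_rw [← mul_add]
  rw [klTerm_add_eq (eigval_nonneg hA (b i)) (eigval_nonneg hB (c j))]

lemma posLogSum_self {v : Set H} (c : HilbertBasis v ℂ H) {A : H →L[ℂ] H} (hA : 0 ≤ A) :
    posLogSum c A A = negEntropySum c A := by
  refine tsum_congr fun j => ?_
  rw [← ENNReal.ofReal_mul (eigval_nonneg hA _), Real.negMulLog]
  congr 1; ring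

lemma negLogSum_self {v : Set H} (c : HilbertBasis v ℂ H) {A : H →L[ℂ] H} (hA : 0 ≤ A) :
    negLogSum c A A = posEntropySum c A := by
  refine tsum_congr fun j => ?_
  rw [negLog]
  split_ifs with h
  · simp [h]
  · rw [← ENNReal.ofReal_mul (eigval_nonneg hA _), Real.negMulLog]
    congr 1; ring

lemma tsum_mul_ofReal_eigval {κ : Type*} {A : κ → H →L[ℂ] H} {q : κ → ℝ} (hq : ∀ k, 0 ≤ q k)
    {S : H →L[ℂ] H} (hS : HasSum (fun k => q k • A k) S) (hA : ∀ k, 0 ≤ A k) (x : H) :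
    ∑' k, ENNReal.ofReal (q k) * ENNReal.ofReal (eigval (A k) x) = ENNReal.ofReal (eigval S x) := by
  rw [eigval, ofReal_re_inner_of_hasSum hS (fun k => smul_nonneg (hq k) (hA k))]
  refine tsum_congr fun k => ?_
  rw [← ENNReal.ofReal_mul (hq k), ← eigval_smul, eigval]

lemma tsum_mul_tsum_eigval {κ : Type*} {A : κ → H →L[ℂ] H} {q : κ → ℝ} (hq : ∀ k, 0 ≤ q k)
    {S : H →L[ℂ] H} (hS : HasSum (fun k => q k • A k) S) (hA : ∀ k, 0 ≤ A k)
    {v : Set H} (c : HilbertBasis v ℂ H) (f : v → ℝ≥0∞) :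
    ∑' k, ENNReal.ofReal (q k) * ∑' j, ENNReal.ofReal (eigval (A k) (c j)) * f j
      = ∑' j, ENNReal.ofReal (eigval S (c j)) * f j := by
  simp_rw [← ENNReal.tsum_mul_left]
  rw [ENNReal.tsum_comm]
  refine tsum_congr fun j => ?_
  simp_rw [← mul_assoc]
  rw [ENNReal.tsum_mul_right, tsum_mul_ofReal_eigval hq hS hA]

lemma tsum_mul_posTrace {κ : Type*} {A : κ → H →L[ℂ] H} {q : κ → ℝ} (hq : ∀ k, 0 ≤ q k)
    {S : H →L[ℂ] H} (hS : HasSum (fun k => q k • A k) S) (hA : ∀ k, 0 ≤ A k) :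
    ∑' k, ENNReal.ofReal (q k) * posTrace (A k) = posTrace S := by
  rw [posTrace_of_hasSum hS fun k => smul_nonneg (hq k) (hA k)]
  exact tsum_congr fun k => (posTrace_smul _ (hq k)).symm

/-- Since `η(x) ≤ 1 - x ≤ 1` for `x ≥ 0`, the bound is the dimension, uniformly in `A`; hence
weighted sums over an ensemble stay finite in finite dimension. -/
lemma posEntropySum_le {w : Set H} (b : HilbertBasis w ℂ H) {A : H →L[ℂ] H} (hA : 0 ≤ A) :
    posEntropySum b A ≤ posTrace (1 : H →L[ℂ] H) := by
  rw [posTrace_eq zero_le_one b]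
  refine ENNReal.tsum_le_tsum fun i => ENNReal.ofReal_le_ofReal ?_
  have h1 := Real.negMulLog_le_one_sub_self (eigval_nonneg hA (b i))
  have h2 := eigval_nonneg hA (b i)
  have h3 : (⟪b i, (1 : H →L[ℂ] H) (b i)⟫_ℂ).re = 1 := by
    rw [one_apply_eq_self, inner_self_eq_norm_sq_to_K, b.orthonormal.1 i]; simp
  rw [h3]; linarith

/-- By linearity the terms `Tr A k log W` add up to `Tr S log W`, and the entropies of the `A k`
enter identically for the reference operators `W` and `S`, so they drop out. -/
lemma donald_of_finiteDimensional [FiniteDimensional ℂ H] [TopologicalSpace.SeparableSpace H]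
    {κ : Type*} {A : κ → H →L[ℂ] H} {q : κ → ℝ} (hq : ∀ k, 0 ≤ q k) (hqs : Summable q)
    {S W : H →L[ℂ] H} (hS : HasSum (fun k => q k • A k) S) (hA : ∀ k, 0 ≤ A k) (hW : 0 ≤ W) :
    ∑' k, ENNReal.ofReal (q k) * relEntropy (A k) W
        + ((∑' k, ENNReal.ofReal (q k)) * posTrace S + posTrace W)
      = ∑' k, ENNReal.ofReal (q k) * relEntropy (A k) S + relEntropy S W
        + ((∑' k, ENNReal.ofReal (q k)) * posTrace W + posTrace S) := by
  have hS0 : 0 ≤ S := nonneg_of_hasSum hS fun k => smul_nonneg (hq k) (hA k)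
  have htop : ∀ A : H →L[ℂ] H, posTrace A ≠ ⊤ := posTrace_ne_top_of_finiteDimensional
  choose w b hb using fun k => exists_isEigenbasis_of_posTrace_ne_top (hA k) (htop (A k))
  obtain ⟨v, c, hc⟩ := exists_isEigenbasis_of_posTrace_ne_top hW (htop W)
  obtain ⟨z, d, hd⟩ := exists_isEigenbasis_of_posTrace_ne_top hS0 (htop S)
  set Q := ∑' k, ENNReal.ofReal (q k) with hQ
  have hQtop : Q ≠ ⊤ := by
    rw [hQ, ← ENNReal.ofReal_tsum_of_nonneg hq hqs]; exact ENNReal.ofReal_ne_top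
  set Ep := ∑' k, ENNReal.ofReal (q k) * posEntropySum (b k) (A k) with hEp
  set Em := ∑' k, ENNReal.ofReal (q k) * negEntropySum (b k) (A k) with hEm
  have hEpt : Ep ≠ ⊤ := by
    refine ne_top_of_le_ne_top (ENNReal.mul_ne_top hQtop (htop 1)) ?_
    rw [hQ, ← ENNReal.tsum_mul_right]
    exact ENNReal.tsum_le_tsum fun k => by gcongr; exact posEntropySum_le _ (hA k)
  have hfin : Finite v := finite_of_hilbertBasis c
  have hfin' : Finite z := finite_of_hilbertBasis d
  have : Fintype v := Fintype.ofFinite v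
  have : Fintype z := Fintype.ofFinite z
  have hP : posLogSum c S W ≠ ⊤ := by
    rw [posLogSum, tsum_fintype]
    exact ENNReal.sum_ne_top.2 fun _ _ => ENNReal.mul_ne_top ENNReal.ofReal_ne_top
      ENNReal.ofReal_ne_top
  have he : posEntropySum d S ≠ ⊤ := by
    rw [posEntropySum, tsum_fintype]
    exact ENNReal.sum_ne_top.2 fun _ _ => ENNReal.ofReal_ne_top
  have hf : negEntropySum d S ≠ ⊤ := by
    rw [negEntropySum, tsum_fintype]
    exact ENNReal.sum_ne_top.2 fun _ _ => ENNReal.ofReal_ne_top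
  have hsum : ∀ {v : Set H} {c : HilbertBasis v ℂ H} {W : H →L[ℂ] H}, IsEigenbasis c W → 0 ≤ W →
      ∑' k, ENNReal.ofReal (q k) * relEntropy (A k) W + (posTrace S + posLogSum c S W + Ep)
        = Em + negLogSum c S W + Q * posTrace W := by
    intro v c W hc hW
    rw [← tsum_mul_posTrace hq hS hA, hEp, hEm, hQ, posLogSum, negLogSum,
      ← tsum_mul_tsum_eigval hq hS hA c, ← tsum_mul_tsum_eigval hq hS hA c,
      ← ENNReal.tsum_mul_right]
    simp_rw [← ENNReal.tsum_add, ← mul_add]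
    exact tsum_congr fun k => congrArg _ (relEntropy_add_eq (hb k) hc (hA k) hW)
  have e1 := hsum hc hW
  have e2 := hsum hd hS0
  have e3 := relEntropy_add_eq hd hc hS0 hW
  rw [posLogSum_self d hS0, negLogSum_self d hS0] at e2
  set D1 := ∑' k, ENNReal.ofReal (q k) * relEntropy (A k) W
  set D2 := ∑' k, ENNReal.ofReal (q k) * relEntropy (A k) S
  -- Only these terms are cancelled. `Em` and `negLogSum c S W` need not be finite and are never
  -- subtracted.
  have hZ : posTrace S + posLogSum c S W + Ep + posEntropySum d S + negEntropySum d S ≠ ⊤ := by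
    simp [htop, hP, hEpt, he, hf]
  rw [← ENNReal.add_left_inj hZ]
  calc _ = (D1 + (posTrace S + posLogSum c S W + Ep))
        + (Q * posTrace S + posTrace W + posEntropySum d S + negEntropySum d S) := by ring
    _ = (Em + posEntropySum d S + Q * posTrace S)
        + (negEntropySum d S + negLogSum c S W + posTrace W) + Q * posTrace W := by rw [e1]; ring
    _ = _ := by rw [← e2, ← e3]; ring

lemma tendsto_tsum_of_monotone {κ : Type*} {f : ℕ → κ → ℝ≥0∞} (hf : Monotone f) :
    Filter.Tendsto (fun n => ∑' k, f n k) Filter.atTop (nhds (∑' k, ⨆ n, f n k)) := by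
  have h : ∑' k, ⨆ n, f n k = ⨆ n, ∑' k, f n k := by
    simp_rw [ENNReal.tsum_eq_iSup_sum]
    rw [iSup_comm]
    congr with s
    exact ENNReal.finsetSum_iSup_of_monotone fun k m n hmn => hf hmn k
  rw [h]
  exact tendsto_atTop_iSup fun m n hmn => ENNReal.tsum_le_tsum (hf hmn)

/-- **Donald's identity** for positive trace-class operators. -/
theorem donald [TopologicalSpace.SeparableSpace H]
    {κ : Type*} {A : κ → H →L[ℂ] H} {q : κ → ℝ} (hq : ∀ k, 0 ≤ q k) (hqs : Summable q)
    {S W : H →L[ℂ] H} (hS : HasSum (fun k => q k • A k) S) (hA : ∀ k, 0 ≤ A k) (hW : 0 ≤ W)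
    (htA : ∀ k, posTrace (A k) ≠ ⊤) (htS : posTrace S ≠ ⊤) (htW : posTrace W ≠ ⊤) :
    ∑' k, ENNReal.ofReal (q k) * relEntropy (A k) W
        + ((∑' k, ENNReal.ofReal (q k)) * posTrace S + posTrace W)
      = ∑' k, ENNReal.ofReal (q k) * relEntropy (A k) S + relEntropy S W
        + ((∑' k, ENNReal.ofReal (q k)) * posTrace W + posTrace S) := by
  have hS0 : 0 ≤ S := nonneg_of_hasSum hS fun k => smul_nonneg (hq k) (hA k)
  obtain ⟨K, hfd, hmono, hd⟩ := exists_finiteDimensional_exhaustion H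
  have hQtop : ∑' k, ENNReal.ofReal (q k) ≠ ⊤ := by
    rw [← ENNReal.ofReal_tsum_of_nonneg hq hqs]; exact ENNReal.ofReal_ne_top
  have hrel : ∀ {A B : H →L[ℂ] H}, 0 ≤ A → 0 ≤ B → posTrace A ≠ ⊤ → posTrace B ≠ ⊤ →
      Filter.Tendsto (fun n => relEntropy (compress (K n) A) (compress (K n) B)) Filter.atTop
        (nhds (relEntropy A B)) := fun hA hB htA htB => by
    rw [relEntropy_eq_iSup_compress hmono hd hA hB htA htB]
    exact tendsto_atTop_iSup (monotone_relEntropy_compress hmono hA hB)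
  have htr : ∀ {B : H →L[ℂ] H}, 0 ≤ B → posTrace B ≠ ⊤ →
      Filter.Tendsto (fun n => posTrace (compress (K n) B)) Filter.atTop
        (nhds (posTrace B)) := fun hB htB => by
    rw [posTrace_eq_iSup_compress hmono hd hB htB]
    exact tendsto_atTop_iSup (monotone_posTrace_compress hmono hB)
  have hsum : ∀ {B : H →L[ℂ] H}, 0 ≤ B → posTrace B ≠ ⊤ → Filter.Tendsto
      (fun n => ∑' k, ENNReal.ofReal (q k) * relEntropy (compress (K n) (A k)) (compress (K n) B))
      Filter.atTop (nhds (∑' k, ENNReal.ofReal (q k) * relEntropy (A k) B)) := fun hB htB => by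
    simp_rw [fun k => relEntropy_eq_iSup_compress hmono hd (hA k) hB (htA k) htB, ENNReal.mul_iSup]
    refine tendsto_tsum_of_monotone fun m n hmn k => ?_
    dsimp only
    gcongr
    exact monotone_relEntropy_compress hmono (hA k) hB hmn
  -- The identity contains no subtraction, so both sides converge in `[0, ∞]` along the compressions
  -- even when the limits are infinite.
  have hL := (hsum hW htW).add
    ((ENNReal.Tendsto.const_mul (htr hS0 htS) (Or.inr hQtop)).add (htr hW htW))
  have hR := ((hsum hS0 htS).add (hrel hS0 hW htS htW)).add
    ((ENNReal.Tendsto.const_mul (htr hW htW) (Or.inr hQtop)).add (htr hS0 htS))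
  refine tendsto_nhds_unique hL (hR.congr fun n => ?_)
  have h1 := hasSum_compress (K n) hS
  simp_rw [compress_smul] at h1
  exact (donald_of_finiteDimensional hq hqs h1 (fun k => compress_nonneg _ (hA k))
    (compress_nonneg _ hW)).symm

/-! ### The continuity bound for sums of Holevo quantities -/

section

variable [TopologicalSpace.SeparableSpace H]

/-- Joint convexity holds for arbitrary nonnegative weights; two unit weights turn it into
subadditivity. -/
lemma relEntropy_add_le {A A' B B' : H →L[ℂ] H} (hA : 0 ≤ A) (hA' : 0 ≤ A') (hB : 0 ≤ B)
    (hB' : 0 ≤ B') (htA : posTrace A ≠ ⊤) (htA' : posTrace A' ≠ ⊤) (htB : posTrace B ≠ ⊤)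
    (htB' : posTrace B' ≠ ⊤) :
    relEntropy (A + A') (B + B') ≤ relEntropy A B + relEntropy A' B' := by
  have h := relEntropy_hasSum_le (κ := Bool) (A := fun k => cond k A A') (B := fun k => cond k B B')
    (q := fun _ => 1) (S := A + A') (T := B + B') (fun _ => zero_le_one)
    (by convert hasSum_fintype (fun k : Bool => (1 : ℝ) • cond k A A') using 1; simp)
    (by convert hasSum_fintype (fun k : Bool => (1 : ℝ) • cond k B B') using 1; simp)
    (by rintro (_ | _) <;> assumption) (by rintro (_ | _) <;> assumption)
    (by rintro (_ | _) <;> assumption) (by rintro (_ | _) <;> assumption)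
    (by rw [posTrace_add hA hA']; exact ENNReal.add_ne_top.2 ⟨htA, htA'⟩)
    (by rw [posTrace_add hB hB']; exact ENNReal.add_ne_top.2 ⟨htB, htB'⟩)
  simpa [tsum_fintype] using h

/-- Subadditivity for the pairs `(A, A)` and `(0, B)`. -/
lemma relEntropy_add_right_le {A B : H →L[ℂ] H} (hA : 0 ≤ A) (hB : 0 ≤ B)
    (htA : posTrace A ≠ ⊤) (htB : posTrace B ≠ ⊤) : relEntropy A (A + B) ≤ posTrace B := by
  have h := relEntropy_add_le hA le_rfl hA hB htA (by simp) htA htB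
  rwa [add_zero, relEntropy_self hA htA, zero_add, relEntropy_zero_left hB htB] at h

/-- Donald's identity with two unit weights. The weights add up to `2`, so after cancellation one
trace survives on each side. -/
lemma donald_pair {A B W : H →L[ℂ] H} (hA : 0 ≤ A) (hB : 0 ≤ B) (hW : 0 ≤ W)
    (htA : posTrace A ≠ ⊤) (htB : posTrace B ≠ ⊤) (htW : posTrace W ≠ ⊤) :
    relEntropy A W + relEntropy B W + posTrace (A + B)
      = relEntropy A (A + B) + relEntropy B (A + B) + relEntropy (A + B) W + posTrace W := by
  have htS : posTrace (A + B) ≠ ⊤ := by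
    rw [posTrace_add hA hB]; exact ENNReal.add_ne_top.2 ⟨htA, htB⟩
  have h := donald (κ := Bool) (A := fun k => cond k A B) (q := fun _ => 1) (S := A + B) (W := W)
    (fun _ => zero_le_one) (hasSum_fintype _).summable
    (by convert hasSum_fintype (fun k : Bool => (1 : ℝ) • cond k A B) using 1; simp)
    (by rintro (_ | _) <;> assumption) hW (by rintro (_ | _) <;> assumption) htS htW
  simp only [ENNReal.ofReal_one, one_mul, tsum_fintype, Fintype.sum_bool, cond_true,
    cond_false] at h
  rw [← ENNReal.add_left_inj (ENNReal.add_ne_top.2 ⟨htS, htW⟩)]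
  calc _ = relEntropy A W + relEntropy B W + ((1 + 1) * posTrace (A + B) + posTrace W) := by ring
    _ = _ := by rw [h]; ring

lemma donald_of_hasSum_one {κ : Type*} {A : κ → H →L[ℂ] H} {q : κ → ℝ} (hq : ∀ k, 0 ≤ q k)
    (hqs : HasSum q 1) {S W : H →L[ℂ] H} (hS : HasSum (fun k => q k • A k) S)
    (hA : ∀ k, 0 ≤ A k) (hW : 0 ≤ W) (htA : ∀ k, posTrace (A k) ≠ ⊤) (htS : posTrace S ≠ ⊤)
    (htW : posTrace W ≠ ⊤) :
    ∑' k, ENNReal.ofReal (q k) * relEntropy (A k) W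
      = ∑' k, ENNReal.ofReal (q k) * relEntropy (A k) S + relEntropy S W := by
  have h := donald hq hqs.summable hS hA hW htA htS htW
  rw [← ENNReal.ofReal_tsum_of_nonneg hq hqs.summable, hqs.tsum_eq, ENNReal.ofReal_one, one_mul,
    one_mul] at h
  rw [← ENNReal.add_left_inj (ENNReal.add_ne_top.2 ⟨htS, htW⟩), h, add_comm (posTrace S)]

/-- Separation of the relative entropy into a normalized part and a part that depends on the traces
only. -/
lemma relEntropy_eq_add_klTerm {A B : H →L[ℂ] H} (hA : 0 ≤ A) (hB : 0 ≤ B) {a b : ℝ}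
    (ha : 0 ≤ a) (hb : 0 < b) (htA : posTrace A = ENNReal.ofReal a)
    (htB : posTrace B = ENNReal.ofReal b) :
    relEntropy A B = relEntropy A ((a / b) • B) + klTerm a b := by
  have htA' : posTrace A ≠ ⊤ := htA ▸ ENNReal.ofReal_ne_top
  have htB' : posTrace B ≠ ⊤ := htB ▸ ENNReal.ofReal_ne_top
  rcases ha.eq_or_lt with rfl | ha
  · rw [ENNReal.ofReal_zero] at htA
    rw [eq_zero_of_posTrace_eq_zero hA htA, relEntropy_zero_left hB htB', zero_div, zero_smul,
      relEntropy_self le_rfl (by simp), zero_add, klTerm_zero_left, htB]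
  have hr : 0 < a / b := div_pos ha hb
  have h := relEntropy_smul_right hA hB htA' htB' hr
  rw [htA, htB] at h
  have hrb : a / b * b = a := div_mul_cancel₀ _ hb.ne'
  have hk : klTerm a b + (ENNReal.ofReal (-Real.log (a / b)) * ENNReal.ofReal a
      + ENNReal.ofReal (a / b) * ENNReal.ofReal b)
      = ENNReal.ofReal (Real.log (a / b)) * ENNReal.ofReal a + ENNReal.ofReal b := by
    have h2 := klTerm_mul_right ha.le hb.le hr
    rw [hrb] at h2
    rw [← h2, klTerm, if_neg (fun h => ha.ne' h.1)]
    simp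
  rw [← ENNReal.add_left_inj (a := ENNReal.ofReal (-Real.log (a / b)) * ENNReal.ofReal a
      + ENNReal.ofReal (a / b) * ENNReal.ofReal b) (ENNReal.add_ne_top.2
        ⟨ENNReal.mul_ne_top ENNReal.ofReal_ne_top ENNReal.ofReal_ne_top,
          ENNReal.mul_ne_top ENNReal.ofReal_ne_top ENNReal.ofReal_ne_top⟩), ← h, add_assoc, hk]

/-- Monotonicity of the relative entropy under the trace, obtained by dropping the normalized part.
-/
lemma klTerm_le_relEntropy {A B : H →L[ℂ] H} (hA : 0 ≤ A) (hB : 0 ≤ B) {a b : ℝ}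
    (ha : 0 ≤ a) (hb : 0 < b) (htA : posTrace A = ENNReal.ofReal a)
    (htB : posTrace B = ENNReal.ofReal b) : klTerm a b ≤ relEntropy A B := by
  rw [relEntropy_eq_add_klTerm hA hB ha hb htA htB]; exact le_add_self

end

/-! ### The function `g` and pairs of operators. -/

lemma gFun_eq {ε : ℝ} (hε : 0 ≤ ε) :
    gFun ε = (1 + ε) * Real.log (1 + ε) - ε * Real.log ε := by
  rcases hε.eq_or_lt with rfl | hε
  · simp [gFun]
  have h1 : (0 : ℝ) < 1 + ε := by linarith
  rw [gFun, Real.binEntropy_eq_negMulLog_add_negMulLog_one_sub]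
  have : 1 - ε / (1 + ε) = 1 / (1 + ε) := by field_simp; ring
  rw [this, Real.negMulLog, Real.negMulLog, Real.log_div hε.ne' h1.ne',
    Real.log_div one_ne_zero h1.ne', Real.log_one]
  field_simp
  ring

lemma gFun_nonneg {ε : ℝ} (hε : 0 ≤ ε) : 0 ≤ gFun ε := by
  have h1 : (0 : ℝ) < 1 + ε := by linarith
  exact mul_nonneg h1.le (Real.binEntropy_nonneg (by positivity)
    ((div_le_one h1).2 (by linarith)))

/-- The origin of `g`: for scalars `1` and `ε` the pair entropy falls short of its upper bound `1 +
ε` by exactly `g(ε)`. -/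
lemma klTerm_add_klTerm_add_gFun {ε : ℝ} (hε : 0 ≤ ε) :
    klTerm 1 (1 + ε) + klTerm ε (1 + ε) + ENNReal.ofReal (gFun ε) = ENNReal.ofReal (1 + ε) := by
  have h1 : (0 : ℝ) < 1 + ε := by linarith
  have k1 := klTerm_nonneg_aux zero_le_one h1
  have k2 := klTerm_nonneg_aux hε h1
  rw [klTerm, if_neg (fun h => h1.ne' h.1), klTerm, if_neg (fun h => h1.ne' h.1),
    ← ENNReal.ofReal_add k1 k2, ← ENNReal.ofReal_add (add_nonneg k1 k2) (gFun_nonneg hε),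
    gFun_eq hε, Real.log_one]
  congr 1; ring

/-- The sum of the unnormalized relative entropies of two operators with respect to their sum. -/
def pairEntropy (A B : H →L[ℂ] H) : ℝ≥0∞ := relEntropy A (A + B) + relEntropy B (A + B)

section

variable [TopologicalSpace.SeparableSpace H]

lemma pairEntropy_le {A B : H →L[ℂ] H} (hA : 0 ≤ A) (hB : 0 ≤ B) (htA : posTrace A ≠ ⊤)
    (htB : posTrace B ≠ ⊤) : pairEntropy A B ≤ posTrace (A + B) := by
  rw [posTrace_add hA hB, add_comm (posTrace A)]
  refine add_le_add (relEntropy_add_right_le hA hB htA htB) ?_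
  rw [add_comm A]
  exact relEntropy_add_right_le hB hA htB htA

/-- Monotonicity under the trace replaces both relative entropies by their values on the traces `1`,
`ε` and `1 + ε`. -/
lemma le_pairEntropy_add_gFun {A B : H →L[ℂ] H} (hA : 0 ≤ A) (hB : 0 ≤ B) {ε : ℝ} (hε : 0 ≤ ε)
    (htA : posTrace A = 1) (htB : posTrace B = ENNReal.ofReal ε) :
    posTrace (A + B) ≤ pairEntropy A B + ENNReal.ofReal (gFun ε) := by
  have h1 : (0 : ℝ) < 1 + ε := by linarith
  have hS : posTrace (A + B) = ENNReal.ofReal (1 + ε) := by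
    rw [posTrace_add hA hB, htA, htB, ENNReal.ofReal_add zero_le_one hε, ENNReal.ofReal_one]
  rw [hS, ← klTerm_add_klTerm_add_gFun hε, pairEntropy]
  gcongr
  · exact klTerm_le_relEntropy hA (add_nonneg hA hB) zero_le_one h1 (by simp [htA]) hS
  · exact klTerm_le_relEntropy hB (add_nonneg hA hB) hε h1 htB hS

lemma pairEntropy_hasSum_le [Countable ι] {A B : ι → H →L[ℂ] H} {p : ι → ℝ} (hp : ∀ k, 0 ≤ p k)
    {S T : H →L[ℂ] H} (hS : HasSum (fun k => p k • A k) S)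
    (hT : HasSum (fun k => p k • B k) T) (hA : ∀ k, 0 ≤ A k) (hB : ∀ k, 0 ≤ B k)
    (htA : ∀ k, posTrace (A k) ≠ ⊤) (htB : ∀ k, posTrace (B k) ≠ ⊤)
    (htS : posTrace S ≠ ⊤) (htT : posTrace T ≠ ⊤) :
    pairEntropy S T ≤ ∑' k, ENNReal.ofReal (p k) * pairEntropy (A k) (B k) := by
  have hS0 : 0 ≤ S := nonneg_of_hasSum hS fun k => smul_nonneg (hp k) (hA k)
  have hT0 : 0 ≤ T := nonneg_of_hasSum hT fun k => smul_nonneg (hp k) (hB k)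
  have hST : HasSum (fun k => p k • (A k + B k)) (S + T) := by
    simpa only [smul_add] using hS.add hT
  have htAB : ∀ k, posTrace (A k + B k) ≠ ⊤ := fun k => by
    rw [posTrace_add (hA k) (hB k)]; exact ENNReal.add_ne_top.2 ⟨htA k, htB k⟩
  have htST : posTrace (S + T) ≠ ⊤ := by
    rw [posTrace_add hS0 hT0]; exact ENNReal.add_ne_top.2 ⟨htS, htT⟩
  simp_rw [pairEntropy, mul_add]
  rw [ENNReal.tsum_add]
  exact add_le_add
    (relEntropy_hasSum_le hp hS hST hA (fun k => add_nonneg (hA k) (hB k)) htA htAB htS htST)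
    (relEntropy_hasSum_le hp hT hST hB (fun k => add_nonneg (hA k) (hB k)) htB htAB htT htST)

/-- Two decompositions of the total relative entropy of the operators `Aᵢ`, `Nᵢ`. -/
lemma sum_relEntropy_add_pairEntropy {A N : ι → H →L[ℂ] H} {p : ι → ℝ}
    (hp : ∀ k, 0 ≤ p k) (hp1 : HasSum p 1)
    {S T : H →L[ℂ] H} (hS : HasSum (fun k => p k • A k) S)
    (hT : HasSum (fun k => p k • N k) T) (hA : ∀ k, 0 ≤ A k) (hN : ∀ k, 0 ≤ N k)
    (htA : ∀ k, posTrace (A k) ≠ ⊤) (htN : ∀ k, posTrace (N k) ≠ ⊤)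
    (htS : posTrace S ≠ ⊤) (htT : posTrace T ≠ ⊤) :
    ∑' k, ENNReal.ofReal (p k) * relEntropy (A k) S + ∑' k, ENNReal.ofReal (p k) * relEntropy (N k) T
        + pairEntropy S T
      = ∑' k, ENNReal.ofReal (p k) * pairEntropy (A k) (N k)
        + ∑' k, ENNReal.ofReal (p k) * relEntropy (A k + N k) (S + T) := by
  have hS0 : 0 ≤ S := nonneg_of_hasSum hS fun k => smul_nonneg (hp k) (hA k)
  have hT0 : 0 ≤ T := nonneg_of_hasSum hT fun k => smul_nonneg (hp k) (hN k)
  have hST : HasSum (fun k => p k • (A k + N k)) (S + T) := by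
    simpa only [smul_add] using hS.add hT
  have htST : posTrace (S + T) ≠ ⊤ := by
    rw [posTrace_add hS0 hT0]; exact ENNReal.add_ne_top.2 ⟨htS, htT⟩
  have hST0 := add_nonneg hS0 hT0
  -- `h1` and `h2` apply Donald's identity within each family, `h3` within each pair `(A k, N k)`.
  -- Both ways compute `∑ p k (H(A k‖S+T) + H(N k‖S+T))`; the extra traces in `h3` cancel on
  -- average.
  have h1 := donald_of_hasSum_one hp hp1 hS hA hST0 htA htS htST
  have h2 := donald_of_hasSum_one hp hp1 hT hN hST0 htN htT htST
  have h3 := fun k => donald_pair (hA k) (hN k) hST0 (htA k) (htN k) htST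
  have h4 := tsum_mul_posTrace hp hST fun k => add_nonneg (hA k) (hN k)
  have h5 : ∑' k, ENNReal.ofReal (p k) * posTrace (S + T) = posTrace (S + T) := by
    rw [ENNReal.tsum_mul_right, ← ENNReal.ofReal_tsum_of_nonneg hp hp1.summable, hp1.tsum_eq,
      ENNReal.ofReal_one, one_mul]
  rw [← ENNReal.add_left_inj htST]
  calc _ = ∑' k, ENNReal.ofReal (p k) * relEntropy (A k) (S + T)
        + ∑' k, ENNReal.ofReal (p k) * relEntropy (N k) (S + T) + posTrace (S + T) := by
        rw [h1, h2, pairEntropy]; ring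
    _ = ∑' k, ENNReal.ofReal (p k) * (relEntropy (A k) (S + T) + relEntropy (N k) (S + T)
          + posTrace (A k + N k)) := by
        conv_lhs => rw [← h4]
        simp_rw [mul_add, ENNReal.tsum_add]
    _ = ∑' k, ENNReal.ofReal (p k) * (pairEntropy (A k) (N k) + relEntropy (A k + N k) (S + T)
          + posTrace (S + T)) := by simp_rw [h3, pairEntropy]
    _ = _ := by
        simp_rw [mul_add, ENNReal.tsum_add]
        rw [h5]

/-- The bound is uniform in `e`, which makes the averaged normalization term `Z` of the next theorem
finite, hence cancellable. -/
lemma klTerm_le_of_le_one {e ε : ℝ} (he : 0 ≤ e) (he1 : e ≤ 1) (hε : 0 < ε) :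
    klTerm e ε ≤ ENNReal.ofReal (|Real.log ε| + ε) := by
  rw [klTerm, if_neg (fun h => hε.ne' h.1)]
  refine ENNReal.ofReal_le_ofReal ?_
  have h1 := Real.mul_log_nonpos he he1
  have h2 : -(e * Real.log ε) ≤ |Real.log ε| := by
    have := neg_abs_le (Real.log ε)
    have := abs_nonneg (Real.log ε)
    nlinarith
  linarith

/-- The abstract form of the continuity bound: if `Aᵢ + Nᵢ = Bᵢ + Pᵢ`, then the Holevo quantities of
`{pᵢ, Aᵢ}` and `{pᵢ, Nᵢ}` are controlled by those of `{pᵢ, Bᵢ}` and `{pᵢ, Pᵢ}`. -/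
theorem sum_relEntropy_le_of_add_eq_add [Countable ι] {A N B P : ι → H →L[ℂ] H} {p e : ι → ℝ}
    (hp : ∀ k, 0 ≤ p k) (hp1 : HasSum p 1) (he : ∀ k, 0 ≤ e k) (he1 : ∀ k, e k ≤ 1) {ε : ℝ}
    (hε : 0 < ε) {S T U V : H →L[ℂ] H}
    (hS : HasSum (fun k => p k • A k) S) (hT : HasSum (fun k => p k • N k) T)
    (hU : HasSum (fun k => p k • B k) U) (hV : HasSum (fun k => p k • P k) V)
    (hA : ∀ k, 0 ≤ A k) (hN : ∀ k, 0 ≤ N k) (hB : ∀ k, 0 ≤ B k) (hP : ∀ k, 0 ≤ P k)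
    (htA : ∀ k, posTrace (A k) = 1) (htB : ∀ k, posTrace (B k) = 1)
    (htN : ∀ k, posTrace (N k) = ENNReal.ofReal (e k))
    (htP : ∀ k, posTrace (P k) = ENNReal.ofReal (e k)) (hε' : HasSum (fun k => p k * e k) ε)
    (hadd : ∀ k, A k + N k = B k + P k) :
    ∑' k, ENNReal.ofReal (p k) * relEntropy (A k) S
        + ∑' k, ENNReal.ofReal (p k) * relEntropy (N k) ((e k / ε) • T)
      ≤ ∑' k, ENNReal.ofReal (p k) * relEntropy (B k) U
        + ∑' k, ENNReal.ofReal (p k) * relEntropy (P k) ((e k / ε) • V)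
        + ENNReal.ofReal (gFun ε) := by
  have hS0 : 0 ≤ S := nonneg_of_hasSum hS fun k => smul_nonneg (hp k) (hA k)
  have hT0 : 0 ≤ T := nonneg_of_hasSum hT fun k => smul_nonneg (hp k) (hN k)
  have hU0 : 0 ≤ U := nonneg_of_hasSum hU fun k => smul_nonneg (hp k) (hB k)
  have hV0 : 0 ≤ V := nonneg_of_hasSum hV fun k => smul_nonneg (hp k) (hP k)
  have hsp : ∑' k, ENNReal.ofReal (p k) = 1 := by
    rw [← ENNReal.ofReal_tsum_of_nonneg hp hp1.summable, hp1.tsum_eq, ENNReal.ofReal_one]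
  have hse : ∑' k, ENNReal.ofReal (p k) * ENNReal.ofReal (e k) = ENNReal.ofReal ε := by
    rw [← hε'.tsum_eq, ENNReal.ofReal_tsum_of_nonneg (fun k => mul_nonneg (hp k) (he k))
      hε'.summable]
    exact tsum_congr fun k => (ENNReal.ofReal_mul (hp k)).symm
  have htS : posTrace S = 1 := by
    rw [← tsum_mul_posTrace hp hS hA]; simp_rw [htA, mul_one, hsp]
  have htU : posTrace U = 1 := by
    rw [← tsum_mul_posTrace hp hU hB]; simp_rw [htB, mul_one, hsp]
  have htT : posTrace T = ENNReal.ofReal ε := by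
    rw [← tsum_mul_posTrace hp hT hN]; simp_rw [htN, hse]
  have htV : posTrace V = ENNReal.ofReal ε := by
    rw [← tsum_mul_posTrace hp hV hP]; simp_rw [htP, hse]
  have fA : ∀ k, posTrace (A k) ≠ ⊤ := fun k => by simp [htA k]
  have fB : ∀ k, posTrace (B k) ≠ ⊤ := fun k => by simp [htB k]
  have fN : ∀ k, posTrace (N k) ≠ ⊤ := fun k => by simp [htN k]
  have fP : ∀ k, posTrace (P k) ≠ ⊤ := fun k => by simp [htP k]
  have fS : posTrace S ≠ ⊤ := by simp [htS]
  have fT : posTrace T ≠ ⊤ := by simp [htT]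
  have fU : posTrace U ≠ ⊤ := by simp [htU]
  have fV : posTrace V ≠ ⊤ := by simp [htV]
  have hSTUV : S + T = U + V := by
    have h1 := hS.add hT
    have h2 := hU.add hV
    simp_rw [← smul_add, hadd] at h1
    simp_rw [← smul_add] at h2
    exact h1.unique h2
  have i1 := sum_relEntropy_add_pairEntropy hp hp1 hS hT hA hN fA fN fS fT
  have i2 := sum_relEntropy_add_pairEntropy hp hp1 hU hV hB hP fB fP fU fV
  simp_rw [← hadd, ← hSTUV] at i2
  -- The cost of renormalizing the second argument depends on traces alone, and `N k`, `P k` have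
  -- equal traces, so `Z` is common to both splittings.
  set Z := ∑' k, ENNReal.ofReal (p k) * klTerm (e k) ε with hZ
  have z1 : ∑' k, ENNReal.ofReal (p k) * relEntropy (N k) T
      = ∑' k, ENNReal.ofReal (p k) * relEntropy (N k) ((e k / ε) • T) + Z := by
    rw [hZ, ← ENNReal.tsum_add]
    exact tsum_congr fun k => by
      rw [relEntropy_eq_add_klTerm (hN k) hT0 (he k) hε (htN k) htT, mul_add]
  have z2 : ∑' k, ENNReal.ofReal (p k) * relEntropy (P k) V
      = ∑' k, ENNReal.ofReal (p k) * relEntropy (P k) ((e k / ε) • V) + Z := by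
    rw [hZ, ← ENNReal.tsum_add]
    exact tsum_congr fun k => by
      rw [relEntropy_eq_add_klTerm (hP k) hV0 (he k) hε (htP k) htV, mul_add]
  have fZ : Z ≠ ⊤ := by
    refine ne_top_of_le_ne_top (b := ENNReal.ofReal (|Real.log ε| + ε)) ENNReal.ofReal_ne_top ?_
    calc Z ≤ ∑' k, ENNReal.ofReal (p k) * ENNReal.ofReal (|Real.log ε| + ε) :=
          ENNReal.tsum_le_tsum fun k => by gcongr; exact klTerm_le_of_le_one (he k) (he1 k) hε
      _ = _ := by rw [ENNReal.tsum_mul_right, hsp, one_mul]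
  have sum_le : ∀ {A N : ι → H →L[ℂ] H} {S T : H →L[ℂ] H}, HasSum (fun k => p k • A k) S →
      HasSum (fun k => p k • N k) T → (∀ k, 0 ≤ A k) → (∀ k, 0 ≤ N k) →
      (∀ k, posTrace (A k) ≠ ⊤) → (∀ k, posTrace (N k) ≠ ⊤) →
      ∑' k, ENNReal.ofReal (p k) * pairEntropy (A k) (N k) ≤ posTrace (S + T) := by
    intro A N S T hS hT hA hN fA fN
    have hST : HasSum (fun k => p k • (A k + N k)) (S + T) := by
      simpa only [smul_add] using hS.add hT
    rw [← tsum_mul_posTrace hp hST fun k => add_nonneg (hA k) (hN k)]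
    exact ENNReal.tsum_le_tsum fun k => by gcongr; exact pairEntropy_le (hA k) (hN k) (fA k) (fN k)
  have fST : posTrace (S + T) ≠ ⊤ := by
    rw [posTrace_add hS0 hT0]; exact ENNReal.add_ne_top.2 ⟨fS, fT⟩
  -- For `(A, N)` the convexity gap is bounded above by `g(ε)`; for `(B, P)` only its nonnegativity
  -- `j2` is used.
  have j1 : ∑' k, ENNReal.ofReal (p k) * pairEntropy (A k) (N k)
      ≤ pairEntropy S T + ENNReal.ofReal (gFun ε) :=
    (sum_le hS hT hA hN fA fN).trans (le_pairEntropy_add_gFun hS0 hT0 hε.le htS htT)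
  have j2 := pairEntropy_hasSum_le hp hU hV hB hP fB fP fU fV
  have fBP : ∑' k, ENNReal.ofReal (p k) * pairEntropy (B k) (P k) ≠ ⊤ :=
    ne_top_of_le_ne_top (hSTUV ▸ fST) (sum_le hU hV hB hP fB fP)
  have fpST : pairEntropy S T ≠ ⊤ := ne_top_of_le_ne_top fST (pairEntropy_le hS0 hT0 fS fT)
  rw [z1] at i1
  rw [z2] at i2
  set a1 := ∑' k, ENNReal.ofReal (p k) * relEntropy (A k) S
  set n1 := ∑' k, ENNReal.ofReal (p k) * relEntropy (N k) ((e k / ε) • T)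
  set b1 := ∑' k, ENNReal.ofReal (p k) * relEntropy (B k) U
  set p1 := ∑' k, ENNReal.ofReal (p k) * relEntropy (P k) ((e k / ε) • V)
  set KA := ∑' k, ENNReal.ofReal (p k) * pairEntropy (A k) (N k)
  set KB := ∑' k, ENNReal.ofReal (p k) * pairEntropy (B k) (P k)
  set X := ∑' k, ENNReal.ofReal (p k) * relEntropy (A k + N k) (S + T)
  have hfin : Z + pairEntropy S T + KB ≠ ⊤ := by simp [fZ, fpST, fBP]
  rw [← ENNReal.add_le_add_iff_right hfin]
  calc _ = (a1 + (n1 + Z) + pairEntropy S T) + KB := by ring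
    _ = KA + (KB + X) := by rw [i1]; ring
    _ = KA + (b1 + (p1 + Z) + pairEntropy U V) := by rw [i2]
    _ ≤ (pairEntropy S T + ENNReal.ofReal (gFun ε)) + (b1 + (p1 + Z) + KB) := by gcongr
    _ = _ := by ring

end

/-! ### Functional calculus and eigenvectors -/

lemma mem_spectrum_of_apply_eq_smul {A : H →L[ℂ] H} {x : H} (hx : x ≠ 0) {l : ℝ}
    (h : A x = l • x) : l ∈ spectrum ℝ A := by
  rw [spectrum.mem_iff]
  rintro ⟨u, hu⟩
  have h1 : (algebraMap ℝ (H →L[ℂ] H) l - A) x = 0 := by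
    rw [sub_apply, h, Algebra.algebraMap_eq_smul_one, smul_apply, one_apply_eq_self, sub_self]
  apply hx
  have h2 : ((u⁻¹ : (H →L[ℂ] H)ˣ) : H →L[ℂ] H) ((u : H →L[ℂ] H) x) = x := by
    rw [← mul_apply_eq_comp, Units.inv_mul, one_apply_eq_self]
  rw [← h2, hu, h1, map_zero]

/-- Stone–Weierstrass: the functions for which this holds form a closed subalgebra that contains the
constants and the identity. -/
lemma cfc_apply_of_apply_eq_smul {A : H →L[ℂ] H} (hA : IsSelfAdjoint A) {f : ℝ → ℝ}
    (hf : ContinuousOn f (spectrum ℝ A)) {x : H} {l : ℝ} (h : A x = l • x) :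
    cfc f A x = f l • x := by
  by_cases hx : x = 0
  · simp [hx]
  have hl := mem_spectrum_of_apply_eq_smul hx h
  have key : ∀ g : C(spectrum ℝ A, ℝ), cfcHom hA g x = g ⟨l, hl⟩ • x := by
    have hid : cfcHom hA (.restrict (spectrum ℝ A) (.id ℝ)) x = l • x := by rw [cfcHom_id, h]
    intro g
    induction g using ContinuousMap.induction_on_of_compact with
    | const r =>
      have : (ContinuousMap.const (spectrum ℝ A) r) = algebraMap ℝ C(spectrum ℝ A, ℝ) r := rfl
      rw [this, AlgHomClass.commutes, Algebra.algebraMap_eq_smul_one, smul_apply,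
        one_apply_eq_self]
      rfl
    | id => exact hid
    | star_id => rw [star_trivial]; exact hid
    | add f g hf hg =>
      rw [map_add, add_apply, hf, hg, ContinuousMap.add_apply, add_smul]
    | mul f g hf hg =>
      rw [map_mul, mul_apply_eq_comp, hg,
        ContinuousLinearMap.map_smul_of_tower, hf,
        ContinuousMap.mul_apply, mul_comm, mul_smul]
    | frequently f hf =>
      have hcl : IsClosed {g : C(spectrum ℝ A, ℝ) | cfcHom hA g x = g ⟨l, hl⟩ • x} := by
        refine isClosed_eq ?_ ?_
        · exact (ContinuousLinearMap.apply ℂ H x).continuous.comp (cfcHom_continuous hA)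
        · exact (continuous_eval_const (F := C(spectrum ℝ A, ℝ)) _).smul continuous_const
      exact hcl.mem_of_frequently_of_tendsto hf Filter.tendsto_id
  rw [cfc_apply f A hA hf, key]
  rfl

lemma opPosPart_nonneg (A : H →L[ℂ] H) : 0 ≤ A⁺ := CFC.posPart_nonneg A

lemma opNegPart_nonneg (A : H →L[ℂ] H) : 0 ≤ A⁻ := CFC.negPart_nonneg A

lemma posPart_apply_of_apply_eq_smul {A : H →L[ℂ] H} (hA : IsSelfAdjoint A) {x : H} {l : ℝ}
    (h : A x = l • x) : A⁺ x = l⁺ • x := by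
  rw [CFC.posPart_def, cfcₙ_eq_cfc (by fun_prop) (by simp)]
  exact cfc_apply_of_apply_eq_smul hA (by fun_prop) h

/-! ### The Jordan decomposition of a difference of states -/

lemma isCompactOperator_sub {A B : H →L[ℂ] H} (hA : 0 ≤ A) (hB : 0 ≤ B) (htA : posTrace A ≠ ⊤)
    (htB : posTrace B ≠ ⊤) : IsCompactOperator (A - B : H →L[ℂ] H) :=
  (isCompactOperator_of_posTrace_ne_top hA htA).sub (isCompactOperator_of_posTrace_ne_top hB htB)

/-- In an eigenbasis of `A - B` each term is `(⟨A⟩ - ⟨B⟩)⁺`, which is at most `⟨A⟩` because both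
expectations are nonnegative. -/
lemma posTrace_posPart_sub_le {A B : H →L[ℂ] H} (hA : 0 ≤ A) (hB : 0 ≤ B)
    (htA : posTrace A ≠ ⊤) (htB : posTrace B ≠ ⊤) : posTrace (A - B)⁺ ≤ posTrace A := by
  have hsa : IsSelfAdjoint (A - B) := hA.isSelfAdjoint.sub hB.isSelfAdjoint
  obtain ⟨w, b, hb⟩ := exists_isEigenbasis hsa (isCompactOperator_sub hA hB htA htB)
  rw [posTrace_eq (opPosPart_nonneg (A - B)) b, posTrace_eq hA b]
  refine ENNReal.tsum_le_tsum fun i => ENNReal.ofReal_le_ofReal ?_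
  rw [posPart_apply_of_apply_eq_smul hsa (hb.apply_eq i), inner_smul_right_eq_smul,
    inner_self_eq_norm_sq_to_K, b.orthonormal.1 i]
  have h1 : eigval (A - B) (b i) = eigval A (b i) - eigval B (b i) := by
    simp [eigval]
  have h2 := eigval_nonneg hA (b i)
  have h3 := eigval_nonneg hB (b i)
  have h4 : (eigval (A - B) (b i))⁺ ≤ eigval A (b i) := by
    rw [posPart_def, h1]
    exact max_le (by linarith) h2
  simpa [eigval] using h4

namespace QState

variable (ρ σ : QState H)

lemma isSelfAdjoint_sub : IsSelfAdjoint (ρ.op - σ.op) :=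
  ρ.nonneg.isSelfAdjoint.sub σ.nonneg.isSelfAdjoint

lemma posTrace_ne_top : posTrace ρ.op ≠ ⊤ := by simp [ρ.trace_eq_one]

/-- The Jordan decomposition rearranged into the double splitting required by
`sum_relEntropy_le_of_add_eq_add`. -/
lemma op_add_negPart : ρ.op + (ρ.op - σ.op)⁻ = σ.op + (ρ.op - σ.op)⁺ := by
  have h := CFC.posPart_sub_negPart _ (isSelfAdjoint_sub ρ σ)
  rw [sub_eq_sub_iff_add_eq_add] at h
  rw [← h, add_comm]

lemma posTrace_posPart_le_one : posTrace (ρ.op - σ.op)⁺ ≤ 1 :=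
  ρ.trace_eq_one ▸ posTrace_posPart_sub_le ρ.nonneg σ.nonneg ρ.posTrace_ne_top σ.posTrace_ne_top

lemma posTrace_negPart_eq : posTrace (ρ.op - σ.op)⁻ = posTrace (ρ.op - σ.op)⁺ := by
  have h := congrArg posTrace (op_add_negPart ρ σ)
  rwa [posTrace_add ρ.nonneg (opNegPart_nonneg (ρ.op - σ.op)), posTrace_add σ.nonneg (opPosPart_nonneg (ρ.op - σ.op)),
    ρ.trace_eq_one, σ.trace_eq_one, ENNReal.add_right_inj ENNReal.one_ne_top] at h

lemma traceNorm_sub : traceNorm (ρ.op - σ.op) = 2 * (posTrace (ρ.op - σ.op)⁺).toReal := by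
  rw [traceNorm, ← CFC.posPart_add_negPart _ (isSelfAdjoint_sub ρ σ),
    posTrace_add (opPosPart_nonneg (ρ.op - σ.op)) (opNegPart_nonneg (ρ.op - σ.op)), posTrace_negPart_eq, ← two_mul,
    ENNReal.toReal_mul]
  rfl

lemma traceNorm_sub_nonneg : 0 ≤ traceNorm (ρ.op - σ.op) := ENNReal.toReal_nonneg

lemma posTrace_posPart_eq :
    posTrace (ρ.op - σ.op)⁺ = ENNReal.ofReal (traceNorm (ρ.op - σ.op) / 2) := by
  rw [traceNorm_sub, mul_div_cancel_left₀ _ two_ne_zero, ENNReal.ofReal_toReal]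
  exact ne_top_of_le_ne_top ENNReal.one_ne_top (posTrace_posPart_le_one ρ σ)

lemma traceNorm_sub_le : traceNorm (ρ.op - σ.op) / 2 ≤ 1 := by
  have h := posTrace_posPart_le_one ρ σ
  rw [posTrace_posPart_eq, ← ENNReal.ofReal_one, ENNReal.ofReal_le_ofReal_iff zero_le_one] at h
  exact h

lemma op_eq_of_traceNorm_eq_zero (h : traceNorm (ρ.op - σ.op) = 0) : ρ.op = σ.op := by
  have h1 := posTrace_posPart_eq ρ σ
  rw [h, zero_div, ENNReal.ofReal_zero] at h1
  have h2 := posTrace_negPart_eq ρ σ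
  rw [h1] at h2
  have h3 := op_add_negPart ρ σ
  rwa [eq_zero_of_posTrace_eq_zero (opPosPart_nonneg (ρ.op - σ.op)) h1,
    eq_zero_of_posTrace_eq_zero (opNegPart_nonneg (ρ.op - σ.op)) h2, add_zero, add_zero] at h3

end QState

/-! ### Entropy bounds for Holevo quantities -/

lemma eigval_le_of_posTrace_le {A : H →L[ℂ] H} (hA : 0 ≤ A) {a : ℝ} (ha : 0 ≤ a)
    (ht : posTrace A ≤ ENNReal.ofReal a) {w : Type*} (b : HilbertBasis w ℂ H) (i : w) :
    eigval A (b i) ≤ a := by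
  rw [posTrace_eq_tsum_eigval hA b] at ht
  exact (ENNReal.ofReal_le_ofReal_iff ha).1 ((ENNReal.le_tsum i).trans ht)

lemma summable_smul_of_posTrace_le {A : ι → H →L[ℂ] H} {p : ι → ℝ} (hp : ∀ i, 0 ≤ p i)
    (hps : Summable p) (hA : ∀ i, 0 ≤ A i) (ht : ∀ i, posTrace (A i) ≤ 1) :
    Summable fun i => p i • A i := by
  refine Summable.of_norm_bounded hps fun i => ?_
  have h := (norm_le_posTrace (hA i)).trans (ht i)
  rw [← ENNReal.ofReal_one, ENNReal.ofReal_le_ofReal_iff zero_le_one] at h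
  rw [norm_smul, Real.norm_of_nonneg (hp i)]
  exact mul_le_of_le_one_right (hp i) h

section

variable [TopologicalSpace.SeparableSpace H]

/-- As `B = r A + (B - r A)`, one has `H(rA‖B) ≤ Tr (B - rA) = 1 - r`. By scaling, `H(rA‖B) = r
H(A‖B) + r log r + 1 - r`. -/
lemma ofReal_mul_relEntropy_le_negMulLog {A B : H →L[ℂ] H} (hA : 0 ≤ A)
    (htA : posTrace A = 1) (htB : posTrace B = 1) {r : ℝ} (hr : 0 ≤ r) (hAB : r • A ≤ B) :
    ENNReal.ofReal r * relEntropy A B ≤ ENNReal.ofReal (Real.negMulLog r) := by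
  rcases hr.eq_or_lt with rfl | hr0
  · simp
  have hB : 0 ≤ B := (smul_nonneg hr hA).trans hAB
  have htrA : posTrace (r • A) = ENNReal.ofReal r := by rw [posTrace_smul _ hr, htA, mul_one]
  have hC : 0 ≤ B - r • A := sub_nonneg.2 hAB
  have htC : ENNReal.ofReal r + posTrace (B - r • A) = 1 := by
    rw [← htrA, ← posTrace_add (smul_nonneg hr hA) hC, add_sub_cancel, htB]
  have hCtop : posTrace (B - r • A) ≠ ⊤ :=
    ne_top_of_le_ne_top ENNReal.one_ne_top (htC ▸ le_add_self)
  have h1 := relEntropy_add_right_le (smul_nonneg hr hA) hC (by simp [htrA]) hCtop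
  rw [add_sub_cancel, relEntropy_eq_add_klTerm (smul_nonneg hr hA) hB hr zero_lt_one htrA
    (by simp [htB]), div_one, relEntropy_smul_smul hA hB (by simp [htA]) (by simp [htB]) hr] at h1
  have hr1 : r ≤ 1 := by
    rw [← ENNReal.ofReal_le_ofReal_iff zero_le_one, ENNReal.ofReal_one, ← htC]
    exact le_self_add
  have h2 : posTrace (B - r • A) = ENNReal.ofReal (1 - r) := by
    rw [← ENNReal.add_right_inj (a := ENNReal.ofReal r) ENNReal.ofReal_ne_top, htC,
      ← ENNReal.ofReal_add hr (by linarith)]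
    simp
  have k := klTerm_nonneg_aux hr zero_lt_one
  have hk : klTerm r 1 + ENNReal.ofReal (Real.negMulLog r) = ENNReal.ofReal (1 - r) := by
    rw [klTerm, if_neg (fun h => one_ne_zero h.1),
      ← ENNReal.ofReal_add k (Real.negMulLog_nonneg hr hr1), Real.negMulLog, Real.log_one]
    congr 1; ring
  rw [h2, ← hk, add_comm] at h1
  exact (ENNReal.add_le_add_iff_left (by
    rw [klTerm, if_neg (fun h => one_ne_zero h.1)]; exact ENNReal.ofReal_ne_top)).1 h1

/-- The Holevo quantity does not exceed the Shannon entropy of the weights. -/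
lemma holevo_le_tsum_negMulLog {p : ι → ℝ} {ρ : ι → H →L[ℂ] H} (hp : ∀ i, 0 ≤ p i)
    (hρ : ∀ i, 0 ≤ ρ i) (ht : ∀ i, p i ≠ 0 → posTrace (ρ i) = 1)
    (hs : Summable fun i => p i • ρ i) (hts : posTrace (∑' i, p i • ρ i) = 1) :
    holevo p ρ ≤ ∑' i, ENNReal.ofReal (Real.negMulLog (p i)) := by
  refine ENNReal.tsum_le_tsum fun i => ?_
  by_cases h : p i = 0
  · simp [h]
  · exact ofReal_mul_relEntropy_le_negMulLog (hρ i) (ht i h) hts (hp i)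
      (hs.le_tsum i fun j _ => smul_nonneg (hp j) (hρ j))

/-- The Holevo quantity does not exceed the von Neumann entropy of the average state. -/
lemma holevo_le_posEntropySum {p : ι → ℝ} {ρ : ι → H →L[ℂ] H} (hp : ∀ i, 0 ≤ p i)
    (hρ : ∀ i, 0 ≤ ρ i) (ht : ∀ i, p i ≠ 0 → posTrace (ρ i) = 1)
    (hs : Summable fun i => p i • ρ i) (hts : posTrace (∑' i, p i • ρ i) = 1)
    {v : Set H} {c : HilbertBasis v ℂ H} (hc : IsEigenbasis c (∑' i, p i • ρ i)) :
    holevo p ρ ≤ posEntropySum c (∑' i, p i • ρ i) := by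
  have hS0 : 0 ≤ ∑' i, p i • ρ i := nonneg_of_hasSum hs.hasSum fun i => smul_nonneg (hp i) (hρ i)
  rw [← negLogSum_self c hS0, negLogSum, ← tsum_mul_tsum_eigval hp hs.hasSum hρ]
  refine ENNReal.tsum_le_tsum fun i => ?_
  by_cases h : p i = 0
  · simp [h]
  gcongr
  obtain ⟨w, b, hb⟩ := exists_isEigenbasis_of_posTrace_ne_top (hρ i) (by simp [ht i h])
  have e := relEntropy_add_eq hb hc (hρ i) hS0
  -- The eigenvalues of `ρ i` are at most `1`, so its entropy has no negative part. Dropping the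
  -- entropy itself leaves the bound `-Tr ρ i log S` with `S` the average.
  have hneg : negEntropySum b (ρ i) = 0 := by
    rw [negEntropySum, ENNReal.tsum_eq_zero]
    intro j
    rw [ENNReal.ofReal_eq_zero, neg_nonpos]
    exact Real.negMulLog_nonneg (eigval_nonneg (hρ i) _)
      (eigval_le_of_posTrace_le (hρ i) zero_le_one (by simp [ht i h]) b j)
  rw [hneg, zero_add, hts, ht i h] at e
  rw [← ENNReal.add_le_add_iff_right ENNReal.one_ne_top]
  calc _ ≤ relEntropy (ρ i) (∑' i, p i • ρ i)
        + (1 + posLogSum c (ρ i) (∑' i, p i • ρ i) + posEntropySum b (ρ i)) := by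
        gcongr
        rw [add_assoc]; exact le_self_add
    _ = _ := by rw [e]; rfl

end

/-! ### Homogeneity of the Shannon and von Neumann entropies. -/

/-- From `η(εx) = ε η(x) + x η(ε)`. The last term is exactly what the homogeneous extensions
subtract; the bounds by `1` keep all terms nonnegative. -/
lemma tsum_negMulLog_mul {α : Type*} {x : α → ℝ} (hx : ∀ i, 0 ≤ x i) (hx1 : ∀ i, x i ≤ 1)
    (hs : ∑' i, ENNReal.ofReal (x i) = 1) {ε : ℝ} (hε : 0 ≤ ε) (hε1 : ε ≤ 1) :
    ∑' i, ENNReal.ofReal (Real.negMulLog (ε * x i))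
      = ENNReal.ofReal ε * ∑' i, ENNReal.ofReal (Real.negMulLog (x i))
        + ENNReal.ofReal (Real.negMulLog ε) := by
  rw [← mul_one (ENNReal.ofReal (Real.negMulLog ε)), ← hs, ← ENNReal.tsum_mul_left,
    ← ENNReal.tsum_mul_left, ← ENNReal.tsum_add]
  refine tsum_congr fun i => ?_
  have h1 := Real.negMulLog_nonneg (hx i) (hx1 i)
  have h2 := Real.negMulLog_nonneg hε hε1
  rw [← ENNReal.ofReal_mul hε, ← ENNReal.ofReal_mul h2,
    ← ENNReal.ofReal_add (by positivity) (mul_nonneg h2 (hx i)), Real.negMulLog_mul]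
  congr 1; ring

lemma shannon_eq {x : ι → ℝ} (hx : ∀ i, 0 ≤ x i) (hx1 : ∀ i, x i ≤ 1) :
    shannon x = ((∑' i, ENNReal.ofReal (Real.negMulLog (x i)) : ℝ≥0∞) : EReal)
      - ((Real.negMulLog (∑' i, x i) : ℝ) : EReal) := by
  have h : ∑' i, ENNReal.ofReal (-Real.negMulLog (x i)) = 0 := by
    rw [ENNReal.tsum_eq_zero]
    intro i
    rw [ENNReal.ofReal_eq_zero, neg_nonpos]
    exact Real.negMulLog_nonneg (hx i) (hx1 i)
  rw [shannon, h]
  simp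

/-- The trace bound puts the spectrum into `[0, 1]`, where `η` is nonnegative; so the negative part
in `saTrace` vanishes. -/
lemma vonNeumann_eq {A : H →L[ℂ] H} (hA : 0 ≤ A) {a : ℝ} (ha : 0 ≤ a) (ha1 : a ≤ 1)
    (ht : posTrace A = ENNReal.ofReal a) {v : Set H} {c : HilbertBasis v ℂ H}
    (hc : IsEigenbasis c A) :
    vonNeumann A = ((posEntropySum c A : ℝ≥0∞) : EReal) - ((Real.negMulLog a : ℝ) : EReal) := by
  have hn : ‖A‖ ≤ 1 := by
    have h := norm_le_posTrace hA
    rw [ht, ENNReal.ofReal_le_ofReal_iff ha] at h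
    exact h.trans ha1
  have hcfc : 0 ≤ cfc Real.negMulLog A := by
    refine cfc_nonneg fun x hx => Real.negMulLog_nonneg (spectrum_nonneg_of_nonneg hA hx) ?_
    have h1 := spectrum.norm_le_norm_mul_of_mem hx
    have h2 : ‖(1 : H →L[ℂ] H)‖ ≤ 1 := ContinuousLinearMap.norm_id_le
    exact (Real.le_norm_self x).trans (h1.trans (mul_le_one₀ hn (norm_nonneg _) h2))
  have h1 : (cfc Real.negMulLog A)⁺ = cfc Real.negMulLog A := (CFC.posPart_eq_self _).2 hcfc
  have h2 : (cfc Real.negMulLog A)⁻ = 0 := (CFC.negPart_eq_zero_iff _ hcfc.isSelfAdjoint).2 hcfc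
  have h3 : posTrace (cfc Real.negMulLog A) = posEntropySum c A := by
    rw [posTrace_eq hcfc c, posEntropySum]
    refine tsum_congr fun i => ?_
    rw [cfc_apply_of_apply_eq_smul hA.isSelfAdjoint Real.continuous_negMulLog.continuousOn
      (hc.apply_eq i), inner_smul_right_eq_smul, inner_self_eq_norm_sq_to_K, c.orthonormal.1 i]
    simp
  rw [vonNeumann, saTrace, h1, h2, h3, ht, ENNReal.toReal_ofReal ha]
  simp

lemma coe_ofReal_eq_coe {x : ℝ} (hx : 0 ≤ x) : ((ENNReal.ofReal x : ℝ≥0∞) : EReal) = (x : EReal) := by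
  rw [EReal.coe_ennreal_ofReal, max_eq_left hx]

lemma EReal_mul_eq_sub {E : ℝ≥0∞} {ε y : ℝ} (hε : 0 ≤ ε) (hy : 0 ≤ y) :
    ((ENNReal.ofReal ε * E + ENNReal.ofReal y : ℝ≥0∞) : EReal) - (y : EReal)
      = (ε : EReal) * (E : EReal) := by
  rw [EReal.coe_ennreal_add, EReal.coe_ennreal_mul, coe_ofReal_eq_coe hε, coe_ofReal_eq_coe hy]
  exact EReal.add_sub_cancel_right

/-! ### Ensembles obtained by normalization -/

/-- Positions with `e i = 0` are harmless: there `N i` has trace zero, hence is zero. -/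
lemma hasSum_normalized {N : ι → H →L[ℂ] H} {p e : ι → ℝ} (hN : ∀ i, 0 ≤ N i)
    (ht : ∀ i, posTrace (N i) = ENNReal.ofReal (e i)) (ε : ℝ) {T : H →L[ℂ] H}
    (hT : HasSum (fun i => p i • N i) T) :
    HasSum (fun i => (p i * e i / ε) • (e i)⁻¹ • N i) (ε⁻¹ • T) := by
  convert hT.const_smul ε⁻¹ using 2 with i
  rw [smul_smul, smul_smul]
  by_cases h : e i = 0
  · rw [eq_zero_of_posTrace_eq_zero (hN i) (by simp [ht i, h])]; simp
  · congr 1; field_simp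

/-- By homogeneity `p e H(N/e‖T/ε) = p H(N‖(e/ε) T)`, which brings `ε χ^±` to the form in which the
abstract bound is stated. -/
lemma ofReal_mul_holevo_normalized [TopologicalSpace.SeparableSpace H] {N : ι → H →L[ℂ] H}
    {p e : ι → ℝ} (hp : ∀ i, 0 ≤ p i) (he : ∀ i, 0 ≤ e i) (hN : ∀ i, 0 ≤ N i)
    (ht : ∀ i, posTrace (N i) = ENNReal.ofReal (e i)) {ε : ℝ} (hε : 0 < ε) {T : H →L[ℂ] H}
    (hT : HasSum (fun i => p i • N i) T) (htT : posTrace T ≠ ⊤) :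
    ENNReal.ofReal ε * holevo (fun i => p i * e i / ε) (fun i => (e i)⁻¹ • N i)
      = ∑' i, ENNReal.ofReal (p i) * relEntropy (N i) ((e i / ε) • T) := by
  have hT0 : 0 ≤ T := nonneg_of_hasSum hT fun k => smul_nonneg (hp k) (hN k)
  rw [holevo, (hasSum_normalized hN ht ε hT).tsum_eq, ← ENNReal.tsum_mul_left]
  refine tsum_congr fun i => ?_
  by_cases h : e i = 0
  · have h0 : N i = 0 := eq_zero_of_posTrace_eq_zero (hN i) (by simp [ht i, h])
    rw [h, h0, zero_div, zero_smul, relEntropy_self le_rfl (by simp)]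
    simp
  · have hi : 0 < e i := lt_of_le_of_ne (he i) (Ne.symm h)
    have h1 := relEntropy_smul_smul (A := (e i)⁻¹ • N i) (B := ε⁻¹ • T)
      (smul_nonneg (inv_nonneg.2 hi.le) (hN i)) (smul_nonneg (inv_nonneg.2 hε.le) hT0)
      (by rw [posTrace_smul _ (inv_nonneg.2 hi.le), ht]
          exact ENNReal.mul_ne_top ENNReal.ofReal_ne_top ENNReal.ofReal_ne_top)
      (by rw [posTrace_smul _ (inv_nonneg.2 hε.le)]
          exact ENNReal.mul_ne_top ENNReal.ofReal_ne_top htT) hi.le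
    rw [smul_inv_smul₀ h, smul_smul, ← div_eq_mul_inv] at h1
    rw [h1, ← mul_assoc, ← mul_assoc, ← ENNReal.ofReal_mul hε.le, ← ENNReal.ofReal_mul (hp i)]
    congr 2
    field_simp

namespace Ensemble

variable (E : Ensemble ι H) (σ : QState H)

/-- Half of the trace norm `‖ρᵢ - σ‖₁`. -/
def excess (i : ι) : ℝ := traceNorm (E.diff σ i) / 2

lemma excess_nonneg (i : ι) : 0 ≤ E.excess σ i :=
  div_nonneg (QState.traceNorm_sub_nonneg _ _) zero_le_two

lemma excess_le_one (i : ι) : E.excess σ i ≤ 1 := QState.traceNorm_sub_le _ _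

lemma posTrace_diff_posPart (i : ι) : posTrace (E.diff σ i)⁺ = ENNReal.ofReal (E.excess σ i) :=
  QState.posTrace_posPart_eq _ _

lemma posTrace_diff_negPart (i : ι) : posTrace (E.diff σ i)⁻ = ENNReal.ofReal (E.excess σ i) :=
  (QState.posTrace_negPart_eq _ _).trans (QState.posTrace_posPart_eq _ _)

lemma summable_p_mul_excess : Summable fun i => E.p i * E.excess σ i :=
  Summable.of_nonneg_of_le (fun i => mul_nonneg (E.p_nonneg i) (E.excess_nonneg σ i))
    (fun i => mul_le_of_le_one_right (E.p_nonneg i) (E.excess_le_one σ i)) E.hasSum_p.summable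

lemma tsum_p_mul_traceNorm : ∑' i, E.p i * traceNorm (E.diff σ i) = 2 * E.eps σ := by
  rw [eps]; ring

lemma hasSum_p_mul_excess : HasSum (fun i => E.p i * E.excess σ i) (E.eps σ) := by
  convert (E.summable_p_mul_excess σ).hasSum using 1
  rw [eps, ← tsum_mul_left]
  exact tsum_congr fun i => by rw [excess]; ring

lemma eps_nonneg : 0 ≤ E.eps σ :=
  (E.hasSum_p_mul_excess σ).nonneg fun i => mul_nonneg (E.p_nonneg i) (E.excess_nonneg σ i)

lemma eps_le_one : E.eps σ ≤ 1 :=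
  hasSum_le (fun i => mul_le_of_le_one_right (E.p_nonneg i) (E.excess_le_one σ i))
    (E.hasSum_p_mul_excess σ) E.hasSum_p

lemma t_eq : E.t σ = fun i => E.p i * E.excess σ i / E.eps σ := by
  ext i
  rw [t, tsum_p_mul_traceNorm, excess, ← mul_div_assoc, div_div]

lemma tauPlus_eq : E.tauPlus σ = fun i => (E.excess σ i)⁻¹ • (E.diff σ i)⁺ := by
  ext1 i; rw [tauPlus, excess, inv_div]

lemma tauMinus_eq : E.tauMinus σ = fun i => (E.excess σ i)⁻¹ • (E.diff σ i)⁻ := by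
  ext1 i; rw [tauMinus, excess, inv_div]

lemma t_nonneg (i : ι) : 0 ≤ E.t σ i := by
  rw [t_eq]
  exact div_nonneg (mul_nonneg (E.p_nonneg i) (E.excess_nonneg σ i)) (E.eps_nonneg σ)

lemma hasSum_t (h : 0 < E.eps σ) : HasSum (E.t σ) 1 := by
  rw [t_eq]
  have := (E.hasSum_p_mul_excess σ).div_const (E.eps σ)
  rwa [div_self h.ne'] at this

lemma t_le_one (h : 0 < E.eps σ) (i : ι) : E.t σ i ≤ 1 :=
  le_hasSum (E.hasSum_t σ h) i fun j _ => E.t_nonneg σ j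

lemma summable_diff_posPart : Summable fun i => E.p i • (E.diff σ i)⁺ :=
  summable_smul_of_posTrace_le E.p_nonneg E.hasSum_p.summable (fun i => opPosPart_nonneg (E.diff σ i))
    fun i => by
      rw [posTrace_diff_posPart, ← ENNReal.ofReal_one]
      exact ENNReal.ofReal_le_ofReal (E.excess_le_one σ i)

lemma summable_diff_negPart : Summable fun i => E.p i • (E.diff σ i)⁻ :=
  summable_smul_of_posTrace_le E.p_nonneg E.hasSum_p.summable (fun i => opNegPart_nonneg (E.diff σ i))
    fun i => by
      rw [posTrace_diff_negPart, ← ENNReal.ofReal_one]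
      exact ENNReal.ofReal_le_ofReal (E.excess_le_one σ i)

lemma summable_state : Summable fun i => E.p i • (E.state i).op :=
  summable_smul_of_posTrace_le E.p_nonneg E.hasSum_p.summable (fun i => (E.state i).nonneg)
    fun i => (E.state i).trace_eq_one.le

lemma tsum_ofReal_p_mul_excess :
    ∑' i, ENNReal.ofReal (E.p i) * ENNReal.ofReal (E.excess σ i) = ENNReal.ofReal (E.eps σ) := by
  rw [← (E.hasSum_p_mul_excess σ).tsum_eq, ENNReal.ofReal_tsum_of_nonneg
    (fun k => mul_nonneg (E.p_nonneg k) (E.excess_nonneg σ k)) (E.summable_p_mul_excess σ)]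
  exact tsum_congr fun k => (ENNReal.ofReal_mul (E.p_nonneg k)).symm

lemma posTrace_tsum_diff_posPart :
    posTrace (∑' i, E.p i • (E.diff σ i)⁺) = ENNReal.ofReal (E.eps σ) := by
  rw [← tsum_mul_posTrace E.p_nonneg (E.summable_diff_posPart σ).hasSum
    fun i => opPosPart_nonneg (E.diff σ i)]
  simp_rw [posTrace_diff_posPart, tsum_ofReal_p_mul_excess]

lemma posTrace_tsum_diff_negPart :
    posTrace (∑' i, E.p i • (E.diff σ i)⁻) = ENNReal.ofReal (E.eps σ) := by
  rw [← tsum_mul_posTrace E.p_nonneg (E.summable_diff_negPart σ).hasSum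
    fun i => opNegPart_nonneg (E.diff σ i)]
  simp_rw [posTrace_diff_negPart, tsum_ofReal_p_mul_excess]

lemma hasSum_t_smul_tauPlus :
    HasSum (fun i => E.t σ i • E.tauPlus σ i) ((E.eps σ)⁻¹ • ∑' i, E.p i • (E.diff σ i)⁺) := by
  rw [t_eq, tauPlus_eq]
  exact hasSum_normalized (fun i => opPosPart_nonneg (E.diff σ i)) (E.posTrace_diff_posPart σ) _
    (E.summable_diff_posPart σ).hasSum

lemma p_eq_zero_or_op_eq (h : E.eps σ = 0) (i : ι) : E.p i = 0 ∨ (E.state i).op = σ.op := by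
  have h1 := E.hasSum_p_mul_excess σ
  rw [h, hasSum_zero_iff_of_nonneg
    fun i => mul_nonneg (E.p_nonneg i) (E.excess_nonneg σ i)] at h1
  rcases mul_eq_zero.1 (congrFun h1 i) with h2 | h2
  · exact Or.inl h2
  · refine Or.inr (QState.op_eq_of_traceNorm_eq_zero _ _ ?_)
    rw [excess, div_eq_zero_iff] at h2
    exact h2.resolve_right two_ne_zero

lemma t_eq_zero (h : E.eps σ = 0) : E.t σ = 0 := by
  rw [t_eq, h]; ext i; simp

lemma chiMinus_eq_zero (h : E.eps σ = 0) : E.chiMinus σ = 0 := by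
  simp [chiMinus, holevo, t_eq_zero E σ h]

lemma hasSum_const : HasSum (fun i => E.p i • σ.op) σ.op := by
  simpa using E.hasSum_p.smul_const σ.op

lemma tsum_diff_posPart_eq_zero (h : E.eps σ = 0) : ∑' i, E.p i • (E.diff σ i)⁺ = 0 := by
  refine eq_zero_of_posTrace_eq_zero (nonneg_of_hasSum (E.summable_diff_posPart σ).hasSum
    fun i => smul_nonneg (E.p_nonneg i) (opPosPart_nonneg (E.diff σ i))) ?_
  rw [posTrace_tsum_diff_posPart, h, ENNReal.ofReal_zero]

section

variable [TopologicalSpace.SeparableSpace H]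

lemma chi_eq_zero (h : E.eps σ = 0) : E.chi = 0 := by
  have hs : ∑' i, E.p i • (E.state i).op = σ.op := by
    rw [← (E.hasSum_const σ).tsum_eq]
    refine tsum_congr fun i => ?_
    rcases E.p_eq_zero_or_op_eq σ h i with h | h <;> rw [h]
    simp
  rw [chi, holevo, hs, ENNReal.tsum_eq_zero]
  intro i
  rcases E.p_eq_zero_or_op_eq σ h i with h | h <;> rw [h]
  · simp
  · rw [relEntropy_self σ.nonneg σ.posTrace_ne_top, mul_zero]

lemma ofReal_eps_mul_chiPlus (h : 0 < E.eps σ) :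
    ENNReal.ofReal (E.eps σ) * E.chiPlus σ = ∑' i, ENNReal.ofReal (E.p i) *
      relEntropy (E.diff σ i)⁺ ((E.excess σ i / E.eps σ) • ∑' i, E.p i • (E.diff σ i)⁺) := by
  rw [chiPlus, t_eq, tauPlus_eq]
  exact ofReal_mul_holevo_normalized E.p_nonneg (E.excess_nonneg σ)
    (fun i => opPosPart_nonneg (E.diff σ i)) (E.posTrace_diff_posPart σ) h
    (E.summable_diff_posPart σ).hasSum (by simp [posTrace_tsum_diff_posPart])

lemma ofReal_eps_mul_chiMinus (h : 0 < E.eps σ) :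
    ENNReal.ofReal (E.eps σ) * E.chiMinus σ = ∑' i, ENNReal.ofReal (E.p i) *
      relEntropy (E.diff σ i)⁻ ((E.excess σ i / E.eps σ) • ∑' i, E.p i • (E.diff σ i)⁻) := by
  rw [chiMinus, t_eq, tauMinus_eq]
  exact ofReal_mul_holevo_normalized E.p_nonneg (E.excess_nonneg σ)
    (fun i => opNegPart_nonneg (E.diff σ i)) (E.posTrace_diff_negPart σ) h
    (E.summable_diff_negPart σ).hasSum (by simp [posTrace_tsum_diff_negPart])

lemma tsum_relEntropy_const : ∑' i, ENNReal.ofReal (E.p i) * relEntropy σ.op σ.op = 0 := by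
  simp [relEntropy_self σ.nonneg σ.posTrace_ne_top]

/-- The abstract bound with `A = ρᵢ`, `N = [ρᵢ - σ]₋`, `B = σ`, `P = [ρᵢ - σ]₊`; the constant family
contributes nothing. -/
theorem chi_add_le [Countable ι] : E.chi + ENNReal.ofReal (E.eps σ) * E.chiMinus σ
    ≤ ENNReal.ofReal (E.eps σ) * E.chiPlus σ + ENNReal.ofReal (gFun (E.eps σ)) := by
  rcases (E.eps_nonneg σ).eq_or_lt with h | h
  · simp [chi_eq_zero E σ h.symm, ← h]
  rw [ofReal_eps_mul_chiPlus E σ h, ofReal_eps_mul_chiMinus E σ h, chi, holevo]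
  have key := sum_relEntropy_le_of_add_eq_add E.p_nonneg E.hasSum_p (E.excess_nonneg σ)
    (E.excess_le_one σ) h E.summable_state.hasSum (E.summable_diff_negPart σ).hasSum
    (E.hasSum_const σ) (E.summable_diff_posPart σ).hasSum (fun i => (E.state i).nonneg)
    (fun i => opNegPart_nonneg (E.diff σ i)) (fun _ => σ.nonneg)
    (fun i => opPosPart_nonneg (E.diff σ i)) (fun i => (E.state i).trace_eq_one)
    (fun _ => σ.trace_eq_one) (E.posTrace_diff_negPart σ) (E.posTrace_diff_posPart σ)
    (E.hasSum_p_mul_excess σ) (fun i => QState.op_add_negPart (E.state i) σ)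
  rwa [tsum_relEntropy_const, zero_add] at key

/-- The same bound with the two splittings exchanged. -/
theorem eps_mul_chiPlus_le [Countable ι] : ENNReal.ofReal (E.eps σ) * E.chiPlus σ
    ≤ E.chi + ENNReal.ofReal (E.eps σ) * E.chiMinus σ + ENNReal.ofReal (gFun (E.eps σ)) := by
  rcases (E.eps_nonneg σ).eq_or_lt with h | h
  · simp [← h]
  rw [ofReal_eps_mul_chiPlus E σ h, ofReal_eps_mul_chiMinus E σ h, chi, holevo]
  have key := sum_relEntropy_le_of_add_eq_add E.p_nonneg E.hasSum_p (E.excess_nonneg σ)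
    (E.excess_le_one σ) h (E.hasSum_const σ) (E.summable_diff_posPart σ).hasSum
    E.summable_state.hasSum (E.summable_diff_negPart σ).hasSum (fun _ => σ.nonneg)
    (fun i => opPosPart_nonneg (E.diff σ i)) (fun i => (E.state i).nonneg)
    (fun i => opNegPart_nonneg (E.diff σ i)) (fun _ => σ.trace_eq_one)
    (fun i => (E.state i).trace_eq_one) (E.posTrace_diff_posPart σ) (E.posTrace_diff_negPart σ)
    (E.hasSum_p_mul_excess σ) (fun i => (QState.op_add_negPart (E.state i) σ).symm)
  rwa [tsum_relEntropy_const, zero_add] at key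

theorem chi_le [Countable ι] : E.chi
    ≤ ENNReal.ofReal (E.eps σ) * E.chiPlus σ + ENNReal.ofReal (gFun (E.eps σ)) :=
  le_self_add.trans (E.chi_add_le σ)

lemma tauPlus_nonneg (i : ι) : 0 ≤ E.tauPlus σ i := by
  rw [tauPlus_eq]
  exact smul_nonneg (inv_nonneg.2 (E.excess_nonneg σ i)) (opPosPart_nonneg (E.diff σ i))

lemma posTrace_tauPlus (i : ι) (hi : E.t σ i ≠ 0) : posTrace (E.tauPlus σ i) = 1 := by
  have h : E.excess σ i ≠ 0 := fun h => hi (by simp [t_eq, h])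
  have h0 := E.excess_nonneg σ i
  rw [tauPlus_eq]
  simp only
  rw [posTrace_smul _ (inv_nonneg.2 h0), posTrace_diff_posPart,
    ← ENNReal.ofReal_mul (inv_nonneg.2 h0), inv_mul_cancel₀ h, ENNReal.ofReal_one]

lemma posTrace_tsum_tauPlus (h : 0 < E.eps σ) :
    posTrace (∑' i, E.t σ i • E.tauPlus σ i) = 1 := by
  rw [(E.hasSum_t_smul_tauPlus σ).tsum_eq, posTrace_smul _ (inv_nonneg.2 h.le),
    posTrace_tsum_diff_posPart, ← ENNReal.ofReal_mul (inv_nonneg.2 h.le), inv_mul_cancel₀ h.ne',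
    ENNReal.ofReal_one]

lemma chiPlus_le_shannon (h : 0 < E.eps σ) : (E.chiPlus σ : EReal) ≤ shannon (E.t σ) := by
  rw [shannon_eq (E.t_nonneg σ) (E.t_le_one σ h), (E.hasSum_t σ h).tsum_eq, Real.negMulLog_one,
    EReal.coe_zero, sub_zero, EReal.coe_ennreal_le_coe_ennreal_iff]
  exact holevo_le_tsum_negMulLog (E.t_nonneg σ) (E.tauPlus_nonneg σ) (E.posTrace_tauPlus σ)
    (E.hasSum_t_smul_tauPlus σ).summable (E.posTrace_tsum_tauPlus σ h)

lemma tsum_tauPlus_nonneg : 0 ≤ ∑' i, E.t σ i • E.tauPlus σ i :=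
  nonneg_of_hasSum (E.hasSum_t_smul_tauPlus σ).summable.hasSum fun i =>
    smul_nonneg (E.t_nonneg σ i) (E.tauPlus_nonneg σ i)

lemma chiPlus_le_vonNeumann (h : 0 < E.eps σ) :
    (E.chiPlus σ : EReal) ≤ vonNeumann (∑' i, E.t σ i • E.tauPlus σ i) := by
  have ht := E.posTrace_tsum_tauPlus σ h
  obtain ⟨v, c, hc⟩ := exists_isEigenbasis_of_posTrace_ne_top (E.tsum_tauPlus_nonneg σ)
    (by simp [ht])
  rw [vonNeumann_eq (E.tsum_tauPlus_nonneg σ) zero_le_one le_rfl (by simp [ht]) hc,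
    Real.negMulLog_one, EReal.coe_zero, sub_zero, EReal.coe_ennreal_le_coe_ennreal_iff]
  exact holevo_le_posEntropySum (E.t_nonneg σ) (E.tauPlus_nonneg σ) (E.posTrace_tauPlus σ)
    (E.hasSum_t_smul_tauPlus σ).summable ht hc

end

lemma eps_mul_shannon : (E.eps σ : EReal) * shannon (E.t σ)
    = shannon fun i => 1 / 2 * E.p i * traceNorm (E.diff σ i) := by
  rcases (E.eps_nonneg σ).eq_or_lt with h | h
  · have h0 : ∀ i, 1 / 2 * E.p i * traceNorm (E.diff σ i) = 0 := fun i => by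
      have h1 := E.hasSum_p_mul_excess σ
      rw [← h, hasSum_zero_iff_of_nonneg
        fun i => mul_nonneg (E.p_nonneg i) (E.excess_nonneg σ i)] at h1
      have h2 := congrFun h1 i
      simp only [excess, Pi.zero_apply] at h2
      linarith
    simp_rw [h0, ← h]
    simp [shannon]
  · have hx : ∀ i, 1 / 2 * E.p i * traceNorm (E.diff σ i) = E.eps σ * E.t σ i := fun i => by
      rw [t_eq]
      simp only
      rw [mul_div_cancel₀ _ h.ne', excess]
      ring
    have ht0 := E.t_nonneg σ
    have ht1 := E.t_le_one σ h
    have hs := E.hasSum_t σ h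
    have hst : ∑' i, ENNReal.ofReal (E.t σ i) = 1 := by
      rw [← ENNReal.ofReal_tsum_of_nonneg ht0 hs.summable, hs.tsum_eq, ENNReal.ofReal_one]
    simp_rw [hx]
    rw [shannon_eq ht0 ht1, shannon_eq (fun i => mul_nonneg h.le (ht0 i))
      (fun i => mul_le_one₀ (E.eps_le_one σ) (ht0 i) (ht1 i)), tsum_mul_left, hs.tsum_eq, mul_one,
      tsum_negMulLog_mul ht0 ht1 hst h.le (E.eps_le_one σ),
      EReal_mul_eq_sub h.le (Real.negMulLog_nonneg h.le (E.eps_le_one σ))]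
    simp

lemma eps_mul_vonNeumann [TopologicalSpace.SeparableSpace H] :
    (E.eps σ : EReal) * vonNeumann (∑' i, E.t σ i • E.tauPlus σ i)
      = vonNeumann (∑' i, E.p i • (E.diff σ i)⁺) := by
  rcases (E.eps_nonneg σ).eq_or_lt with h | h
  · rw [tsum_diff_posPart_eq_zero E σ h.symm, ← h]
    simp [vonNeumann, saTrace]
  · have hA := E.tsum_tauPlus_nonneg σ
    have ht := E.posTrace_tsum_tauPlus σ h
    have he : ∑' i, E.p i • (E.diff σ i)⁺ = E.eps σ • ∑' i, E.t σ i • E.tauPlus σ i := by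
      rw [(E.hasSum_t_smul_tauPlus σ).tsum_eq, smul_inv_smul₀ h.ne']
    rw [he]
    set A := ∑' i, E.t σ i • E.tauPlus σ i
    obtain ⟨v, c, hc⟩ := exists_isEigenbasis_of_posTrace_ne_top hA (by simp [ht])
    rw [vonNeumann_eq hA zero_le_one le_rfl (by simp [ht]) hc,
      vonNeumann_eq (smul_nonneg h.le hA) h.le (E.eps_le_one σ)
        (by rw [posTrace_smul _ h.le, ht, mul_one]) (hc.smul (E.eps σ)), posEntropySum,
      posEntropySum]
    simp_rw [eigval_smul]
    rw [tsum_negMulLog_mul (fun i => eigval_nonneg hA (c i))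
      (eigval_le_of_posTrace_le hA zero_le_one (by simp [ht]) c)
      (by rw [← posTrace_eq_tsum_eigval hA c, ht]) h.le (E.eps_le_one σ),
      EReal_mul_eq_sub h.le (Real.negMulLog_nonneg h.le (E.eps_le_one σ))]
    simp

end Ensemble

/-! ### Operators on the span of two orthonormal vectors -/

lemma rankOne_self_nonneg (x : H) : 0 ≤ InnerProductSpace.rankOne ℂ x x := by
  rw [ContinuousLinearMap.nonneg_iff_isPositive]
  exact InnerProductSpace.isPositive_rankOne_self x

lemma posTrace_rankOne_self (x : H) :
    posTrace (InnerProductSpace.rankOne ℂ x x) = ENNReal.ofReal (‖x‖ ^ 2) := by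
  rw [posTrace, ← tsum_norm_inner_sq (someBasis H)]
  refine tsum_congr fun i => ?_
  rw [InnerProductSpace.rankOne_apply, inner_smul_right, ← inner_conj_symm x, Complex.conj_mul']
  norm_cast

/-- The pure state of a unit vector. -/
def pureState (x : H) (hx : ‖x‖ = 1) : QState H where
  op := InnerProductSpace.rankOne ℂ x x
  nonneg := rankOne_self_nonneg x
  trace_eq_one := by rw [posTrace_rankOne_self, hx]; simp

section TwoVectors

variable {x y : H}

/-- The operator with eigenvalue `r` on `x` and `s` on `y`. -/
def diagOp (x y : H) (r s : ℝ) : H →L[ℂ] H :=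
  r • InnerProductSpace.rankOne ℂ x x + s • InnerProductSpace.rankOne ℂ y y

lemma diagOp_nonneg (x y : H) {r s : ℝ} (hr : 0 ≤ r) (hs : 0 ≤ s) : 0 ≤ diagOp x y r s :=
  add_nonneg (smul_nonneg hr (rankOne_self_nonneg x)) (smul_nonneg hs (rankOne_self_nonneg y))

/-- The basis does not depend on `r`, `s`, so all these operators are diagonal simultaneously and
their relative entropies are classical. -/
lemma exists_hilbertBasis_diagOp (hx : ‖x‖ = 1) (hy : ‖y‖ = 1) (hxy : ⟪x, y⟫_ℂ = 0) :
    ∃ (w : Set H) (b : HilbertBasis w ℂ H) (z₀ z₁ : w),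
    z₀ ≠ z₁ ∧ ∀ r s, IsEigenbasis b (diagOp x y r s) ∧ eigval (diagOp x y r s) (b z₀) = r ∧
      eigval (diagOp x y r s) (b z₁) = s ∧
      ∀ i, i ≠ z₀ → i ≠ z₁ → eigval (diagOp x y r s) (b i) = 0 := by
  have hyx : ⟪y, x⟫_ℂ = 0 := by rw [← inner_conj_symm, hxy, map_zero]
  have hxx : ⟪x, x⟫_ℂ = 1 := by rw [inner_self_eq_norm_sq_to_K, hx]; simp
  have hyy : ⟪y, y⟫_ℂ = 1 := by rw [inner_self_eq_norm_sq_to_K, hy]; simp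
  have hne : x ≠ y := fun h => by rw [h, hyy] at hxy; exact one_ne_zero hxy
  have hon : Orthonormal ℂ ((↑) : ({x, y} : Set H) → H) := by
    constructor
    · rintro ⟨v, rfl | rfl⟩ <;> assumption
    · rintro ⟨v, rfl | rfl⟩ ⟨u, rfl | rfl⟩ h
      · exact absurd rfl h
      · exact hxy
      · exact hyx
      · exact absurd rfl h
  obtain ⟨w, b, hw, hb⟩ := hon.exists_hilbertBasis_extension
  have hxw : x ∈ w := hw (by simp)
  have hyw : y ∈ w := hw (by simp)
  have hb0 : b ⟨x, hxw⟩ = x := by rw [hb]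
  have hb1 : b ⟨y, hyw⟩ = y := by rw [hb]
  have a0 : ∀ r s, diagOp x y r s x = r • x := fun r s => by
    simp [diagOp, hx, hyx]
  have a1 : ∀ r s, diagOp x y r s y = s • y := fun r s => by
    simp [diagOp, hy, hxy]
  have a2 : ∀ r s i, i ≠ ⟨x, hxw⟩ → i ≠ ⟨y, hyw⟩ → diagOp x y r s (b i) = 0 := fun r s i h0 h1 => by
    have e0 : ⟪b ⟨x, hxw⟩, b i⟫_ℂ = 0 := b.orthonormal.2 h0.symm
    have e1 : ⟪b ⟨y, hyw⟩, b i⟫_ℂ = 0 := b.orthonormal.2 h1.symm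
    rw [hb0] at e0
    rw [hb1] at e1
    simp [diagOp, e0, e1]
  refine ⟨w, b, ⟨x, hxw⟩, ⟨y, hyw⟩, fun h => hne (congrArg Subtype.val h), fun r s =>
    ⟨fun i => ?_, ?_, ?_, fun i h0 h1 => ?_⟩⟩
  · by_cases h0 : i = ⟨x, hxw⟩
    · exact ⟨r, by rw [h0, hb0, a0]⟩
    by_cases h1 : i = ⟨y, hyw⟩
    · exact ⟨s, by rw [h1, hb1, a1]⟩
    · exact ⟨0, by rw [a2 r s i h0 h1, zero_smul]⟩
  · rw [eigval, hb0, a0, inner_smul_right_eq_smul, hxx]; simp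
  · rw [eigval, hb1, a1, inner_smul_right_eq_smul, hyy]; simp
  · rw [eigval, a2 r s i h0 h1]; simp

lemma tsum_eq_add_of_ne {α M : Type*} [AddCommMonoid M] [TopologicalSpace M] {f : α → M}
    {z₀ z₁ : α} (hne : z₀ ≠ z₁) (hf : ∀ i, i ≠ z₀ → i ≠ z₁ → f i = 0) :
    ∑' i, f i = f z₀ + f z₁ := by
  classical
  rw [tsum_eq_sum (s := {z₀, z₁}), Finset.sum_pair hne]
  intro i hi
  simp only [Finset.mem_insert, Finset.mem_singleton, not_or] at hi
  exact hf i hi.1 hi.2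

lemma relEntropy_diagOp [TopologicalSpace.SeparableSpace H] (hx : ‖x‖ = 1) (hy : ‖y‖ = 1) (hxy : ⟪x, y⟫_ℂ = 0)
    {r s r' s' : ℝ} (hr : 0 ≤ r) (hs : 0 ≤ s) (hr' : 0 ≤ r') (hs' : 0 ≤ s') :
    relEntropy (diagOp x y r s) (diagOp x y r' s') = klTerm r r' + klTerm s s' := by
  obtain ⟨w, b, z₀, z₁, hne, h⟩ := exists_hilbertBasis_diagOp hx hy hxy
  rw [relEntropy_eq_tsum (h r s).1 (h r' s').1 (diagOp_nonneg x y hr hs)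
    (diagOp_nonneg x y hr' hs')]
  have h1 : ∀ i, ∑' j, ENNReal.ofReal (‖⟪b i, b j⟫_ℂ‖ ^ 2) *
      klTerm (eigval (diagOp x y r s) (b i)) (eigval (diagOp x y r' s') (b j))
      = klTerm (eigval (diagOp x y r s) (b i)) (eigval (diagOp x y r' s') (b i)) := by
    intro i
    rw [tsum_eq_single i]
    · rw [inner_self_eq_norm_sq_to_K, b.orthonormal.1 i]; simp
    · intro j hj
      rw [b.orthonormal.2 hj.symm]; simp
  simp_rw [h1]
  rw [tsum_eq_add_of_ne hne, (h r s).2.1, (h r s).2.2.1, (h r' s').2.1, (h r' s').2.2.1]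
  intro i h0 h1
  rw [(h r s).2.2.2 i h0 h1, (h r' s').2.2.2 i h0 h1, klTerm_zero_left, ENNReal.ofReal_zero]

lemma vonNeumann_rankOne (hx : ‖x‖ = 1) (hy : ‖y‖ = 1) (hxy : ⟪x, y⟫_ℂ = 0) :
    vonNeumann (InnerProductSpace.rankOne ℂ y y) = 0 := by
  obtain ⟨w, b, z₀, z₁, hne, h⟩ := exists_hilbertBasis_diagOp hx hy hxy
  have hd : InnerProductSpace.rankOne ℂ y y = diagOp x y 0 1 := by simp [diagOp]
  obtain ⟨hb, h0, h1, h2⟩ := h 0 1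
  rw [vonNeumann_eq (a := 1) (rankOne_self_nonneg y) zero_le_one le_rfl
    (by rw [posTrace_rankOne_self, hy]; simp) (hd ▸ hb), posEntropySum, hd]
  have : ∀ i, ENNReal.ofReal (Real.negMulLog (eigval (diagOp x y 0 1) (b i))) = 0 := by
    intro i
    by_cases e0 : i = z₀
    · rw [e0, h0]; simp
    by_cases e1 : i = z₁
    · rw [e1, h1]; simp
    · rw [h2 i e0 e1]; simp
  simp [this]

lemma posPart_negPart_rankOne_sub (hxy : ⟪x, y⟫_ℂ = 0) :
    (InnerProductSpace.rankOne ℂ y y - InnerProductSpace.rankOne ℂ x x : H →L[ℂ] H)⁺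
        = InnerProductSpace.rankOne ℂ y y ∧
      (InnerProductSpace.rankOne ℂ y y - InnerProductSpace.rankOne ℂ x x : H →L[ℂ] H)⁻
        = InnerProductSpace.rankOne ℂ x x := by
  have hyx : ⟪y, x⟫_ℂ = 0 := by rw [← inner_conj_symm, hxy, map_zero]
  have h := CFC.posPart_negPart_unique
    (a := (InnerProductSpace.rankOne ℂ y y - InnerProductSpace.rankOne ℂ x x : H →L[ℂ] H))
    (b := InnerProductSpace.rankOne ℂ y y) (c := InnerProductSpace.rankOne ℂ x x) rfl
    (by ext v; simp [hyx]) (rankOne_self_nonneg y) (rankOne_self_nonneg x)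
  exact h

end TwoVectors

/-! ### The two-state ensemble -/

section Example

open Classical in
/-- The ensemble of the states `x`, `y` with weights `1 - ε`, `ε` at the positions `i₀`, `i₁`. -/
def twoStateEnsemble {i₀ i₁ : ι} (hi : i₀ ≠ i₁) {x y : H} (hx : ‖x‖ = 1) (hy : ‖y‖ = 1) {ε : ℝ}
    (h0 : 0 < ε) (h1 : ε ≤ 1) : Ensemble ι H where
  p i := if i = i₁ then ε else if i = i₀ then 1 - ε else 0
  p_nonneg i := by split_ifs <;> linarith
  hasSum_p := by
    have h : HasSum (fun i => (if i = i₁ then ε else 0) + (if i = i₀ then 1 - ε else 0))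
        (ε + (1 - ε)) := (hasSum_ite_eq i₁ ε).add (hasSum_ite_eq i₀ (1 - ε))
    convert h using 1
    · ext i
      split_ifs with e1 e2
      · exact absurd (e2.symm.trans e1) hi
      · simp
      · simp
      · simp
    · ring
  state i := if i = i₁ then pureState y hy else pureState x hx

variable {i₀ i₁ : ι} {x y : H} {ε : ℝ}

lemma twoState_p_right (hi : i₀ ≠ i₁) (hx : ‖x‖ = 1) (hy : ‖y‖ = 1)
    (h0 : 0 < ε) (h1 : ε ≤ 1) : (twoStateEnsemble hi hx hy h0 h1).p i₁ = ε := by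
  simp [twoStateEnsemble]

lemma twoState_p_left (hi : i₀ ≠ i₁) (hx : ‖x‖ = 1) (hy : ‖y‖ = 1)
    (h0 : 0 < ε) (h1 : ε ≤ 1) : (twoStateEnsemble hi hx hy h0 h1).p i₀ = 1 - ε := by
  simp [twoStateEnsemble, hi]

lemma twoState_p_of_ne (hi : i₀ ≠ i₁) (hx : ‖x‖ = 1) (hy : ‖y‖ = 1)
    (h0 : 0 < ε) (h1 : ε ≤ 1) {i : ι} (e0 : i ≠ i₀) (e1 : i ≠ i₁) :
    (twoStateEnsemble hi hx hy h0 h1).p i = 0 := by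
  simp [twoStateEnsemble, e0, e1]

lemma twoState_state_right (hi : i₀ ≠ i₁) (hx : ‖x‖ = 1) (hy : ‖y‖ = 1)
    (h0 : 0 < ε) (h1 : ε ≤ 1) : ((twoStateEnsemble hi hx hy h0 h1).state i₁).op
    = InnerProductSpace.rankOne ℂ y y := by
  simp [twoStateEnsemble, pureState]

lemma twoState_state_of_ne (hi : i₀ ≠ i₁) (hx : ‖x‖ = 1) (hy : ‖y‖ = 1)
    (h0 : 0 < ε) (h1 : ε ≤ 1) {i : ι} (e1 : i ≠ i₁) :
    ((twoStateEnsemble hi hx hy h0 h1).state i).op = InnerProductSpace.rankOne ℂ x x := by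
  simp [twoStateEnsemble, pureState, e1]

lemma twoState_diff_right (hi : i₀ ≠ i₁) (hx : ‖x‖ = 1) (hy : ‖y‖ = 1)
    (h0 : 0 < ε) (h1 : ε ≤ 1) : (twoStateEnsemble hi hx hy h0 h1).diff (pureState x hx) i₁
    = InnerProductSpace.rankOne ℂ y y - InnerProductSpace.rankOne ℂ x x := by
  rw [Ensemble.diff, twoState_state_right]; rfl

lemma twoState_excess_of_ne (hi : i₀ ≠ i₁) (hx : ‖x‖ = 1) (hy : ‖y‖ = 1)
    (h0 : 0 < ε) (h1 : ε ≤ 1) {i : ι} (e1 : i ≠ i₁) :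
    (twoStateEnsemble hi hx hy h0 h1).excess (pureState x hx) i = 0 := by
  have h : (twoStateEnsemble hi hx hy h0 h1).diff (pureState x hx) i = 0 := by
    rw [Ensemble.diff, twoState_state_of_ne hi hx hy h0 h1 e1]; exact sub_self _
  simp [Ensemble.excess, h, traceNorm]

lemma twoState_excess_right (hi : i₀ ≠ i₁) (hx : ‖x‖ = 1) (hy : ‖y‖ = 1) (hxy : ⟪x, y⟫_ℂ = 0)
    (h0 : 0 < ε) (h1 : ε ≤ 1) :
    (twoStateEnsemble hi hx hy h0 h1).excess (pureState x hx) i₁ = 1 := by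
  have h := (twoStateEnsemble hi hx hy h0 h1).posTrace_diff_posPart (pureState x hx) i₁
  rw [twoState_diff_right, (posPart_negPart_rankOne_sub hxy).1, posTrace_rankOne_self, hy,
    one_pow] at h
  exact ((ENNReal.ofReal_eq_ofReal_iff zero_le_one (Ensemble.excess_nonneg _ _ _)).1 h).symm

lemma twoState_eps (hi : i₀ ≠ i₁) (hx : ‖x‖ = 1) (hy : ‖y‖ = 1) (hxy : ⟪x, y⟫_ℂ = 0)
    (h0 : 0 < ε) (h1 : ε ≤ 1) : (twoStateEnsemble hi hx hy h0 h1).eps (pureState x hx) = ε := by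
  rw [← ((twoStateEnsemble hi hx hy h0 h1).hasSum_p_mul_excess (pureState x hx)).tsum_eq,
    tsum_eq_single i₁, twoState_excess_right hi hx hy hxy h0 h1, twoState_p_right, mul_one]
  intro i e1
  rw [twoState_excess_of_ne hi hx hy h0 h1 e1, mul_zero]

lemma twoState_t_right (hi : i₀ ≠ i₁) (hx : ‖x‖ = 1) (hy : ‖y‖ = 1) (hxy : ⟪x, y⟫_ℂ = 0)
    (h0 : 0 < ε) (h1 : ε ≤ 1) : (twoStateEnsemble hi hx hy h0 h1).t (pureState x hx) i₁ = 1 := by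
  rw [Ensemble.t_eq]
  simp only
  rw [twoState_eps hi hx hy hxy, twoState_p_right, twoState_excess_right hi hx hy hxy, mul_one,
    div_self h0.ne']

lemma twoState_t_of_ne (hi : i₀ ≠ i₁) (hx : ‖x‖ = 1) (hy : ‖y‖ = 1)
    (h0 : 0 < ε) (h1 : ε ≤ 1) {i : ι} (e1 : i ≠ i₁) :
    (twoStateEnsemble hi hx hy h0 h1).t (pureState x hx) i = 0 := by
  rw [Ensemble.t_eq]
  simp only
  rw [twoState_excess_of_ne hi hx hy h0 h1 e1, mul_zero, zero_div]

lemma twoState_tauPlus (hi : i₀ ≠ i₁) (hx : ‖x‖ = 1) (hy : ‖y‖ = 1) (hxy : ⟪x, y⟫_ℂ = 0)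
    (h0 : 0 < ε) (h1 : ε ≤ 1) : (twoStateEnsemble hi hx hy h0 h1).tauPlus (pureState x hx) i₁
    = InnerProductSpace.rankOne ℂ y y := by
  rw [Ensemble.tauPlus_eq]
  simp only
  rw [twoState_excess_right hi hx hy hxy, twoState_diff_right,
    (posPart_negPart_rankOne_sub hxy).1, inv_one, one_smul]

lemma twoState_tauMinus (hi : i₀ ≠ i₁) (hx : ‖x‖ = 1) (hy : ‖y‖ = 1) (hxy : ⟪x, y⟫_ℂ = 0)
    (h0 : 0 < ε) (h1 : ε ≤ 1) : (twoStateEnsemble hi hx hy h0 h1).tauMinus (pureState x hx) i₁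
    = InnerProductSpace.rankOne ℂ x x := by
  rw [Ensemble.tauMinus_eq]
  simp only
  rw [twoState_excess_right hi hx hy hxy, twoState_diff_right,
    (posPart_negPart_rankOne_sub hxy).2, inv_one, one_smul]

/-- The average coincides with the only state of nonzero weight. -/
lemma holevo_eq_zero_of_single [TopologicalSpace.SeparableSpace H] {t : ι → ℝ}
    {τ : ι → H →L[ℂ] H} (ht1 : t i₁ = 1) (ht : ∀ i, i ≠ i₁ → t i = 0) (hτ : 0 ≤ τ i₁)
    (htop : posTrace (τ i₁) ≠ ⊤) : holevo t τ = 0 := by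
  have h : ∑' j, t j • τ j = τ i₁ := by
    rw [tsum_eq_single i₁, ht1, one_smul]
    intro i e1
    rw [ht i e1, zero_smul]
  rw [holevo, h, tsum_eq_single i₁, relEntropy_self hτ htop, mul_zero]
  intro i e1
  rw [ht i e1, ENNReal.ofReal_zero, zero_mul]

lemma twoState_shannon (hi : i₀ ≠ i₁) (hx : ‖x‖ = 1) (hy : ‖y‖ = 1) (hxy : ⟪x, y⟫_ℂ = 0)
    (h0 : 0 < ε) (h1 : ε ≤ 1) : shannon (fun i => 1 / 2 * (twoStateEnsemble hi hx hy h0 h1).p i *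
    traceNorm ((twoStateEnsemble hi hx hy h0 h1).diff (pureState x hx) i)) = 0 := by
  have he := twoState_eps hi hx hy hxy h0 h1
  have hpos : 0 < (twoStateEnsemble hi hx hy h0 h1).eps (pureState x hx) := he.symm ▸ h0
  rw [← Ensemble.eps_mul_shannon, shannon_eq (Ensemble.t_nonneg _ _) (Ensemble.t_le_one _ _ hpos),
    (Ensemble.hasSum_t _ _ hpos).tsum_eq]
  have : ∀ i, ENNReal.ofReal (Real.negMulLog
      ((twoStateEnsemble hi hx hy h0 h1).t (pureState x hx) i)) = 0 := by
    intro i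
    by_cases e1 : i = i₁
    · rw [e1, twoState_t_right hi hx hy hxy]; simp
    · rw [twoState_t_of_ne hi hx hy h0 h1 e1]; simp
  simp [this]

variable [TopologicalSpace.SeparableSpace H]

lemma twoState_vonNeumann (hi : i₀ ≠ i₁) (hx : ‖x‖ = 1) (hy : ‖y‖ = 1) (hxy : ⟪x, y⟫_ℂ = 0)
    (h0 : 0 < ε) (h1 : ε ≤ 1) : vonNeumann (∑' i, (twoStateEnsemble hi hx hy h0 h1).p i •
    ((twoStateEnsemble hi hx hy h0 h1).diff (pureState x hx) i)⁺) = 0 := by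
  rw [← Ensemble.eps_mul_vonNeumann, tsum_eq_single i₁, twoState_t_right hi hx hy hxy,
    twoState_tauPlus hi hx hy hxy, one_smul, vonNeumann_rankOne hx hy hxy, mul_zero]
  intro i e1
  rw [twoState_t_of_ne hi hx hy h0 h1 e1, zero_smul]

lemma twoState_chi (hi : i₀ ≠ i₁) (hx : ‖x‖ = 1) (hy : ‖y‖ = 1) (hxy : ⟪x, y⟫_ℂ = 0)
    (h0 : 0 < ε) (h1 : ε ≤ 1) :
    (twoStateEnsemble hi hx hy h0 h1).chi = ENNReal.ofReal (Real.binEntropy ε) := by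
  have hs : ∑' j, (twoStateEnsemble hi hx hy h0 h1).p j •
      ((twoStateEnsemble hi hx hy h0 h1).state j).op = diagOp x y (1 - ε) ε := by
    rw [tsum_eq_add_of_ne hi, twoState_p_left, twoState_p_right, twoState_state_right,
      twoState_state_of_ne hi hx hy h0 h1 hi, diagOp]
    intro i e0 e1
    rw [twoState_p_of_ne hi hx hy h0 h1 e0 e1, zero_smul]
  have dx : InnerProductSpace.rankOne ℂ x x = diagOp x y 1 0 := by simp [diagOp]
  have dy : InnerProductSpace.rankOne ℂ y y = diagOp x y 0 1 := by simp [diagOp]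
  have h1' : 0 ≤ 1 - ε := by linarith
  rw [Ensemble.chi, holevo, hs, tsum_eq_add_of_ne hi, twoState_p_left, twoState_p_right,
    twoState_state_right, twoState_state_of_ne hi hx hy h0 h1 hi, dx, dy,
    relEntropy_diagOp hx hy hxy zero_le_one le_rfl h1' h0.le,
    relEntropy_diagOp hx hy hxy le_rfl zero_le_one h1' h0.le, klTerm_zero_left, klTerm_zero_left]
  · have k2 := klTerm_nonneg_aux zero_le_one h0
    have e2 : klTerm 1 ε = ENNReal.ofReal (1 * Real.log 1 - 1 * Real.log ε + ε - 1) := by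
      rw [klTerm, if_neg (fun h => h0.ne' h.1)]
    -- At `ε = 1` the relative entropy of the first state is infinite, but its weight is zero.
    rcases h1'.eq_or_lt with h | h
    · have : ε = 1 := by linarith
      rw [e2, this]; simp
    · have k1 := klTerm_nonneg_aux zero_le_one h
      have e1 : klTerm 1 (1 - ε)
          = ENNReal.ofReal (1 * Real.log 1 - 1 * Real.log (1 - ε) + (1 - ε) - 1) := by
        rw [klTerm, if_neg (fun h' => h.ne' h'.1)]
      rw [e1, e2, ← ENNReal.ofReal_add k1 h0.le, ← ENNReal.ofReal_add h1' k2,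
        ← ENNReal.ofReal_mul h1', ← ENNReal.ofReal_mul h0.le,
        ← ENNReal.ofReal_add (by positivity) (by positivity),
        Real.binEntropy_eq_negMulLog_add_negMulLog_one_sub, Real.negMulLog, Real.negMulLog,
        Real.log_one]
      congr 1; ring
  · intro i e0 e1
    rw [twoState_p_of_ne hi hx hy h0 h1 e0 e1, ENNReal.ofReal_zero, zero_mul]

end Example

lemma exists_orthonormal_pair (h : 2 ≤ Module.rank ℂ H) :
    ∃ x y : H, ‖x‖ = 1 ∧ ‖y‖ = 1 ∧ ⟪x, y⟫_ℂ = 0 := by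
  obtain ⟨w, b, -⟩ := exists_hilbertBasis ℂ H
  by_cases hw : Subsingleton w
  · exfalso
    have : Finite w := Finite.of_subsingleton
    have := Fintype.ofFinite w
    have hr := rank_eq_card_basis b.toOrthonormalBasis.toBasis
    rw [hr] at h
    have h2 : 2 ≤ Fintype.card w := by exact_mod_cast h
    have := Fintype.card_le_one_iff_subsingleton.2 hw
    omega
  · rw [not_subsingleton_iff_nontrivial] at hw
    obtain ⟨i, j, hij⟩ := hw
    exact ⟨b i, b j, b.orthonormal.1 i, b.orthonormal.1 j, b.orthonormal.2 hij⟩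

/-- An ensemble for which all the upper bounds equal `g(ε)` and the Holevo quantity equals
`h₂(ε)`. -/
theorem exists_ensemble_chi_eq_binEntropy [TopologicalSpace.SeparableSpace H] (hι : Nontrivial ι)
    (hH : 2 ≤ Module.rank ℂ H) {ε : ℝ} (h0 : 0 < ε) (h1 : ε ≤ 1) :
    ∃ (E : Ensemble ι H) (σ : QState H), E.eps σ = ε ∧
      E.chi = ENNReal.ofReal (Real.binEntropy ε) ∧ E.chiPlus σ = 0 ∧ E.chiMinus σ = 0 ∧
      shannon (fun i => 1 / 2 * E.p i * traceNorm (E.diff σ i)) = 0 ∧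
      vonNeumann (∑' i, E.p i • (E.diff σ i)⁺) = 0 := by
  obtain ⟨i₀, i₁, hi⟩ := hι
  obtain ⟨x, y, hx, hy, hxy⟩ := exists_orthonormal_pair hH
  refine ⟨twoStateEnsemble hi hx hy h0 h1, pureState x hx, twoState_eps hi hx hy hxy h0 h1,
    twoState_chi hi hx hy hxy h0 h1, ?_, ?_, twoState_shannon hi hx hy hxy h0 h1,
    twoState_vonNeumann hi hx hy hxy h0 h1⟩
  · refine holevo_eq_zero_of_single (twoState_t_right hi hx hy hxy h0 h1)
      (fun i e1 => twoState_t_of_ne hi hx hy h0 h1 e1) ?_ ?_ <;>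
      rw [twoState_tauPlus hi hx hy hxy]
    · exact rankOne_self_nonneg y
    · simp [posTrace_rankOne_self]
  · refine holevo_eq_zero_of_single (twoState_t_right hi hx hy hxy h0 h1)
      (fun i e1 => twoState_t_of_ne hi hx hy h0 h1 e1) ?_ ?_ <;>
      rw [twoState_tauMinus hi hx hy hxy]
    · exact rankOne_self_nonneg x
    · simp [posTrace_rankOne_self]

/-! ### Tightness -/

/-- The terms `-ε log ε` cancel, so `g(ε) - h₂(ε) = (1 + ε) log (1 + ε) + (1 - ε) log (1 - ε) ≤
2ε²`, while `ε ≤ 1/e` gives `g(ε) ≥ ε`. -/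
lemma one_sub_two_mul_le_binEntropy_div_gFun {ε : ℝ} (h0 : 0 < ε) (h1 : ε ≤ Real.exp (-1)) :
    0 < gFun ε ∧ 1 - 2 * ε ≤ Real.binEntropy ε / gFun ε := by
  have hlog : Real.log ε ≤ -1 := by
    rw [← Real.log_exp (-1)]; exact Real.log_le_log h0 h1
  have hlt : ε < 1 := by
    refine h1.trans_lt ?_
    rw [Real.exp_lt_one_iff]; norm_num
  have l1 : Real.log (1 + ε) ≤ ε := by
    have := Real.log_le_sub_one_of_pos (show 0 < 1 + ε by linarith); linarith
  have l1' : 0 ≤ Real.log (1 + ε) := Real.log_nonneg (by linarith)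
  have l2 : Real.log (1 - ε) ≤ -ε := by
    have := Real.log_le_sub_one_of_pos (show 0 < 1 - ε by linarith); linarith
  have hg := gFun_eq h0.le
  have hgε : ε ≤ gFun ε := by rw [hg]; nlinarith
  have hb : Real.binEntropy ε = -(ε * Real.log ε) - (1 - ε) * Real.log (1 - ε) := by
    rw [Real.binEntropy_eq_negMulLog_add_negMulLog_one_sub, Real.negMulLog, Real.negMulLog]; ring
  have hpos : 0 < gFun ε := h0.trans_le hgε
  refine ⟨hpos, ?_⟩
  rw [le_div_iff₀ hpos]
  have hdiff : gFun ε - Real.binEntropy ε ≤ 2 * ε ^ 2 := by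
    rw [hg, hb]
    nlinarith
  nlinarith

lemma EReal_div_le_one {a b : EReal} (ha : 0 ≤ a) (hab : a ≤ b) : a / b ≤ 1 := by
  induction b with
  | bot => exact absurd (ha.trans hab) (by simp)
  | top => simp
  | coe b =>
    induction a with
    | bot => exact absurd ha (by simp)
    | top => exact absurd hab (by simp)
    | coe a =>
      rw [← EReal.coe_div, ← EReal.coe_one, EReal.coe_le_coe_iff]
      exact div_le_one_of_le₀ (by exact_mod_cast hab)
        (by exact_mod_cast ha.trans hab)

/-- The supremum is approached as `ε → 0`, where the ratio `h₂(ε) / g(ε)` is at least `1 - 2ε`. -/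
lemma isTightBound_of_exists {X : Type*} {S : Set X} {f g : X → EReal}
    (h : ∀ x ∈ S, 0 ≤ f x ∧ f x ≤ g x)
    (hex : ∀ ε : ℝ, 0 < ε → ε ≤ 1 →
      ∃ x ∈ S, f x = (Real.binEntropy ε : EReal) ∧ g x = (gFun ε : EReal)) :
    IsTightBound S f g := by
  refine ⟨h, le_antisymm (iSup₂_le fun x hx => EReal_div_le_one (h x hx).1 (h x hx).2) ?_⟩
  have htend : Filter.Tendsto (fun ε : ℝ => ((1 - 2 * ε : ℝ) : EReal))
      (nhdsWithin 0 (Set.Ioi 0)) (nhds 1) := by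
    have h1 : Filter.Tendsto (fun ε : ℝ => 1 - 2 * ε) (nhds 0) (nhds (1 - 2 * 0)) :=
      (by fun_prop : Continuous fun ε : ℝ => 1 - 2 * ε).tendsto 0
    rw [mul_zero, sub_zero] at h1
    exact ((continuous_coe_real_ereal.tendsto (1 : ℝ)).comp h1).mono_left nhdsWithin_le_nhds
  refine le_of_tendsto htend ?_
  filter_upwards [Ioc_mem_nhdsGT (Real.exp_pos (-1))] with ε hε
  have hε1 : ε ≤ 1 := hε.2.trans (by rw [Real.exp_le_one_iff]; norm_num)
  obtain ⟨x, hx, hf, hg⟩ := hex ε hε.1 hε1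
  refine le_iSup₂_of_le x hx ?_
  rw [hf, hg, ← EReal.coe_div, EReal.coe_le_coe_iff]
  exact (one_sub_two_mul_le_binEntropy_div_gFun hε.1 hε.2).2

/-! ### Passage to extended real numbers -/

/-- Finiteness of `c` excludes `∞ - ∞`. The case `ε = 0` is separate because the product is then
zero even for infinite `b`; for `ε > 0` and `b = ∞` the right side is infinite. -/
lemma EReal_le_mul_sub_add {a b c : ℝ≥0∞} {ε g : ℝ} (hε : 0 ≤ ε) (hg : 0 ≤ g) (hc : c ≠ ⊤)
    (h : a + ENNReal.ofReal ε * c ≤ ENNReal.ofReal ε * b + ENNReal.ofReal g) :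
    (a : EReal) ≤ (ε : EReal) * ((b : EReal) - (c : EReal)) + (g : EReal) := by
  rcases hε.eq_or_lt with rfl | hε0
  · simp only [ENNReal.ofReal_zero, zero_mul, add_zero, zero_add] at h
    rw [EReal.coe_zero, zero_mul, zero_add, ← coe_ofReal_eq_coe hg]
    exact_mod_cast h
  lift c to NNReal using hc
  by_cases hb : b = ⊤
  · have h1 : ((⊤ : ℝ≥0∞) : EReal) - (((c : NNReal) : ℝ≥0∞) : EReal) = ⊤ := by
      rw [EReal.coe_ennreal_top, EReal.coe_nnreal_eq_coe_real]
      exact EReal.top_sub_coe _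
    rw [hb, h1, EReal.coe_mul_top_of_pos hε0, EReal.top_add_coe]
    exact le_top
  lift b to NNReal using hb
  have ha : a ≠ ⊤ := by
    refine ne_top_of_le_ne_top ?_ (le_self_add.trans h)
    exact ENNReal.add_ne_top.2 ⟨ENNReal.mul_ne_top ENNReal.ofReal_ne_top ENNReal.coe_ne_top,
      ENNReal.ofReal_ne_top⟩
  lift a to NNReal using ha
  have h2 := ENNReal.toReal_mono (ENNReal.add_ne_top.2 ⟨ENNReal.mul_ne_top ENNReal.ofReal_ne_top
    ENNReal.coe_ne_top, ENNReal.ofReal_ne_top⟩) h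
  rw [ENNReal.toReal_add ENNReal.coe_ne_top (ENNReal.mul_ne_top ENNReal.ofReal_ne_top
    ENNReal.coe_ne_top), ENNReal.toReal_add (ENNReal.mul_ne_top ENNReal.ofReal_ne_top
    ENNReal.coe_ne_top) ENNReal.ofReal_ne_top, ENNReal.toReal_mul, ENNReal.toReal_mul,
    ENNReal.toReal_ofReal hε, ENNReal.toReal_ofReal hg, ENNReal.coe_toReal, ENNReal.coe_toReal,
    ENNReal.coe_toReal] at h2
  simp only [EReal.coe_nnreal_eq_coe_real]
  rw [← EReal.coe_sub, ← EReal.coe_mul, ← EReal.coe_add, EReal.coe_le_coe_iff]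
  linarith

lemma EReal_mul_sub_le_mul {b c : ℝ≥0∞} {ε : ℝ} (hε : 0 ≤ ε) :
    (ε : EReal) * ((b : EReal) - (c : EReal)) ≤ (ε : EReal) * (b : EReal) := by
  refine mul_le_mul_of_nonneg_left ?_ (by exact_mod_cast hε)
  calc (b : EReal) - (c : EReal) ≤ (b : EReal) - 0 :=
        EReal.sub_le_sub le_rfl (EReal.coe_ennreal_nonneg c)
    _ = b := sub_zero _

lemma abs_toReal_sub_le {a b c : ℝ≥0∞} {ε g : ℝ} (hε : 0 ≤ ε) (hg : 0 ≤ g) (ha : a ≠ ⊤)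
    (hb : b ≠ ⊤) (hc : c ≠ ⊤)
    (h1 : a + ENNReal.ofReal ε * c ≤ ENNReal.ofReal ε * b + ENNReal.ofReal g)
    (h2 : ENNReal.ofReal ε * b ≤ a + ENNReal.ofReal ε * c + ENNReal.ofReal g) :
    |a.toReal - ε * (b.toReal - c.toReal)| ≤ g := by
  have hεb := ENNReal.mul_ne_top (ENNReal.ofReal_ne_top (r := ε)) hb
  have hεc := ENNReal.mul_ne_top (ENNReal.ofReal_ne_top (r := ε)) hc
  have e1 := ENNReal.toReal_mono (ENNReal.add_ne_top.2 ⟨hεb, ENNReal.ofReal_ne_top⟩) h1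
  have e2 := ENNReal.toReal_mono (ENNReal.add_ne_top.2 ⟨ENNReal.add_ne_top.2 ⟨ha, hεc⟩,
    ENNReal.ofReal_ne_top⟩) h2
  rw [ENNReal.toReal_add ha hεc, ENNReal.toReal_add hεb ENNReal.ofReal_ne_top, ENNReal.toReal_mul,
    ENNReal.toReal_mul, ENNReal.toReal_ofReal hε, ENNReal.toReal_ofReal hg] at e1
  rw [ENNReal.toReal_add (ENNReal.add_ne_top.2 ⟨ha, hεc⟩) ENNReal.ofReal_ne_top,
    ENNReal.toReal_add ha hεc, ENNReal.toReal_mul,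
    ENNReal.toReal_mul, ENNReal.toReal_ofReal hε, ENNReal.toReal_ofReal hg] at e2
  rw [abs_le]
  constructor <;> linarith

namespace Ensemble

variable [Countable ι] [TopologicalSpace.SeparableSpace H] (E : Ensemble ι H) (σ : QState H)

lemma chi_and_chiMinus_ne_top (h : E.chiPlus σ ≠ ⊤) : E.chi ≠ ⊤ ∧ E.chiMinus σ ≠ ⊤ := by
  have hb : E.chi + ENNReal.ofReal (E.eps σ) * E.chiMinus σ ≠ ⊤ :=
    ne_top_of_le_ne_top (ENNReal.add_ne_top.2
      ⟨ENNReal.mul_ne_top ENNReal.ofReal_ne_top h, ENNReal.ofReal_ne_top⟩) (E.chi_add_le σ)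
  rw [ENNReal.add_ne_top] at hb
  refine ⟨hb.1, fun ht => ?_⟩
  -- For `ε = 0` finiteness of the product says nothing about `χ⁻`, which vanishes because all
  -- weights `t` do.
  rcases (E.eps_nonneg σ).eq_or_lt with h0 | h0
  · rw [chiMinus_eq_zero E σ h0.symm] at ht
    exact ENNReal.zero_ne_top ht
  · refine hb.2 ?_
    rw [ht, ENNReal.mul_top]
    simpa using h0

lemma coe_chi_le : (E.chi : EReal)
    ≤ (E.eps σ : EReal) * (E.chiPlus σ : EReal) + (gFun (E.eps σ) : EReal) := by
  have h := EReal.coe_ennreal_le_coe_ennreal_iff.2 (E.chi_le σ)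
  rwa [EReal.coe_ennreal_add, EReal.coe_ennreal_mul, coe_ofReal_eq_coe (E.eps_nonneg σ),
    coe_ofReal_eq_coe (gFun_nonneg (E.eps_nonneg σ))] at h

lemma coe_chi_le_of_chiPlus_le {x : EReal} (h : 0 < E.eps σ → (E.chiPlus σ : EReal) ≤ x) :
    (E.chi : EReal) ≤ (E.eps σ : EReal) * x + (gFun (E.eps σ) : EReal) := by
  refine (E.coe_chi_le σ).trans (add_le_add ?_ le_rfl)
  rcases (E.eps_nonneg σ).eq_or_lt with h0 | h0
  · rw [← h0]; simp
  · exact mul_le_mul_of_nonneg_left (h h0) (by exact_mod_cast h0.le)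

end Ensemble

end HolevoBound

end

/-! ### The bounds and their tightness. -/

theorem proposition1 {ι : Type*} [Countable ι]
    {H : Type*} [NormedAddCommGroup H] [InnerProductSpace ℂ H] [CompleteSpace H]
    [TopologicalSpace.SeparableSpace H] :
    (∀ (E : Ensemble ι H) (σ : QState H),
      -- the two-sided inequality, without subtractions, in `[0, ∞]`
      (E.chi + ENNReal.ofReal (E.eps σ) * E.chiMinus σ
          ≤ ENNReal.ofReal (E.eps σ) * E.chiPlus σ + ENNReal.ofReal (gFun (E.eps σ)) ∧
        ENNReal.ofReal (E.eps σ) * E.chiPlus σ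
          ≤ E.chi + ENNReal.ofReal (E.eps σ) * E.chiMinus σ + ENNReal.ofReal (gFun (E.eps σ))) ∧
      -- the inequality between real numbers
      (E.chiPlus σ ≠ ⊤ → E.chi ≠ ⊤ ∧ E.chiMinus σ ≠ ⊤ ∧
        |E.chi.toReal - E.eps σ * ((E.chiPlus σ).toReal - (E.chiMinus σ).toReal)|
          ≤ gFun (E.eps σ)) ∧
      -- the upper bounds
      (E.chiMinus σ ≠ ⊤ →
        (E.chi : EReal) ≤ (E.eps σ : EReal) * ((E.chiPlus σ : EReal) - (E.chiMinus σ : EReal))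
            + (gFun (E.eps σ) : EReal) ∧
        (E.eps σ : EReal) * ((E.chiPlus σ : EReal) - (E.chiMinus σ : EReal))
            + (gFun (E.eps σ) : EReal)
          ≤ (E.eps σ : EReal) * (E.chiPlus σ : EReal) + (gFun (E.eps σ) : EReal)) ∧
      (E.chi : EReal) ≤ (E.eps σ : EReal) * (E.chiPlus σ : EReal) + (gFun (E.eps σ) : EReal) ∧
      ((E.chi : EReal) ≤ (E.eps σ : EReal) * shannon (E.t σ) + (gFun (E.eps σ) : EReal) ∧
        (E.eps σ : EReal) * shannon (E.t σ)
          = shannon fun i => 1 / 2 * E.p i * traceNorm (E.diff σ i)) ∧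
      ((E.chi : EReal) ≤ (E.eps σ : EReal) * vonNeumann (∑' i, E.t σ i • E.tauPlus σ i)
            + (gFun (E.eps σ) : EReal) ∧
        (E.eps σ : EReal) * vonNeumann (∑' i, E.t σ i • E.tauPlus σ i)
          = vonNeumann (∑' i, E.p i • (E.diff σ i)⁺))) ∧
    -- tightness, and the value `h₂(ε)`
    (Nontrivial ι → 2 ≤ Module.rank ℂ H →
      IsTightBound {x : Ensemble ι H × QState H | x.1.chiPlus x.2 ≠ ⊤}
        (fun x => ((|x.1.chi.toReal - x.1.eps x.2 *
          ((x.1.chiPlus x.2).toReal - (x.1.chiMinus x.2).toReal)| : ℝ) : EReal))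
        (fun x => (gFun (x.1.eps x.2) : EReal)) ∧
      IsTightBound {x : Ensemble ι H × QState H | x.1.chiMinus x.2 ≠ ⊤}
        (fun x => (x.1.chi : EReal))
        (fun x => (x.1.eps x.2 : EReal) *
            ((x.1.chiPlus x.2 : EReal) - (x.1.chiMinus x.2 : EReal))
          + (gFun (x.1.eps x.2) : EReal)) ∧
      IsTightBound (Set.univ : Set (Ensemble ι H × QState H))
        (fun x => (x.1.chi : EReal))
        (fun x => (x.1.eps x.2 : EReal) * (x.1.chiPlus x.2 : EReal)
          + (gFun (x.1.eps x.2) : EReal)) ∧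
      IsTightBound (Set.univ : Set (Ensemble ι H × QState H))
        (fun x => (x.1.chi : EReal))
        (fun x => shannon (fun i => 1 / 2 * x.1.p i * traceNorm (x.1.diff x.2 i))
          + (gFun (x.1.eps x.2) : EReal)) ∧
      IsTightBound (Set.univ : Set (Ensemble ι H × QState H))
        (fun x => (x.1.chi : EReal))
        (fun x => vonNeumann (∑' i, x.1.p i • (x.1.diff x.2 i)⁺)
          + (gFun (x.1.eps x.2) : EReal)) ∧
      ∀ ε : ℝ, 0 < ε → ε ≤ 1 → ∃ (E : Ensemble ι H) (σ : QState H),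
        E.eps σ = ε ∧ E.chi ≠ ⊤ ∧ E.chiPlus σ ≠ ⊤ ∧ E.chiMinus σ ≠ ⊤ ∧
        E.chi.toReal - ε * ((E.chiPlus σ).toReal - (E.chiMinus σ).toReal)
          = Real.binEntropy ε) := by
  have habs : ∀ (E : Ensemble ι H) (σ : QState H), E.chiPlus σ ≠ ⊤ →
      |E.chi.toReal - E.eps σ * ((E.chiPlus σ).toReal - (E.chiMinus σ).toReal)|
        ≤ gFun (E.eps σ) := fun E σ h =>
    abs_toReal_sub_le (E.eps_nonneg σ) (gFun_nonneg (E.eps_nonneg σ))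
      (E.chi_and_chiMinus_ne_top σ h).1 h (E.chi_and_chiMinus_ne_top σ h).2
      (E.chi_add_le σ) (E.eps_mul_chiPlus_le σ)
  have hsub : ∀ (E : Ensemble ι H) (σ : QState H), E.chiMinus σ ≠ ⊤ →
      (E.chi : EReal) ≤ (E.eps σ : EReal) * ((E.chiPlus σ : EReal) - (E.chiMinus σ : EReal))
        + (gFun (E.eps σ) : EReal) := fun E σ h =>
    EReal_le_mul_sub_add (E.eps_nonneg σ) (gFun_nonneg (E.eps_nonneg σ)) h (E.chi_add_le σ)
  have hsh := fun (E : Ensemble ι H) (σ : QState H) =>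
    E.coe_chi_le_of_chiPlus_le σ (E.chiPlus_le_shannon σ)
  have hvn := fun (E : Ensemble ι H) (σ : QState H) =>
    E.coe_chi_le_of_chiPlus_le σ (E.chiPlus_le_vonNeumann σ)
  refine ⟨fun E σ => ⟨⟨E.chi_add_le σ, E.eps_mul_chiPlus_le σ⟩,
    fun h => ⟨(E.chi_and_chiMinus_ne_top σ h).1, (E.chi_and_chiMinus_ne_top σ h).2, habs E σ h⟩,
    fun h => ⟨hsub E σ h, add_le_add (EReal_mul_sub_le_mul (E.eps_nonneg σ)) le_rfl⟩,
    E.coe_chi_le σ, ⟨hsh E σ, E.eps_mul_shannon σ⟩, ⟨hvn E σ, E.eps_mul_vonNeumann σ⟩⟩, ?_⟩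
  intro hι hH
  -- One family serves all the tightness claims: on it every upper bound equals `g(ε)` and every
  -- left side equals `h₂(ε)`.
  have hex := fun (ε : ℝ) (h0 : 0 < ε) (h1 : ε ≤ 1) =>
    exists_ensemble_chi_eq_binEntropy (H := H) hι hH h0 h1
  have hbin : ∀ ε : ℝ, 0 < ε → ε ≤ 1 → 0 ≤ Real.binEntropy ε := fun ε h0 h1 =>
    Real.binEntropy_nonneg h0.le h1
  refine ⟨isTightBound_of_exists (fun x hx => ⟨?_, ?_⟩) fun ε h0 h1 => ?_,
    isTightBound_of_exists (fun x hx => ⟨EReal.coe_ennreal_nonneg _, hsub x.1 x.2 hx⟩)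
      fun ε h0 h1 => ?_,
    isTightBound_of_exists (fun x _ => ⟨EReal.coe_ennreal_nonneg _, x.1.coe_chi_le x.2⟩)
      fun ε h0 h1 => ?_,
    isTightBound_of_exists (fun x _ => ⟨EReal.coe_ennreal_nonneg _, ?_⟩) fun ε h0 h1 => ?_,
    isTightBound_of_exists (fun x _ => ⟨EReal.coe_ennreal_nonneg _, ?_⟩) fun ε h0 h1 => ?_,
    fun ε h0 h1 => ?_⟩
  · exact_mod_cast abs_nonneg _
  · exact_mod_cast habs x.1 x.2 hx
  · obtain ⟨E, σ, he, hc, hp, hm, -, -⟩ := hex ε h0 h1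
    refine ⟨(E, σ), by simp [hp], ?_, by rw [he]⟩
    simp [hc, hp, hm, ENNReal.toReal_ofReal (hbin ε h0 h1), abs_of_nonneg (hbin ε h0 h1)]
  · obtain ⟨E, σ, he, hc, hp, hm, -, -⟩ := hex ε h0 h1
    refine ⟨(E, σ), by simp [hm], ?_, by simp [he, hp, hm]⟩
    simp only [hc, coe_ofReal_eq_coe (hbin ε h0 h1)]
  · obtain ⟨E, σ, he, hc, hp, -, -, -⟩ := hex ε h0 h1
    refine ⟨(E, σ), Set.mem_univ _, ?_, by simp [he, hp]⟩
    simp only [hc, coe_ofReal_eq_coe (hbin ε h0 h1)]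
  · rw [← x.1.eps_mul_shannon x.2]
    exact hsh x.1 x.2
  · obtain ⟨E, σ, he, hc, -, -, hs, -⟩ := hex ε h0 h1
    refine ⟨(E, σ), Set.mem_univ _, ?_, by simp only [he, hs, zero_add]⟩
    simp only [hc, coe_ofReal_eq_coe (hbin ε h0 h1)]
  · rw [← x.1.eps_mul_vonNeumann x.2]
    exact hvn x.1 x.2
  · obtain ⟨E, σ, he, hc, -, -, -, hv⟩ := hex ε h0 h1
    refine ⟨(E, σ), Set.mem_univ _, ?_, by simp only [he, hv, zero_add]⟩
    simp only [hc, coe_ofReal_eq_coe (hbin ε h0 h1)]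
  · obtain ⟨E, σ, he, hc, hp, hm, -, -⟩ := hex ε h0 h1
    refine ⟨E, σ, he, by simp [hc], by simp [hp], by simp [hm], ?_⟩
    simp [hc, hp, hm, ENNReal.toReal_ofReal (hbin ε h0 h1)]
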